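/- Notation. For $\alpha>0$, $r>0$, $\mathcal H^{\alpha}_r(\mathbb R^d)$ is the set of functions $f:\mathbb R^d\to\mathbb R$ with partial derivatives of all orders up to $\lceil\alpha\rceil-1$ and $$\sum_{|j|<\alpha}\sup_x|f^{(j)}(x)|+\sum_{\alpha-1\le|j|<\alpha}\ \sup_{x\ne y}\frac{|f^{(j)}(x)-f^{(j)}(y)|}{\|x-y\|^{\alpha-|j|}}\le r ,$$ and $\mathcal H^0_r(\mathbb R^d)$ is the set of (measurable) $f$ with $\sup|f|\le r$. For $U\subset\mathbb R^d$, $\mathcal H^\alpha_r(U)$ is the set of functions on $U$ that extend to an element of $\mathcal H^\alpha_r(\mathbb R^d)$. For probability measures $\mu,\nu$ on $\mathbb R^{D_Y}$ let $d_\gamma(\mu,\nu)=\sup_{f\in\mathcal H^\gamma_1(\mathbb R^{D_Y})}\big|\int f\,d\mu-\int f\,d\nu\big|$. Let $D_Y,D_X\ge1$ and $0\le d_X\le D_X$ be integers, $\alpha_Y,\alpha_X>0$ and $L>0$. Let $\mathcal P^*_1=\mathcal P_1^*(D_Y,D_X,d_X,\alpha_Y,\alpha_X,L)$ be the family of all joint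 laws $\mu^*=\mu^*_X\mu^*_{Y|X}$ on $\mathbb R^{D_X}\times\mathbb R^{D_Y}$ such that 1. the support $\mathcal M_X$ of $\mu_X^*$ lies in the open ball of radius $L$ around $0$ and, for every $0<\varepsilon\le1$, every subset of $\mathcal M_X$ whose distinct points are more than $\varepsilon$ apart has at most $L\varepsilon^{-d_X}$ points; the support of the law of $Y$ lies in the open ball of radius $L$ around $0$; 2. for every $x\in\mathcal M_X$, $\mu^*_{Y|x}$ has a density $u^*(\cdot\,|\,x)\ge 0$ with respect to Lebesgue measure, with $u^*(\cdot\,|\,x)\in\mathcal H^{\alpha_Y}_L(\mathbb R^{D_Y})$ for every $x\in\mathcal M_X$ and $u^*(y\,|\,\cdot)\in\mathcal H^{\alpha_X}_L(\mathcal M_X)$ for every $y\in\mathbb R^{D_Y}$. Theorem (minimax rate under Regime 1). For every $\gamma\ge0$ there is a constant $L_0$ such that for every $L\ge L_0$ there are constants $C,C_1>0$, independent of $n$, such that for all $n\ge L_0$ $$C\Big(n^{-\frac{\alpha_X}{2\alpha_X+d_X}}+n^{-\frac{\alpha_Y+\gamma}{2\alpha_Y+D_Y+\frac{\alpha_Y}{\alpha_X}d_X}}\Big)\le\inf_{\widehat\mu_{Y|X}}\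 \sup_{\mu^*\in\mathcal P^*_1}\mathbb E_{\mu^{*,\otimes n}}\Big[\mathbb E_{\mu_X^*}\big[d_\gamma(\mu^*_{Y|X},\widehat\mu_{Y|X})\big]\Big]$$ $$\le C_1\Big(\ell_n\cdot\Big(\frac n{\log n}\Big)^{-\frac{\alpha_X}{2\alpha_X+d_X}}+\Big(\frac n{\log n}\Big)^{-\frac{\alpha_Y+\gamma}{2\alpha_Y+D_Y+\frac{\alpha_Y}{\alpha_X}d_X}}\Big),$$ where the infimum is over all conditional distribution estimators (Markov kernels from the covariate space to the response space depending measurably on the $n$ i.i.d. observations), and $\ell_n=\sqrt{\log n}$, except that $\ell_n=\log n$ when $d_X\ge1$ and $\gamma=\frac{D_Y\alpha_X}{2\alpha_X+d_X}$ is not an integer. -/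

import Mathlib

open MeasureTheory ProbabilityTheory
open scoped ENNReal

/-- The Euclidean space `ℝ^d` with its Euclidean norm. -/
abbrev Euc (d : ℕ) : Type := EuclideanSpace ℝ (Fin d)

/-- The finite set of multi-indices `j ∈ ℕ^d` with `|j| < α`; see `mem_multiIdx`. -/
noncomputable def multiIdx (d : ℕ) (α : ℝ) : Finset (Fin d → ℕ) :=
  (Fintype.piFinset fun _ : Fin d => Finset.range ⌈α⌉₊).filter
    fun j => ((∑ i, j i : ℕ) : ℝ) < α

theorem mem_multiIdx {d : ℕ} {α : ℝ} {j : Fin d → ℕ} :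
    j ∈ multiIdx d α ↔ ((∑ i, j i : ℕ) : ℝ) < α := by
  unfold multiIdx
  rw [Finset.mem_filter, Fintype.mem_piFinset]
  refine ⟨fun h => h.2, fun h => ⟨fun i => ?_, h⟩⟩
  rw [Finset.mem_range, Nat.lt_ceil]
  refine lt_of_le_of_lt ?_ h
  exact_mod_cast Finset.single_le_sum (f := j) (fun _ _ => Nat.zero_le _) (Finset.mem_univ i)

/-- The mixed partial derivative `f^{(j)}(x)` of a (sufficiently smooth) function `f` on `ℝ^d`: the
derivative of order `|j|` evaluated at the standard basis vectors, `e_i` being used `j i` times. -/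
noncomputable def mixedPartial {d : ℕ} (j : Fin d → ℕ) (f : Euc d → ℝ) (x : Euc d) : ℝ :=
  iteratedFDeriv ℝ (∑ i, j i) f x
    fun m => EuclideanSpace.single (finSigmaFinEquiv.symm m).1 (1 : ℝ)

/-- The Hölder norm of order `α > 0` on `ℝ^d`: the sum of the sup norms of all partial derivatives of
order `|j| < α` and of the Hölder seminorms, with exponent `α - |j| ∈ (0, 1]`, of those of the top
order `α - 1 ≤ |j| < α`. -/
noncomputable def holderNorm {d : ℕ} (α : ℝ) (f : Euc d → ℝ) : ℝ≥0∞ :=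
  (∑ j ∈ multiIdx d α, (⨆ x : Euc d, ENNReal.ofReal |mixedPartial j f x|))
  + (∑ j ∈ (multiIdx d α).filter (fun j => α - 1 ≤ ((∑ i, j i : ℕ) : ℝ)),
      (⨆ (x : Euc d) (y : Euc d) (_ : x ≠ y),
        ENNReal.ofReal (|mixedPartial j f x - mixedPartial j f y|
          / ‖x - y‖ ^ (α - ((∑ i, j i : ℕ) : ℝ)))))

/-- The Hölder ball of smoothness `α ≥ 0` and radius `r` on `ℝ^d`. For `α > 0` the partial
derivatives of all orders `< α` have to exist, that is, up to the order `⌈α⌉ - 1`. -/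
def HolderBall (d : ℕ) (α r : ℝ) : Set (Euc d → ℝ) :=
  {f | (α = 0 → ∀ x, |f x| ≤ r) ∧
    (0 < α → ContDiff ℝ ((⌈α⌉₊ - 1 : ℕ) : ℕ∞) f ∧ holderNorm α f ≤ ENNReal.ofReal r)}

/-- The Hölder ball on a subset `U` of `ℝ^d`: the functions whose restriction to `U` extends to a
member of the Hölder ball on `ℝ^d` (values outside `U` play no role). -/
def HolderBallOn (d : ℕ) (α r : ℝ) (U : Set (Euc d)) : Set (Euc d → ℝ) :=
  {f | ∃ g ∈ HolderBall d α r, Set.EqOn g f U}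

/-- Marginally smooth functions of two variables on `U₁ × U₂`: smooth of order `α₁` in the first
variable for each value of the second one, and of order `α₂` in the second one for each value of the
first one. -/
def MarginalHolderBall (d₁ d₂ : ℕ) (α₁ α₂ r : ℝ) (U₁ : Set (Euc d₁)) (U₂ : Set (Euc d₂)) :
    Set (Euc d₁ → Euc d₂ → ℝ) :=
  {f | (∀ y ∈ U₂, (fun x => f x y) ∈ HolderBallOn d₁ α₁ r U₁) ∧
    ∀ x ∈ U₁, f x ∈ HolderBallOn d₂ α₂ r U₂}

/-- The `γ`-Hölder integral probability metric. Measurability of the test function matters only for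
`γ = 0`, since test functions are continuous for `γ > 0`. -/
noncomputable def holderIPM {d : ℕ} (γ : ℝ) (μ ν : Measure (Euc d)) : ℝ≥0∞ :=
  ⨆ (f : Euc d → ℝ) (_ : f ∈ HolderBall d γ 1) (_ : Measurable f),
    ENNReal.ofReal |∫ y, f y ∂μ - ∫ y, f y ∂ν|

/-- `M ⊆ ℝ^D` has Minkowski dimension at most `d` with constant `L`: it lies in the open ball of
radius `L`, and for `0 < ε ≤ 1` each of its `ε`-packings has at most `L ε^{-d}` points. -/
def MinkowskiDimAtMost (D d : ℕ) (L : ℝ) (M : Set (Euc D)) : Prop :=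
  M ⊆ Metric.ball 0 L ∧
    ∀ ε : ℝ, 0 < ε → ε ≤ 1 → ∀ P : Finset (Euc D), (P : Set (Euc D)) ⊆ M →
      (∀ x ∈ P, ∀ x' ∈ P, x ≠ x' → ε < ‖x - x'‖) → (P.card : ℝ) ≤ L * ε ^ (-(d : ℝ))

/-- The distribution family of density regression with Euclidean response. A joint law is given by
the covariate law `μX` and a version `κ` of the conditional law of the response; the joint law is
`μX ⊗ₘ κ`. -/
structure Regime1 (DY DX dX : ℕ) (αY αX L : ℝ)
    (μX : Measure (Euc DX)) (κ : Kernel (Euc DX) (Euc DY)) : Prop where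
  isProbabilityMeasure : IsProbabilityMeasure μX
  isMarkovKernel : IsMarkovKernel κ
  minkowski : MinkowskiDimAtMost DX dX L μX.support
  support_snd : (μX ⊗ₘ κ).snd.support ⊆ Metric.ball 0 L
  density : ∃ u : Euc DY → Euc DX → ℝ,
    (∀ x ∈ μX.support, (∀ y, 0 ≤ u y x) ∧
      κ x = volume.withDensity fun y => ENNReal.ofReal (u y x)) ∧
    u ∈ MarginalHolderBall DY DX αY αX L Set.univ μX.support

/-- An estimator of the conditional law from `n` observations: a Markov kernel that sends a sample
`s` and a covariate value `x` to a probability measure on the response space. -/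
abbrev CondEstimator (DY DX n : ℕ) : Type :=
  Kernel ((Fin n → Euc DX × Euc DY) × Euc DX) (Euc DY)

/-- The risk in expected `γ`-Hölder metric under `n` i.i.d. observations of `μX ⊗ₘ κ`. -/
noncomputable def ipmRisk {DY DX n : ℕ} (γ : ℝ) (est : CondEstimator DY DX n)
    (μX : Measure (Euc DX)) (κ : Kernel (Euc DX) (Euc DY)) : ℝ≥0∞ :=
  ∫⁻ s, ∫⁻ x, holderIPM γ (κ x) (est (s, x)) ∂μX ∂(Measure.pi fun _ : Fin n => μX ⊗ₘ κ)

/-- The minimax risk over the family `Regime1`. -/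
noncomputable def condMinimaxRisk (DY DX dX : ℕ) (αY αX L γ : ℝ) (n : ℕ) : ℝ≥0∞ :=
  ⨅ (est : CondEstimator DY DX n) (_ : IsMarkovKernel est),
    ⨆ (μX : Measure (Euc DX)) (κ : Kernel (Euc DX) (Euc DY))
      (_ : Regime1 DY DX dX αY αX L μX κ), ipmRisk γ est μX κ

open Classical in
/-- The logarithmic factor in front of the regression rate: `√(log n)`, except in the case
`d_X ≥ 1`, `γ = D_Y α_X / (2 α_X + d_X) ∉ ℕ`, where it is `log n`. -/
noncomputable def logFactor (DY dX : ℕ) (αX γ : ℝ) (n : ℕ) : ℝ :=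
  if 1 ≤ dX ∧ γ = DY * αX / (2 * αX + dX) ∧ ∀ k : ℕ, γ ≠ k then Real.log n
  else √(Real.log n)

/-!
The theorem combines a lower bound by perturbation of a fixed density and an upper bound by an
explicit estimator.

*Lower bound.* On the uniform distribution of a grid of mesh `1 / m'` in a `d_X`-dimensional
coordinate subspace, the density of the response is perturbed by `a ∑ ω_{jk} φ_j(x) ψ_k(y)`, with
signs `ω_{jk}` and disjoint bumps of side `1 / m'` in `x` and `1 / m` in `y`. The perturbed laws
belong to the family as soon as `a ≲ m ^ (-α_Y)` and `a ≲ m' ^ (-α_X)`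
(`Perturbation.exists_regime1_kernel`), and no sign can be recovered from `n` observations if
`n a ^ 2 ≲ m ^ D_Y m' ^ d_X` (`assouad`, from a `χ²` computation). The test functions
`m ^ (-γ) ∑ ± ψ_k` then show that the risk is at least of order `a m ^ (-γ)`
(`exists_le_condMinimaxRisk`). The choice `m = 1` gives the first rate, and
`m ^ α_Y ∼ m' ^ α_X`, `m ∼ n ^ (1 / (2 α_Y + D_Y + d_X α_Y / α_X))` the second one.

*Upper bound.* All densities are supported in a ball, hence are functions on a torus. Finite
differences bound the Fourier coefficients of a Hölder function of order `γ`, level by level: those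
with frequencies of size about `2 ^ j` have square sum of order `2 ^ (-2 j γ)`
(`exists_sum_shell_boxCoeff_le`), and for an integer `γ` the sum of `2 ^ (2 j γ)` times these square
sums stays bounded over all levels (`exists_sum_boxCoeff_le`). Hence the `γ`-Hölder metric between
two densities is bounded by a weighted Euclidean distance of their Fourier coefficients up to a
level `J`, plus `2 ^ (-J (α_Y + γ))` (`holderIPM_le_of_weights`, `holderIPM_le_of_nat`). For a fixed
frequency, the Fourier coefficient of the conditional density is a regression function of the
covariate. It is estimated by Forster–Warmuth regression on piecewise polynomials, whose risk bound
needs no assumption on the distribution of the design (`lintegral_fwPredict_sq_sub_le`); the side of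
the cells depends on the level. By Bessel's inequality the squared biases sum up to the square of
the sup norm of the approximation error of the density, so that they are not multiplied with the
number of frequencies (`exists_sum_fwCoeff_risk_le`). The estimator of the conditional law is the
nearest density of the class, up to measurable selection (`exists_condMinimaxRisk_le`). Geometric
weights over the levels balance the regression error against the size of the test functions; the
number of levels, that is `log n`, enters only at the critical smoothness
`γ = D_Y α_X / (2 α_X + d_X)`, and only by its square root if that is an integer
(`exists_condMinimaxRisk_le_rate`).
-/

/-! ### Mixed partial derivatives and Hölder balls -/

/-- Symmetry of the iterated derivative of a function of class `C^n` over `ℝ`. It suffices to treat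
transpositions of neighbours; those that move the outermost derivative reduce to the symmetry of
second derivatives, the others to the statement of lower order. -/
theorem iteratedFDeriv_perm_of_contDiff {E F : Type*} [NormedAddCommGroup E] [NormedSpace ℝ E]
    [NormedAddCommGroup F] [NormedSpace ℝ F] (n : ℕ) {f : E → F} (hf : ContDiff ℝ n f)
    (x : E) (v : Fin n → E) (σ : Equiv.Perm (Fin n)) :
    iteratedFDeriv ℝ n f x (v ∘ σ) = iteratedFDeriv ℝ n f x v := by
  induction n generalizing x with
  | zero =>
    congr 1
    exact Subsingleton.elim _ _
  | succ n ih =>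
    have hfn : ContDiff ℝ n f := hf.of_le (by exact_mod_cast Nat.le_succ n)
    have hσ : σ ∈ Submonoid.closure
        (Set.range fun i : Fin n ↦ Equiv.swap i.castSucc i.succ) := by
      rw [Equiv.Perm.mclosure_swap_castSucc_succ]; trivial
    induction hσ using Submonoid.closure_induction generalizing v with
    | one => rfl
    | mul a b _ _ ha hb =>
      have : v ∘ ⇑(a * b) = (v ∘ a) ∘ b := rfl
      rw [this, hb, ha]
    | mem τ hτ =>
      obtain ⟨i, rfl⟩ := hτ
      have hd : DifferentiableAt ℝ (iteratedFDeriv ℝ n f) x :=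
        (hf.differentiable_iteratedFDeriv (by exact_mod_cast Nat.lt_succ_self n)) x
      have key : ∀ (a : E) (w : Fin n → E),
          (fderiv ℝ (iteratedFDeriv ℝ n f) x a) w
            = fderiv ℝ (fun y => iteratedFDeriv ℝ n f y w) x a := by
        intro a w
        rw [fderiv_continuousMultilinear_apply_const_apply hd]
      cases n with
      | zero => exact i.elim0
      | succ n =>
      induction i using Fin.cases with
      | succ i =>
        have h0 : (v ∘ Equiv.swap (Fin.succ i).castSucc (Fin.succ i).succ) 0 = v 0 := by
          simp only [Function.comp_apply]
          rw [Equiv.swap_apply_of_ne_of_ne]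
          · exact fun h => by simp [Fin.ext_iff] at h
          · exact fun h => by simp [Fin.ext_iff] at h
        have hτ : Fin.tail (v ∘ Equiv.swap (Fin.succ i).castSucc (Fin.succ i).succ)
              = Fin.tail v ∘ Equiv.swap i.castSucc i.succ := by
          funext l
          simp only [Fin.tail, Function.comp_apply]
          congr 1
          rw [← Fin.succ_castSucc]
          exact (Fin.succ_injective _).swap_apply i.castSucc i.succ l
        rw [iteratedFDeriv_succ_apply_left, iteratedFDeriv_succ_apply_left, h0, hτ, key, key]
        congr 2
        ext y
        exact ih hfn y _ _
      | zero =>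
        have hg : ContDiff ℝ 2 (iteratedFDeriv ℝ n f) :=
          hf.iteratedFDeriv_right (by norm_cast; omega)
        have hgd : Differentiable ℝ (fderiv ℝ (iteratedFDeriv ℝ n f)) :=
          (hg.fderiv_right (m := 1) (by norm_num)).differentiable (by norm_num)
        have hs : IsSymmSndFDerivAt ℝ (iteratedFDeriv ℝ n f) x :=
          hg.contDiffAt.isSymmSndFDerivAt (by simp)
        have h2 : ∀ w : Fin (n + 2) → E, iteratedFDeriv ℝ (n + 2) f x w
            = (fderiv ℝ (fderiv ℝ (iteratedFDeriv ℝ n f)) x (w 0) (w 1)) (Fin.tail (Fin.tail w)) := by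
          intro w
          rw [iteratedFDeriv_succ_apply_left, key]
          have : (fun y => iteratedFDeriv ℝ (n + 1) f y (Fin.tail w))
              = fun y => (fderiv ℝ (iteratedFDeriv ℝ n f) y (w 1)) (Fin.tail (Fin.tail w)) := by
            funext y
            rw [iteratedFDeriv_succ_apply_left]
            rfl
          rw [this, fderiv_continuousMultilinear_apply_const_apply
            ((hgd x).clm_apply (differentiableAt_const _)), fderiv_clm_apply (hgd x)
            (differentiableAt_const _)]
          simp
        have e0 : (v ∘ Equiv.swap (Fin.castSucc (0 : Fin (n + 1))) (Fin.succ 0)) 0 = v 1 := by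
          simp
        have e1 : (v ∘ Equiv.swap (Fin.castSucc (0 : Fin (n + 1))) (Fin.succ 0)) 1 = v 0 := by
          simp
        have e2 : Fin.tail (Fin.tail (v ∘ Equiv.swap (Fin.castSucc (0 : Fin (n + 1))) (Fin.succ 0)))
            = Fin.tail (Fin.tail v) := by
          funext l
          simp only [Fin.tail, Function.comp_apply]
          rw [Equiv.swap_apply_of_ne_of_ne]
          · exact fun h => by simp [Fin.ext_iff] at h
          · exact fun h => by simp [Fin.ext_iff] at h
        rw [h2, h2, e0, e1, e2, hs.eq]

/-- An iterated derivative along standard basis vectors, in any order, is a mixed partial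
derivative; the multi-index counts how often each direction occurs. -/
theorem exists_mixedPartial_eq {d : ℕ} (k : ℕ) (m : Fin k → Fin d) :
    ∃ j : Fin d → ℕ, ∑ i, j i = k ∧ ∀ f : Euc d → ℝ, ContDiff ℝ k f → ∀ x,
      mixedPartial j f x
        = iteratedFDeriv ℝ k f x fun l => EuclideanSpace.single (m l) (1 : ℝ) := by
  classical
  let j : Fin d → ℕ := fun i => Fintype.card {l // m l = i}
  have hj : ∑ i, j i = k := by
    have := Fintype.card_congr (Equiv.sigmaFiberEquiv m)
    rw [Fintype.card_sigma, Fintype.card_fin] at this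
    exact this
  let e : Fin k ≃ Fin (∑ i, j i) :=
    (Equiv.sigmaFiberEquiv m).symm.trans
      ((Equiv.sigmaCongrRight fun i => Fintype.equivFin {l // m l = i}).trans finSigmaFinEquiv)
  have he : ∀ l, (finSigmaFinEquiv.symm (e l)).1 = m l := by
    intro l
    simp [e, Equiv.sigmaFiberEquiv]
  refine ⟨j, hj, fun f hf x => ?_⟩
  unfold mixedPartial
  have gen : ∀ (N : ℕ) (hN : N = k) (e : Fin k ≃ Fin N) (w : Fin N → Fin d)
      (_ : ∀ l, w (e l) = m l),
      (iteratedFDeriv ℝ N f x fun l => EuclideanSpace.single (w l) (1 : ℝ))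
        = iteratedFDeriv ℝ k f x fun l => EuclideanSpace.single (m l) (1 : ℝ) := by
    intro N hN e w hw
    subst hN
    rw [← iteratedFDeriv_perm_of_contDiff _ hf x _ e]
    congr 1
    funext l
    simp [hw]
  exact gen _ hj e _ he

theorem lt_of_lt_ceil_top {α : ℝ} {k : ℕ} (hk : k < ⌈α⌉₊) : (k : ℝ) < α := Nat.lt_ceil.1 hk

theorem le_top_add_one {α : ℝ} (hα : 0 < α) : α ≤ ((⌈α⌉₊ - 1 : ℕ) : ℝ) + 1 := by
  have h1 : 1 ≤ ⌈α⌉₊ := Nat.one_le_ceil_iff.2 hα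
  have := Nat.le_ceil α
  push_cast [h1]
  linarith

theorem top_lt {α : ℝ} (hα : 0 < α) : ((⌈α⌉₊ - 1 : ℕ) : ℝ) < α :=
  lt_of_lt_ceil_top (Nat.sub_lt (Nat.ceil_pos.2 hα) one_pos)

section HolderBall

variable {d : ℕ} {α r : ℝ} {f : Euc d → ℝ}

theorem HolderBall.contDiff (hα : 0 < α) (hf : f ∈ HolderBall d α r) :
    ContDiff ℝ ((⌈α⌉₊ - 1 : ℕ) : ℕ∞) f := (hf.2 hα).1

theorem HolderBall.contDiff_of_lt (hα : 0 < α) (hf : f ∈ HolderBall d α r) {k : ℕ}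
    (hk : k < ⌈α⌉₊) : ContDiff ℝ k f :=
  (HolderBall.contDiff hα hf).of_le (by
    have : k ≤ ⌈α⌉₊ - 1 := by omega
    exact_mod_cast this)

theorem HolderBall.abs_mixedPartial_le (hα : 0 < α) (hr : 0 ≤ r) (hf : f ∈ HolderBall d α r)
    {j : Fin d → ℕ} (hj : ((∑ i, j i : ℕ) : ℝ) < α) (x : Euc d) :
    |mixedPartial j f x| ≤ r := by
  have h := (hf.2 hα).2
  unfold holderNorm at h
  have h1 := le_trans le_self_add h
  have h2 := le_trans (Finset.single_le_sum (f := fun j => ⨆ x : Euc d,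
    ENNReal.ofReal |mixedPartial j f x|) (fun _ _ => zero_le) (mem_multiIdx.2 hj)) h1
  have h3 := le_trans (le_iSup (fun x : Euc d => ENNReal.ofReal |mixedPartial j f x|) x) h2
  exact (ENNReal.ofReal_le_ofReal_iff hr).1 h3

theorem HolderBall.abs_mixedPartial_sub_le (hα : 0 < α) (hr : 0 ≤ r) (hf : f ∈ HolderBall d α r)
    {j : Fin d → ℕ} (hj : ((∑ i, j i : ℕ) : ℝ) < α) (hj' : α - 1 ≤ ((∑ i, j i : ℕ) : ℝ))
    (x y : Euc d) :
    |mixedPartial j f x - mixedPartial j f y|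
      ≤ r * ‖x - y‖ ^ (α - ((∑ i, j i : ℕ) : ℝ)) := by
  by_cases hxy : x = y
  · subst hxy
    rw [sub_self, abs_zero]
    positivity
  have h := (hf.2 hα).2
  unfold holderNorm at h
  have h1 := le_trans le_add_self h
  have h2 := le_trans (Finset.single_le_sum (f := fun j : Fin d → ℕ =>
    ⨆ (x : Euc d) (y : Euc d) (_ : x ≠ y),
        ENNReal.ofReal (|mixedPartial j f x - mixedPartial j f y|
          / ‖x - y‖ ^ (α - ((∑ i, j i : ℕ) : ℝ)))) (fun _ _ => zero_le)
    (Finset.mem_filter.2 ⟨mem_multiIdx.2 hj, hj'⟩)) h1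
  have h3 := le_trans (le_iSup_of_le x (le_iSup_of_le y (le_iSup_of_le hxy le_rfl))) h2
  have h4 := (ENNReal.ofReal_le_ofReal_iff hr).1 h3
  have : 0 < ‖x - y‖ ^ (α - ((∑ i, j i : ℕ) : ℝ)) :=
    Real.rpow_pos_of_pos (norm_pos_iff.2 (sub_ne_zero.2 hxy)) _
  rwa [div_le_iff₀ this] at h4

theorem HolderBall.abs_iteratedFDeriv_le (hα : 0 < α) (hr : 0 ≤ r) (hf : f ∈ HolderBall d α r)
    {k : ℕ} (hk : k < ⌈α⌉₊) (m : Fin k → Fin d) (x : Euc d) :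
    |iteratedFDeriv ℝ k f x fun l => EuclideanSpace.single (m l) (1 : ℝ)| ≤ r := by
  obtain ⟨j, hj, h⟩ := exists_mixedPartial_eq k m
  rw [← h f (HolderBall.contDiff_of_lt hα hf hk)]
  exact HolderBall.abs_mixedPartial_le hα hr hf (by rw [hj]; exact lt_of_lt_ceil_top hk) x

theorem HolderBall.abs_iteratedFDeriv_sub_le (hα : 0 < α) (hr : 0 ≤ r)
    (hf : f ∈ HolderBall d α r) (m : Fin (⌈α⌉₊ - 1) → Fin d) (x y : Euc d) :
    |(iteratedFDeriv ℝ (⌈α⌉₊ - 1) f x fun l => EuclideanSpace.single (m l) (1 : ℝ))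
        - iteratedFDeriv ℝ (⌈α⌉₊ - 1) f y fun l => EuclideanSpace.single (m l) (1 : ℝ)|
      ≤ r * ‖x - y‖ ^ (α - ((⌈α⌉₊ - 1 : ℕ) : ℝ)) := by
  obtain ⟨j, hj, h⟩ := exists_mixedPartial_eq _ m
  have hk : ⌈α⌉₊ - 1 < ⌈α⌉₊ := Nat.sub_lt (Nat.ceil_pos.2 hα) one_pos
  rw [← h f (HolderBall.contDiff_of_lt hα hf hk), ← h f (HolderBall.contDiff_of_lt hα hf hk)]
  have := HolderBall.abs_mixedPartial_sub_le hα hr hf (j := j)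
    (by rw [hj]; exact lt_of_lt_ceil_top hk) (by rw [hj]; linarith [le_top_add_one hα]) x y
  rwa [hj] at this

theorem HolderBall.abs_le (hα : 0 ≤ α) (hr : 0 ≤ r) (hf : f ∈ HolderBall d α r) (x : Euc d) :
    |f x| ≤ r := by
  rcases hα.eq_or_lt with h | h
  · exact hf.1 h.symm x
  · simpa using HolderBall.abs_iteratedFDeriv_le h hr hf (k := 0) (Nat.ceil_pos.2 h)
      Fin.elim0 x

end HolderBall

/-- Derivatives of the restriction of a function to a line. -/
theorem iteratedDeriv_comp_line {E : Type*} [NormedAddCommGroup E] [NormedSpace ℝ E]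
    {f : E → ℝ} (k : ℕ) (hf : ContDiff ℝ k f) (x v : E) (t : ℝ) :
    iteratedDeriv k (fun t : ℝ => f (x + t • v)) t
      = iteratedFDeriv ℝ k f (x + t • v) fun _ => v := by
  induction k generalizing t with
  | zero => simp
  | succ k ih =>
    have hk : ContDiff ℝ k f := hf.of_le (by exact_mod_cast Nat.le_succ k)
    rw [iteratedDeriv_succ]
    have : iteratedDeriv k (fun t : ℝ => f (x + t • v))
        = fun t => iteratedFDeriv ℝ k f (x + t • v) fun _ => v := by
      funext t; exact ih hk t
    rw [this, iteratedFDeriv_succ_apply_left]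
    have hd : DifferentiableAt ℝ (iteratedFDeriv ℝ k f) (x + t • v) :=
      (hf.differentiable_iteratedFDeriv (by exact_mod_cast Nat.lt_succ_self k)) _
    have hl : HasDerivAt (fun t : ℝ => x + t • v) v t := by
      simpa using ((hasDerivAt_id t).smul_const v).const_add x
    have h1 := hd.hasFDerivAt.comp_hasDerivAt t hl
    have h2 := (ContinuousMultilinearMap.apply ℝ (fun _ : Fin k => E) ℝ
      (fun _ => v)).hasFDerivAt.comp_hasDerivAt t h1
    exact h2.deriv

/-- Expansion of a multilinear form on `ℝ^d` in the standard basis. -/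
theorem multilinear_apply_eq_sum {d k : ℕ} (A : ContinuousMultilinearMap ℝ (fun _ : Fin k => Euc d) ℝ)
    (v : Euc d) :
    A (fun _ => v) = ∑ m : Fin k → Fin d,
      A (fun l => EuclideanSpace.single (m l) (1 : ℝ)) * ∏ l, v (m l) := by
  have hv : v = ∑ i, v i • EuclideanSpace.single i (1 : ℝ) := by
    have := (EuclideanSpace.basisFun (Fin d) ℝ).sum_repr v
    simpa using this.symm
  conv_lhs => rw [hv]
  rw [ContinuousMultilinearMap.map_sum]
  refine Finset.sum_congr rfl fun m _ => ?_
  rw [ContinuousMultilinearMap.map_smul_univ, smul_eq_mul, mul_comm]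

/-- The Taylor polynomial at `x₀`, of degree `⌈α⌉ - 1`, approximates a function of a Hölder ball of
order `α` up to a multiple of `‖x - x₀‖ ^ α`. -/
theorem HolderBall.taylor {d : ℕ} {α r : ℝ} {f : Euc d → ℝ} (hα : 0 < α) (hr : 0 ≤ r)
    (hf : f ∈ HolderBall d α r) (x₀ x : Euc d) :
    |f x - ∑ k ∈ Finset.range ⌈α⌉₊, ∑ m : Fin k → Fin d,
      ((k.factorial : ℝ)⁻¹ * iteratedFDeriv ℝ k f x₀ fun l => EuclideanSpace.single (m l) (1 : ℝ))
        * ∏ l, (x - x₀) (m l)|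
      ≤ (d : ℝ) ^ (⌈α⌉₊ - 1) * r * ‖x - x₀‖ ^ α := by
  set v := x - x₀ with hv
  set k := ⌈α⌉₊ - 1 with hk
  have hk1 : ⌈α⌉₊ = k + 1 := by
    have := Nat.ceil_pos.2 hα; omega
  have hfk : ContDiff ℝ k f := HolderBall.contDiff_of_lt hα hf (by omega)
  set g : ℝ → ℝ := fun t => f (x₀ + t • v) with hg
  have hg_cd : ContDiff ℝ k g := hfk.comp (by fun_prop)
  have hg1 : g 1 = f x := by simp [hg, hv]
  have hder : ∀ l ≤ k, ∀ t, iteratedDeriv l g t = iteratedFDeriv ℝ l f (x₀ + t • v) fun _ => v :=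
    fun l hl t => iteratedDeriv_comp_line l (hfk.of_le (by exact_mod_cast hl)) x₀ v t
  have hsum : ∑ k ∈ Finset.range ⌈α⌉₊, ∑ m : Fin k → Fin d,
      ((k.factorial : ℝ)⁻¹ * iteratedFDeriv ℝ k f x₀ fun l => EuclideanSpace.single (m l) (1 : ℝ))
        * ∏ l, v (m l)
      = ∑ l ∈ Finset.range (k + 1), (l.factorial : ℝ)⁻¹ * iteratedDeriv l g 0 := by
    rw [hk1]
    refine Finset.sum_congr rfl fun l hl => ?_
    rw [hder l (by simp at hl; omega), multilinear_apply_eq_sum, Finset.mul_sum]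
    simp only [zero_smul, add_zero, mul_assoc]
  have hincr : ∀ t ∈ Set.Icc (0 : ℝ) 1, |iteratedDeriv k g t - iteratedDeriv k g 0|
      ≤ (d : ℝ) ^ k * r * ‖v‖ ^ α := by
    intro t ht
    rw [hder k le_rfl, hder k le_rfl, multilinear_apply_eq_sum, multilinear_apply_eq_sum,
      ← Finset.sum_sub_distrib]
    refine (Finset.abs_sum_le_sum_abs _ _).trans ?_
    have hterm : ∀ m : Fin k → Fin d,
        |(iteratedFDeriv ℝ k f (x₀ + t • v) fun l => EuclideanSpace.single (m l) (1 : ℝ))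
            * ∏ l, v (m l)
          - (iteratedFDeriv ℝ k f (x₀ + (0 : ℝ) • v) fun l => EuclideanSpace.single (m l) (1 : ℝ))
            * ∏ l, v (m l)| ≤ r * ‖v‖ ^ α := by
      intro m
      rw [← sub_mul, abs_mul]
      have h1 := HolderBall.abs_iteratedFDeriv_sub_le hα hr hf m (x₀ + t • v) (x₀ + (0 : ℝ) • v)
      have h2 : |∏ l, v (m l)| ≤ ‖v‖ ^ k := by
        rw [Finset.abs_prod]
        refine (Finset.prod_le_prod (fun l _ => abs_nonneg _)
          fun l _ => PiLp.norm_apply_le v (m l)).trans (by simp)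
      have h3 : ‖(x₀ + t • v) - (x₀ + (0 : ℝ) • v)‖ ≤ ‖v‖ := by
        simp only [zero_smul, add_zero, add_sub_cancel_left, norm_smul, Real.norm_eq_abs]
        rw [abs_of_nonneg ht.1]
        exact mul_le_of_le_one_left (norm_nonneg _) ht.2
      have hpos : 0 ≤ α - (k : ℝ) := by have := top_lt hα; linarith
      calc _ ≤ (r * ‖v‖ ^ (α - (k : ℝ))) * ‖v‖ ^ k := by
              refine mul_le_mul (h1.trans ?_) h2 (abs_nonneg _) (by positivity)
              exact mul_le_mul_of_nonneg_left
                (Real.rpow_le_rpow (norm_nonneg _) h3 hpos) hr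
        _ = r * ‖v‖ ^ α := by
              rw [mul_assoc, ← Real.rpow_natCast ‖v‖ k, ← Real.rpow_add_of_nonneg (norm_nonneg _)
                hpos (Nat.cast_nonneg _)]
              congr 2; ring
    refine (Finset.sum_le_sum fun m _ => hterm m).trans ?_
    simp [mul_assoc]
  have hrem : ∃ t ∈ Set.Icc (0 : ℝ) 1,
      g 1 - ∑ l ∈ Finset.range (k + 1), (l.factorial : ℝ)⁻¹ * iteratedDeriv l g 0
        = (k.factorial : ℝ)⁻¹ * (iteratedDeriv k g t - iteratedDeriv k g 0) := by
    rcases Nat.eq_zero_or_pos k with h0 | hpos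
    · exact ⟨1, by simp, by rw [h0]; simp⟩
    · obtain ⟨p, hp⟩ : ∃ p, k = p + 1 := ⟨k - 1, by omega⟩
      obtain ⟨t, ht, h⟩ := taylor_mean_remainder_lagrange_iteratedDeriv (f := g) (x := 1) (x₀ := 0)
        (n := p) zero_ne_one (by rw [hp] at hg_cd; exact_mod_cast hg_cd.contDiffOn)
      have ht' : t ∈ Set.Icc (0 : ℝ) 1 := by
        rw [Set.uIoo_of_lt one_pos] at ht; exact ⟨ht.1.le, ht.2.le⟩
      refine ⟨t, ht', ?_⟩
      rw [Finset.sum_range_succ, ← sub_sub, mul_sub]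
      have hT : taylorWithinEval g p (Set.uIcc 0 1) 0 1
          = ∑ l ∈ Finset.range k, (l.factorial : ℝ)⁻¹ * iteratedDeriv l g 0 := by
        rw [taylor_within_apply, hp]
        refine Finset.sum_congr rfl fun l hl => ?_
        rw [iteratedDerivWithin_eq_iteratedDeriv (uniqueDiffOn_uIcc zero_ne_one)
          ((hg_cd.of_le (by have := Finset.mem_range.1 hl; exact_mod_cast (by omega))).contDiffAt)
          (Set.left_mem_uIcc)]
        simp
      rw [hT, ← hp] at h
      rw [h]
      simp [hp]
      ring
  obtain ⟨t, ht, h⟩ := hrem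
  rw [hsum, ← hg1, h, abs_mul]
  have hfac : |(k.factorial : ℝ)⁻¹| ≤ 1 := by
    rw [abs_of_nonneg (by positivity)]
    exact inv_le_one_of_one_le₀ (by exact_mod_cast Nat.factorial_pos k)
  calc _ ≤ 1 * ((d : ℝ) ^ k * r * ‖v‖ ^ α) :=
        mul_le_mul hfac (hincr t ht) (abs_nonneg _) zero_le_one
    _ = _ := one_mul _

/-! ### Finite differences of Hölder functions -/

/-- Leibniz rule for iterated forward differences, as a bound. -/
theorem abs_fwdDiff_iter_mul_le {E : Type*} [AddCommGroup E] (v : E) (K : ℕ) (f g : E → ℝ) (M : ℝ)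
    (h : ∀ l p, l + p = K → ∀ y y', |(fwdDiff v)^[l] f y| * |(fwdDiff v)^[p] g y'| ≤ M) (y : E) :
    |(fwdDiff v)^[K] (fun z => f z * g z) y| ≤ 2 ^ K * M := by
  induction K generalizing f g with
  | zero => simpa [abs_mul] using h 0 0 rfl y y
  | succ K ih =>
    have hD : fwdDiff v (fun z => f z * g z)
        = (fun z => (fun z => f (z + v)) z * fwdDiff v g z) + fun z => fwdDiff v f z * g z := by
      funext z
      simp only [fwdDiff, Pi.add_apply]
      ring
    rw [Function.iterate_succ_apply, hD, fwdDiff_iter_add, Pi.add_apply]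
    have h1 := ih (fun z => f (z + v)) (fwdDiff v g) (fun l p hlp y y' => by
      rw [fwdDiff_iter_comp_add, ← Function.iterate_succ_apply]
      exact h l (p + 1) (by omega) _ _)
    have h2 := ih (fwdDiff v f) g (fun l p hlp y y' => by
      rw [← Function.iterate_succ_apply]
      exact h (l + 1) p (by omega) _ _)
    calc _ ≤ _ := abs_add_le _ _
      _ ≤ 2 ^ K * M + 2 ^ K * M := add_le_add h1 h2
      _ = _ := by ring

theorem fwdDiff_iter_comp_line {E : Type*} [AddCommGroup E] [Module ℝ E] (f : E → ℝ) (x v : E)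
    (h : ℝ) (n : ℕ) (t : ℝ) :
    (fwdDiff (h • v))^[n] f (x + t • v) = (fwdDiff h)^[n] (fun s : ℝ => f (x + s • v)) t := by
  induction n generalizing f with
  | zero => rfl
  | succ n ih =>
    rw [Function.iterate_succ_apply, Function.iterate_succ_apply, ih]
    have : (fun s : ℝ => fwdDiff (h • v) f (x + s • v))
        = fwdDiff h fun s : ℝ => f (x + s • v) := by
      funext s
      simp [fwdDiff, add_smul, add_assoc]
    rw [this]

/-- The mean value theorem for iterated forward differences. -/
theorem abs_fwdDiff_iter_le {m : ℕ} {g : ℝ → ℝ} {B h : ℝ} (hg : ContDiff ℝ m g)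
    (hB : ∀ t, |iteratedDeriv m g t| ≤ B) (hh : 0 ≤ h) (t : ℝ) :
    |(fwdDiff h)^[m] g t| ≤ h ^ m * B := by
  induction m generalizing g B with
  | zero => simpa using hB t
  | succ m ih =>
    have hgm : ContDiff ℝ m g := hg.of_le (by exact_mod_cast Nat.le_succ m)
    have hshift : ContDiff ℝ m (fun s => g (s + h)) := hgm.comp (by fun_prop)
    have hD : fwdDiff h g = (fun s => g (s + h)) - g := rfl
    rw [Function.iterate_succ_apply, pow_succ, mul_assoc]
    refine ih (by rw [hD]; exact hshift.sub hgm) fun s => ?_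
    rw [hD, iteratedDeriv_sub hshift.contDiffAt hgm.contDiffAt, iteratedDeriv_comp_add_const]
    have hdiff : Differentiable ℝ (iteratedDeriv m g) :=
      hg.differentiable_iteratedDeriv m (by exact_mod_cast Nat.lt_succ_self m)
    have := Convex.norm_image_sub_le_of_norm_deriv_le (f := iteratedDeriv m g) (s := Set.univ)
      (C := B) (x := s) (y := s + h) (fun x _ => hdiff x)
      (fun x _ => by rw [← iteratedDeriv_succ]; exact hB x) convex_univ trivial trivial
    simpa [abs_of_nonneg hh, mul_comm] using this

section

variable {d : ℕ}

/-- Forward differences in a coordinate direction of a function of a Hölder ball: the order of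
vanishing in the step size is that of the difference, capped by the smoothness `γ`. -/
theorem HolderBall.abs_fwdDiff_iter_le {γ r : ℝ} {f : Euc d → ℝ} (hγ : 0 ≤ γ) (hr : 0 ≤ r)
    (hf : f ∈ HolderBall d γ r) (i : Fin d) {h : ℝ} (hh : 0 < h) {p : ℕ} (hp : p ≤ ⌈γ⌉₊)
    (y : Euc d) :
    |(fwdDiff (h • EuclideanSpace.single i (1 : ℝ)))^[p] f y| ≤ r * h ^ min γ p := by
  rcases Nat.eq_zero_or_pos p with h0 | hpos
  · subst h0
    simpa [hγ] using HolderBall.abs_le hγ hr hf y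
  have hγ' : 0 < γ := Nat.ceil_pos.1 (lt_of_lt_of_le hpos hp)
  set e : Euc d := EuclideanSpace.single i (1 : ℝ) with he
  set g : ℝ → ℝ := fun s => f (y + s • e) with hg
  have hline : ∀ n, (fwdDiff (h • e))^[n] f y = (fwdDiff h)^[n] g 0 := fun n => by
    simpa using fwdDiff_iter_comp_line f y e h n 0
  have hcd : ∀ k < ⌈γ⌉₊, ContDiff ℝ k g := fun k hk =>
    (HolderBall.contDiff_of_lt hγ' hf hk).comp (by fun_prop)
  have hder : ∀ k < ⌈γ⌉₊, ∀ t, iteratedDeriv k g t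
      = iteratedFDeriv ℝ k f (y + t • e) fun _ => EuclideanSpace.single i (1 : ℝ) := fun k hk t =>
    iteratedDeriv_comp_line k (HolderBall.contDiff_of_lt hγ' hf hk) y e t
  rcases hp.lt_or_eq with hlt | heq
  · have h1 := _root_.abs_fwdDiff_iter_le (hcd p hlt) (B := r) (fun t => by
      rw [hder p hlt]
      exact HolderBall.abs_iteratedFDeriv_le hγ' hr hf hlt (fun _ => i) _) hh.le 0
    rw [hline]
    refine h1.trans (le_of_eq ?_)
    rw [min_eq_right (lt_of_lt_ceil_top hlt).le, Real.rpow_natCast, mul_comm]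
  · obtain ⟨k, hk⟩ : ∃ k, ⌈γ⌉₊ = k + 1 := ⟨⌈γ⌉₊ - 1, by omega⟩
    have hk' : ⌈γ⌉₊ - 1 = k := by omega
    have hcdk := hcd k (by omega)
    have hshift : ContDiff ℝ k (fun s => g (s + h)) := hcdk.comp (by fun_prop)
    have hD : fwdDiff h g = (fun s => g (s + h)) - g := rfl
    have h1 := _root_.abs_fwdDiff_iter_le (g := fwdDiff h g) (m := k)
      (B := r * h ^ (γ - k)) (h := h) (by rw [hD]; exact hshift.sub hcdk) (fun t => by
        rw [hD, iteratedDeriv_sub hshift.contDiffAt hcdk.contDiffAt, iteratedDeriv_comp_add_const]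
        beta_reduce
        rw [hder k (by omega), hder k (by omega)]
        have := HolderBall.abs_iteratedFDeriv_sub_le hγ' hr hf (fun _ => i) (y + (t + h) • e)
          (y + t • e)
        rw [hk'] at this
        refine this.trans (le_of_eq ?_)
        congr 2
        rw [add_sub_add_left_eq_sub, ← sub_smul, norm_smul, he]
        simp [abs_of_pos hh]) hh.le 0
    rw [hline, heq, hk, Function.iterate_succ_apply]
    refine h1.trans (le_of_eq ?_)
    rw [min_eq_left (by rw [← hk]; exact Nat.le_ceil γ), ← Real.rpow_natCast h k, mul_left_comm,
      ← Real.rpow_add hh]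
    congr 2; ring

/-- Multiplication by a function with bounded derivatives preserves the bound on differences of
order `⌈γ⌉`. -/
theorem HolderBall.abs_fwdDiff_iter_mul_le {γ r A : ℝ} {f χ : Euc d → ℝ} (hγ : 0 ≤ γ) (hr : 0 ≤ r)
    (hf : f ∈ HolderBall d γ r) (i : Fin d) {h : ℝ} (hh : 0 < h) (hh1 : h ≤ 1)
    (hχ : ∀ l ≤ ⌈γ⌉₊, ∀ y,
      |(fwdDiff (h • EuclideanSpace.single i (1 : ℝ)))^[l] χ y| ≤ A * h ^ l) (y : Euc d) :
    |(fwdDiff (h • EuclideanSpace.single i (1 : ℝ)))^[⌈γ⌉₊] (fun z => χ z * f z) y|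
      ≤ 2 ^ ⌈γ⌉₊ * (A * r) * h ^ γ := by
  have hA : 0 ≤ A := by simpa using (abs_nonneg _).trans (hχ 0 (Nat.zero_le _) y)
  refine (_root_.abs_fwdDiff_iter_mul_le _ _ χ f ((A * r) * h ^ γ) (fun l p hlp y y' => ?_) y).trans
    (le_of_eq (by ring))
  have h1 := hχ l (by omega) y
  have h2 := HolderBall.abs_fwdDiff_iter_le hγ hr hf i hh (p := p) (by omega) y'
  calc _ ≤ (A * h ^ l) * (r * h ^ min γ p) := mul_le_mul h1 h2 (abs_nonneg _) (by positivity)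
    _ = (A * r) * h ^ ((l : ℝ) + min γ p) := by
        rw [Real.rpow_add hh, Real.rpow_natCast]; ring
    _ ≤ (A * r) * h ^ γ := by
        refine mul_le_mul_of_nonneg_left (Real.rpow_le_rpow_of_exponent_ge hh hh1 ?_) (by positivity)
        have h3 : γ ≤ (l : ℝ) + p := by
          have := Nat.le_ceil γ
          rw [← hlp] at this
          exact_mod_cast this
        rcases le_total γ p with h4 | h4
        · rw [min_eq_left h4]; linarith [Nat.cast_nonneg (α := ℝ) l]
        · rw [min_eq_right h4]; exact h3

/-- Forward differences of a smooth function of compact support. -/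
theorem exists_abs_fwdDiff_iter_le {χ : Euc d → ℝ} (K : ℕ) (hχ : ContDiff ℝ K χ)
    (hc : HasCompactSupport χ) :
    ∃ A : ℝ, 0 ≤ A ∧ ∀ l ≤ K, ∀ (i : Fin d) (h : ℝ), 0 < h → ∀ y,
      |(fwdDiff (h • EuclideanSpace.single i (1 : ℝ)))^[l] χ y| ≤ A * h ^ l := by
  have hb : ∀ l ≤ K, ∃ B, ∀ x, ‖iteratedFDeriv ℝ l χ x‖ ≤ B := fun l hl => by
    obtain ⟨B, hB⟩ := (hc.iteratedFDeriv (𝕜 := ℝ) l).exists_bound_of_continuous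
      (hχ.continuous_iteratedFDeriv (by exact_mod_cast hl))
    exact ⟨B, hB⟩
  choose! B hB using hb
  have hB0 : ∀ l ≤ K, 0 ≤ B l := fun l hl => (norm_nonneg _).trans (hB l hl 0)
  refine ⟨∑ l ∈ Finset.range (K + 1), B l,
    Finset.sum_nonneg fun l hl => hB0 l (by simp at hl; omega), fun l hl i h hh y => ?_⟩
  set e : Euc d := EuclideanSpace.single i (1 : ℝ) with he
  have hline : (fwdDiff (h • e))^[l] χ y = (fwdDiff h)^[l] (fun s : ℝ => χ (y + s • e)) 0 := by
    simpa using fwdDiff_iter_comp_line χ y e h l 0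
  have hχl : ContDiff ℝ l χ := hχ.of_le (by exact_mod_cast hl)
  rw [hline, mul_comm]
  refine (abs_fwdDiff_iter_le (hχl.comp (by fun_prop)) (fun t => ?_) hh.le 0)
  rw [show (χ ∘ fun s : ℝ => y + s • e) = fun s : ℝ => χ (y + s • e) from rfl,
    iteratedDeriv_comp_line l hχl y e t]
  have h1 := (iteratedFDeriv ℝ l χ (y + t • e)).le_opNorm fun _ => e
  have h2 : ∏ _l : Fin l, ‖e‖ = 1 := by simp [he]
  rw [h2, mul_one, Real.norm_eq_abs] at h1
  refine h1.trans ((hB l hl _).trans ?_)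
  exact Finset.single_le_sum (f := B) (fun l hl => hB0 l (by simp at hl; omega))
    (Finset.mem_range.2 (by omega))

end

/-! ### Fourier coefficients of functions supported in a box -/

/-- The character `y ↦ exp (2πi ⟨k, y⟩ / R)` of `ℝ^d`, of period `R` in each coordinate. -/
noncomputable def boxChar {d : ℕ} (R : ℝ) (k : Fin d → ℤ) (y : Euc d) : ℂ :=
  UnitAddTorus.mFourier k fun i => ((y i / R : ℝ) : UnitAddCircle)

/-- The (unnormalised) Fourier coefficients of a function on `ℝ^d` which is supported in the box of
side `R` around the origin. -/
noncomputable def boxCoeff {d : ℕ} (R : ℝ) (F : Euc d → ℝ) (k : Fin d → ℤ) : ℂ :=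
  ∫ y, boxChar R (-k) y * (F y : ℂ)

section

variable {d : ℕ} {R : ℝ}

theorem continuous_boxChar (k : Fin d → ℤ) : Continuous (boxChar (d := d) R k) := by
  unfold boxChar
  refine (UnitAddTorus.mFourier k).continuous.comp (continuous_pi fun i => ?_)
  exact (AddCircle.continuous_mk' 1).comp (by fun_prop)

theorem norm_boxChar (k : Fin d → ℤ) (y : Euc d) : ‖boxChar R k y‖ = 1 := by
  unfold boxChar
  simp only [UnitAddTorus.mFourier, ContinuousMap.coe_mk, norm_prod, fourier_apply, Circle.norm_coe,
    Finset.prod_const_one]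

theorem boxChar_add (k : Fin d → ℤ) (y v : Euc d) :
    boxChar R k (y + v) = boxChar R k y * boxChar R k v := by
  unfold boxChar
  simp only [UnitAddTorus.mFourier, ContinuousMap.coe_mk]
  rw [← Finset.prod_mul_distrib]
  refine Finset.prod_congr rfl fun i _ => ?_
  rw [PiLp.add_apply, add_div, AddCircle.coe_add, fourier_apply, fourier_apply, fourier_apply,
    smul_add, AddCircle.toCircle_add]
  simp

theorem boxChar_neg_mul_self (k : Fin d → ℤ) (y : Euc d) :
    boxChar R (-k) (-y) = boxChar R k y := by
  unfold boxChar
  simp only [UnitAddTorus.mFourier, ContinuousMap.coe_mk]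
  refine Finset.prod_congr rfl fun i _ => ?_
  simp [fourier_apply, neg_div]

theorem boxChar_single (k : Fin d → ℤ) (i : Fin d) (h : ℝ) :
    boxChar R k (h • EuclideanSpace.single i (1 : ℝ))
      = Complex.exp ((2 * Real.pi * (k i) * h / R : ℝ) * Complex.I) := by
  unfold boxChar
  simp only [UnitAddTorus.mFourier, ContinuousMap.coe_mk]
  rw [Finset.prod_eq_single i]
  · rw [fourier_coe_apply]
    simp
    congr 1
    ring
  · intro j _ hj
    simp [hj]
  · simp

-- the normalisation of the measure on the circle that Mathlib uses for Fourier series on the torus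
attribute [local instance] instMeasureSpaceUnitAddCircle

theorem isProbabilityMeasure_unitAddCircle :
    IsProbabilityMeasure (volume : Measure UnitAddCircle) :=
  inferInstanceAs (IsProbabilityMeasure AddCircle.haarAddCircle)

attribute [local instance] isProbabilityMeasure_unitAddCircle

/-- The function on the torus that a function on `ℝ^d` supported in the box of side `R` induces. -/
noncomputable def torusFun (R : ℝ) (F : Euc d → ℝ) (t : UnitAddTorus (Fin d)) : ℂ :=
  (F (R • WithLp.toLp 2 (UnitAddTorus.measurableEquivPiIoc (fun _ : Fin d => (-1 / 2 : ℝ)) t).1) : ℂ)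

theorem measurable_torusFun {F : Euc d → ℝ} (hF : Measurable F) :
    Measurable (torusFun R F) := by
  unfold torusFun
  have : Measurable (fun t : UnitAddTorus (Fin d) =>
      (UnitAddTorus.measurableEquivPiIoc (fun _ : Fin d => (-1 / 2 : ℝ)) t).1) :=
    measurable_subtype_coe.comp (MeasurableEquiv.measurable _)
  have h2 : Measurable fun t : UnitAddTorus (Fin d) =>
      WithLp.toLp 2 (UnitAddTorus.measurableEquivPiIoc (fun _ : Fin d => (-1 / 2 : ℝ)) t).1 :=
    (WithLp.measurable_toLp 2 _).comp this
  exact Complex.measurable_ofReal.comp (hF.comp (h2.const_smul R))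

theorem memLp_torusFun {F : Euc d → ℝ} (hF : Measurable F) {B : ℝ} (hB : ∀ y, |F y| ≤ B) :
    MemLp (torusFun R F) 2 := by
  refine MemLp.of_bound (measurable_torusFun hF).aestronglyMeasurable B
    (Filter.Eventually.of_forall fun t => ?_)
  simp [torusFun, hB]

theorem integral_torus_eq {F : Euc d → ℝ} (hR : 0 < R)
    (hs : ∀ y, (∃ i, R / 2 ≤ |y i|) → F y = 0) (w : UnitAddTorus (Fin d) → ℂ → ℂ)
    (hw : ∀ t, w t 0 = 0) :
    ∫ t, w t (torusFun R F t)
      = ((R ^ d)⁻¹ : ℝ) * ∫ y : Euc d, w (fun i => ((y i / R : ℝ) : UnitAddCircle)) (F y : ℂ) := by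
  rw [UnitAddTorus.integral_preimage _ (fun _ : Fin d => (-1 / 2 : ℝ))]
  set box : Set (Fin d → ℝ) := {x | ∀ i, x i ∈ Set.Ioc (-1 / 2 : ℝ) (-1 / 2 + 1)} with hbox
  have hmeas : MeasurableSet box := by
    have : box = Set.pi Set.univ fun _ => Set.Ioc (-1 / 2 : ℝ) (-1 / 2 + 1) := by
      ext x; simp [hbox]
    rw [this]
    exact MeasurableSet.univ_pi fun _ => measurableSet_Ioc
  have hrep : ∀ x ∈ box, torusFun R F (fun i => (x i : UnitAddCircle))
      = (F (R • WithLp.toLp 2 x) : ℂ) := by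
    intro x hx
    unfold torusFun
    have h1 : (UnitAddTorus.measurableEquivPiIoc (fun _ : Fin d => (-1 / 2 : ℝ)))
        (fun i => (x i : UnitAddCircle)) = ⟨x, hx⟩ := by
      rw [← UnitAddTorus.coe_symm_measurableEquivPiIoc_apply (b := fun _ : Fin d => (-1 / 2 : ℝ))
        (y := ⟨x, hx⟩)]
      simp only [MeasurableEquiv.apply_symm_apply]
    rw [h1]
  have h1 : ∫ x in box, w (fun i => (x i : UnitAddCircle))
      (torusFun R F (fun i => (x i : UnitAddCircle)))
      = ∫ x : Fin d → ℝ, w (fun i => (x i : UnitAddCircle)) (F (R • WithLp.toLp 2 x) : ℂ) := by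
    rw [setIntegral_congr_fun hmeas (g := fun x => w (fun i => (x i : UnitAddCircle))
      (F (R • WithLp.toLp 2 x) : ℂ)) (fun x hx => by simp only [hrep x hx])]
    refine setIntegral_eq_integral_of_forall_compl_eq_zero fun x hx => ?_
    have : F (R • WithLp.toLp 2 x) = 0 := by
      refine hs _ ?_
      simp only [hbox, Set.mem_ofPred_eq, not_forall] at hx
      obtain ⟨i, hi⟩ := hx
      refine ⟨i, ?_⟩
      have h2 : (1 / 2 : ℝ) ≤ |x i| := by
        by_contra hlt
        rw [not_le, abs_lt] at hlt
        exact hi ⟨by linarith [hlt.1], by linarith [hlt.2]⟩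
      simp only [PiLp.smul_apply, smul_eq_mul, abs_mul, abs_of_pos hR]
      nlinarith
    rw [this]
    simpa using hw _
  rw [h1]
  have h2 : ∫ x : Fin d → ℝ, w (fun i => (x i : UnitAddCircle)) (F (R • WithLp.toLp 2 x) : ℂ)
      = ∫ y : Euc d, w (fun i => (y i : UnitAddCircle)) (F (R • y) : ℂ) := by
    rw [← (EuclideanSpace.volume_preserving_symm_measurableEquiv_toLp (Fin d)).integral_comp
      (MeasurableEquiv.measurableEmbedding _)]
    rfl
  rw [h2]
  have h3 := Measure.integral_comp_smul (volume : Measure (Euc d))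
    (fun y : Euc d => w (fun i => ((y i / R : ℝ) : UnitAddCircle)) (F y : ℂ)) R
  simp only [PiLp.smul_apply, smul_eq_mul, mul_div_cancel_left₀ _ hR.ne', finrank_euclideanSpace,
    Fintype.card_fin, abs_of_pos (inv_pos.2 (pow_pos hR d))] at h3
  rw [h3]
  simp

theorem boxCoeff_eq {F : Euc d → ℝ} (hR : 0 < R)
    (hs : ∀ y, (∃ i, R / 2 ≤ |y i|) → F y = 0) (k : Fin d → ℤ) :
    boxCoeff R F k = (R ^ d : ℝ) * UnitAddTorus.mFourierCoeff (torusFun R F) k := by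
  unfold UnitAddTorus.mFourierCoeff boxCoeff
  have := integral_torus_eq (F := F) hR hs (fun t z => UnitAddTorus.mFourier (-k) t • z) (by simp)
  rw [this, ← mul_assoc, ← Complex.ofReal_mul, mul_inv_cancel₀ (pow_pos hR d).ne']
  simp [boxChar]

/-- **Parseval's identity** for functions supported in a box. -/
theorem hasSum_boxCoeff_mul {F G : Euc d → ℝ} (hR : 0 < R) (hF : Measurable F) (hG : Measurable G)
    {B B' : ℝ} (hFB : ∀ y, |F y| ≤ B) (hGB : ∀ y, |G y| ≤ B')
    (hFs : ∀ y, (∃ i, R / 2 ≤ |y i|) → F y = 0) (hGs : ∀ y, (∃ i, R / 2 ≤ |y i|) → G y = 0) :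
    HasSum (fun k => (starRingEnd ℂ) (boxCoeff R F k) * boxCoeff R G k)
      ((R ^ d * ∫ y, F y * G y : ℝ) : ℂ) := by
  have hf := memLp_torusFun (R := R) hF hFB
  have hg := memLp_torusFun (R := R) hG hGB
  have h := (UnitAddTorus.hasSum_prod_mFourierCoeff hf.toLp hg.toLp).mul_left
    (((R ^ d : ℝ) : ℂ) * ((R ^ d : ℝ) : ℂ))
  have cf : ∀ k, UnitAddTorus.mFourierCoeff (hf.toLp) k
      = UnitAddTorus.mFourierCoeff (torusFun R F) k := fun k =>
    integral_congr_ae (by filter_upwards [hf.coeFn_toLp] with t ht; simp only [ht])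
  have cg : ∀ k, UnitAddTorus.mFourierCoeff (hg.toLp) k
      = UnitAddTorus.mFourierCoeff (torusFun R G) k := fun k =>
    integral_congr_ae (by filter_upwards [hg.coeFn_toLp] with t ht; simp only [ht])
  have e0 : (fun k => (starRingEnd ℂ) (boxCoeff R F k) * boxCoeff R G k)
      = fun k => ((R ^ d : ℝ) : ℂ) * ((R ^ d : ℝ) : ℂ)
        * ((starRingEnd ℂ) (UnitAddTorus.mFourierCoeff (hf.toLp (torusFun R F)) k)
          * UnitAddTorus.mFourierCoeff (hg.toLp (torusFun R G)) k) := by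
    funext k
    rw [boxCoeff_eq hR hFs, boxCoeff_eq hR hGs, cf, cg, map_mul, Complex.conj_ofReal]
    ring
  have e1 : ∫ t, (starRingEnd ℂ) ((hf.toLp (torusFun R F)) t) * (hg.toLp (torusFun R G)) t
      = ∫ t, torusFun R (fun y => F y * G y) t := by
    refine integral_congr_ae ?_
    filter_upwards [hf.coeFn_toLp, hg.coeFn_toLp] with t h1 h2
    rw [h1, h2]
    simp [torusFun]
  rw [e1, integral_torus_eq (F := fun y => F y * G y) hR
    (fun y hy => by simp [hFs y hy]) (fun _ z => z) (by simp), integral_complex_ofReal] at h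
  rw [e0]
  convert! h using 1
  push_cast
  have : (R : ℂ) ^ d ≠ 0 := pow_ne_zero _ (by exact_mod_cast hR.ne')
  field_simp

/-- **Bessel's inequality** for bounded functions supported in a box. -/
theorem sum_norm_boxCoeff_sq_le {F : Euc d → ℝ} (hR : 0 < R) (hF : Measurable F)
    {B : ℝ} (hFB : ∀ y, |F y| ≤ B) (hFs : ∀ y, (∃ i, R / 2 ≤ |y i|) → F y = 0)
    (s : Finset (Fin d → ℤ)) :
    ∑ k ∈ s, ‖boxCoeff R F k‖ ^ 2 ≤ (R ^ d) ^ 2 * B ^ 2 := by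
  have hf := memLp_torusFun (R := R) hF hFB
  have h := UnitAddTorus.hasSum_sq_mFourierCoeff hf.toLp
  have cf : ∀ k, UnitAddTorus.mFourierCoeff (hf.toLp) k
      = UnitAddTorus.mFourierCoeff (torusFun R F) k := fun k =>
    integral_congr_ae (by filter_upwards [hf.coeFn_toLp] with t ht; simp only [ht])
  have h1 : ∑ k ∈ s, ‖boxCoeff R F k‖ ^ 2
      = (R ^ d) ^ 2 * ∑ k ∈ s, ‖UnitAddTorus.mFourierCoeff (hf.toLp) k‖ ^ 2 := by
    rw [Finset.mul_sum]
    refine Finset.sum_congr rfl fun k _ => ?_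
    rw [boxCoeff_eq hR hFs, cf, norm_mul, Complex.norm_real, mul_pow, Real.norm_eq_abs, sq_abs]
  rw [h1]
  refine mul_le_mul_of_nonneg_left ((sum_le_hasSum s (fun _ _ => by positivity) h).trans ?_)
    (by positivity)
  calc ∫ t, ‖(hf.toLp (torusFun R F)) t‖ ^ 2 ≤ ∫ _t : UnitAddTorus (Fin d), B ^ 2 := by
        refine integral_mono_of_nonneg (Filter.Eventually.of_forall fun t => by positivity)
          (integrable_const _) ?_
        filter_upwards [hf.coeFn_toLp] with t ht
        rw [ht]
        simp only [torusFun, Complex.norm_real, Real.norm_eq_abs]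
        exact pow_le_pow_left₀ (abs_nonneg _) (hFB _) 2
    _ = B ^ 2 := by simp

end

/-! ### Decay of Fourier coefficients by finite differences -/

/-- The maximum norm of a frequency. -/
def freqNorm {d : ℕ} (k : Fin d → ℤ) : ℕ := Finset.univ.sup fun i => (k i).natAbs

/-- The dyadic level of a frequency: `0` for the zero frequency, and `j ≥ 1` if its maximum norm lies
in `[2 ^ (j - 1), 2 ^ j)`. -/
def freqLevel {d : ℕ} (k : Fin d → ℤ) : ℕ := Nat.size (freqNorm k)

/-- The finite set of frequencies of level at most `J`; see `mem_freqBox`. -/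
noncomputable def freqBox (d J : ℕ) : Finset (Fin d → ℤ) :=
  (Fintype.piFinset fun _ => Finset.Icc (-(2 ^ J : ℤ)) (2 ^ J)).filter fun k => freqLevel k ≤ J

theorem natAbs_le_freqNorm {d : ℕ} (k : Fin d → ℤ) (i : Fin d) : (k i).natAbs ≤ freqNorm k :=
  Finset.le_sup (f := fun i => (k i).natAbs) (Finset.mem_univ i)

theorem mem_freqBox {d J : ℕ} {k : Fin d → ℤ} : k ∈ freqBox d J ↔ freqLevel k ≤ J := by
  unfold freqBox
  rw [Finset.mem_filter, and_iff_right_iff_imp, Fintype.mem_piFinset]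
  intro h i
  have h1 := Nat.size_le.1 h
  have h2 := (natAbs_le_freqNorm k i).trans h1.le
  rw [Finset.mem_Icc, ← abs_le, Int.abs_eq_natAbs]
  exact_mod_cast h2

theorem card_freqBox_le (d J : ℕ) : (freqBox d J).card ≤ 3 ^ d * (2 ^ J) ^ d := by
  refine (Finset.card_filter_le _ _).trans ?_
  rw [Fintype.card_piFinset]
  simp only [Int.card_Icc, Finset.prod_const, Finset.card_univ, Fintype.card_fin]
  rw [← mul_pow]
  refine Nat.pow_le_pow_left ?_ d
  have : 1 ≤ 2 ^ J := Nat.one_le_two_pow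
  have h2 : (2 ^ J + 1 - -(2 ^ J) : ℤ) = ((2 * 2 ^ J + 1 : ℕ) : ℤ) := by push_cast; ring
  rw [h2, Int.toNat_natCast]
  omega

theorem exists_natAbs_ge_of_freqLevel {d : ℕ} {k : Fin d → ℤ} (h : freqLevel k ≠ 0) :
    ∃ i, 2 ^ freqLevel k ≤ 2 * (k i).natAbs := by
  have hk : freqNorm k ≠ 0 := fun h0 => h (by simp [freqLevel, h0])
  have hne : (Finset.univ : Finset (Fin d)).Nonempty := by
    by_contra hemp
    rw [Finset.not_nonempty_iff_eq_empty] at hemp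
    exact hk (by simp [freqNorm, hemp])
  obtain ⟨i, -, hi⟩ := Finset.exists_mem_eq_sup _ hne fun i => (k i).natAbs
  refine ⟨i, ?_⟩
  have h1 : 2 ^ (freqLevel k - 1) ≤ freqNorm k := Nat.lt_size.1 (by
    change freqLevel k - 1 < freqLevel k
    omega)
  have h2 : (k i).natAbs = freqNorm k := hi.symm
  rw [h2]
  obtain ⟨l, hl⟩ : ∃ l, freqLevel k = l + 1 := ⟨freqLevel k - 1, by omega⟩
  rw [hl] at h1 ⊢
  simp only [Nat.add_sub_cancel] at h1
  rw [pow_succ]; omega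

section

variable {d : ℕ} {R : ℝ}

theorem boxCoeff_shift (F : Euc d → ℝ) (v : Euc d) (k : Fin d → ℤ) :
    boxCoeff R (fun y => F (y + v)) k = boxChar R k v * boxCoeff R F k := by
  unfold boxCoeff
  have h := integral_add_right_eq_self (μ := (volume : Measure (Euc d)))
    (fun z => boxChar R (-k) (z + -v) * (F z : ℂ)) v
  simp only [add_neg_cancel_right] at h
  rw [h, ← integral_const_mul]
  refine integral_congr_ae (Filter.Eventually.of_forall fun y => ?_)
  simp only [boxChar_add, boxChar_neg_mul_self]
  ring

theorem integrable_boxChar_mul {F : Euc d → ℝ} (hF : Integrable F) (k : Fin d → ℤ) :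
    Integrable fun y => boxChar R k y * (F y : ℂ) :=
  hF.ofReal.bdd_mul (c := 1) (continuous_boxChar k).aestronglyMeasurable
    (Filter.Eventually.of_forall fun y => (norm_boxChar k y).le)

theorem integrable_fwdDiff {F : Euc d → ℝ} (hF : Integrable F) (v : Euc d) :
    Integrable (fwdDiff v F) := (hF.comp_add_right v).sub hF

theorem boxCoeff_fwdDiff {F : Euc d → ℝ} (hF : Integrable F) (v : Euc d) (k : Fin d → ℤ) :
    boxCoeff R (fwdDiff v F) k = (boxChar R k v - 1) * boxCoeff R F k := by
  have h : boxCoeff R (fwdDiff v F) k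
      = boxCoeff R (fun y => F (y + v)) k - boxCoeff R F k := by
    unfold boxCoeff
    rw [← integral_sub (integrable_boxChar_mul (hF.comp_add_right v) _)
      (integrable_boxChar_mul hF _)]
    refine integral_congr_ae (Filter.Eventually.of_forall fun y => ?_)
    simp only [fwdDiff, Complex.ofReal_sub]
    ring
  rw [h, boxCoeff_shift]
  ring

theorem boxCoeff_fwdDiff_iter {F : Euc d → ℝ} (hF : Integrable F) (v : Euc d) (k : Fin d → ℤ)
    (K : ℕ) : boxCoeff R ((fwdDiff v)^[K] F) k = (boxChar R k v - 1) ^ K * boxCoeff R F k := by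
  induction K generalizing F with
  | zero => simp
  | succ K ih =>
    rw [Function.iterate_succ_apply, ih (integrable_fwdDiff hF v), boxCoeff_fwdDiff hF]
    ring

theorem fwdDiff_iter_eq_zero {F : Euc d → ℝ} {ρ : ℝ} (hs : ∀ y, ρ ≤ ‖y‖ → F y = 0) (v : Euc d)
    (K : ℕ) : ∀ y, ρ + K * ‖v‖ ≤ ‖y‖ → (fwdDiff v)^[K] F y = 0 := by
  induction K generalizing F ρ with
  | zero => simpa using hs
  | succ K ih =>
    intro y hy
    rw [Function.iterate_succ_apply]
    refine ih (ρ := ρ + ‖v‖) (fun z hz => ?_) y (by push_cast at hy; linarith)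
    have h1 : ‖z‖ ≤ ‖z + v‖ + ‖v‖ := by simpa using norm_sub_le (z + v) v
    rw [fwdDiff, hs z (by linarith [norm_nonneg v]), hs (z + v) (by linarith), sub_zero]

theorem measurable_fwdDiff_iter {F : Euc d → ℝ} (hF : Measurable F) (v : Euc d) (K : ℕ) :
    Measurable ((fwdDiff v)^[K] F) := by
  induction K generalizing F with
  | zero => exact hF
  | succ K ih =>
    rw [Function.iterate_succ_apply]
    exact ih ((hF.comp (measurable_add_const v)).sub hF)

theorem le_norm_boxChar_sub_one (k : Fin d → ℤ) (i : Fin d) {h : ℝ}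
    (hh : |k i * h / R| ≤ 1 / 2) :
    4 * |k i * h / R| ≤ ‖boxChar R k (h • EuclideanSpace.single i (1 : ℝ)) - 1‖ := by
  rw [boxChar_single, mul_comm _ Complex.I, Complex.norm_exp_I_mul_ofReal_sub_one]
  have e : 2 * Real.pi * (k i) * h / R / 2 = Real.pi * (k i * h / R) := by ring
  have h1 : |Real.pi * (k i * h / R)| ≤ Real.pi / 2 := by
    rw [abs_mul, abs_of_pos Real.pi_pos]
    nlinarith [Real.pi_pos]
  have h2 := Real.mul_abs_le_abs_sin h1
  rw [e, norm_mul, Real.norm_eq_abs, Real.norm_eq_abs, abs_two]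
  rw [abs_mul, abs_of_pos Real.pi_pos] at h2
  have h3 : 2 / Real.pi * (Real.pi * |k i * h / R|) = 2 * |k i * h / R| := by
    field_simp
  linarith

/-- A function on `ℝ^d` of smoothness `a`, in the sense of its differences of order `⌈a⌉` in the
coordinate directions, which vanishes outside the ball of radius `R / 4`. -/
structure SmoothInBox (R a B : ℝ) (F : Euc d → ℝ) : Prop where
  measurable : Measurable F
  bound : ∀ y, |F y| ≤ B
  support : ∀ y, R / 4 ≤ ‖y‖ → F y = 0
  diff : ∀ (i : Fin d) (h : ℝ), 0 < h → h ≤ 1 → ∀ y,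
    |(fwdDiff (h • EuclideanSpace.single i (1 : ℝ)))^[⌈a⌉₊] F y| ≤ B * h ^ a

theorem SmoothInBox.eq_zero {a B : ℝ} {F : Euc d → ℝ} (hF : SmoothInBox R a B F) (hR : 0 < R)
    (y : Euc d) (hy : ∃ i, R / 2 ≤ |y i|) : F y = 0 := by
  obtain ⟨i, hi⟩ := hy
  refine hF.support y ?_
  have := PiLp.norm_apply_le y i
  rw [Real.norm_eq_abs] at this
  linarith

theorem SmoothInBox.integrable {a B : ℝ} {F : Euc d → ℝ} (hF : SmoothInBox R a B F) :
    Integrable F := by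
  have h1 : IntegrableOn F (Metric.ball 0 (R / 4)) :=
    Measure.integrableOn_of_bounded (M := B) measure_ball_lt_top.ne
      hF.measurable.aestronglyMeasurable
      (Filter.Eventually.of_forall fun y => by simpa using hF.bound y)
  refine (integrableOn_iff_integrable_of_support_subset fun y hy => ?_).1 h1
  by_contra h
  exact hy (hF.support y (by simpa using h))

/-- Weighted square sums of the Fourier coefficients of a function of smoothness `a` up to level `J`.
A single difference step of size about `2 ^ (-J)` in each coordinate direction serves all the
levels up to `J` at once. -/
theorem exists_sum_boxCoeff_le {R a B : ℝ} (hR : 0 < R) (ha : 0 ≤ a) :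
    ∃ C : ℝ, 0 ≤ C ∧ ∀ F : Euc d → ℝ, SmoothInBox R a B F → ∀ J : ℕ,
      ∑ k ∈ freqBox d J, (4 : ℝ) ^ (⌈a⌉₊ * freqLevel k) * ‖boxCoeff R F k‖ ^ 2
        ≤ C * ((2 : ℝ) ^ J) ^ (2 * ((⌈a⌉₊ : ℝ) - a)) := by
  set K := ⌈a⌉₊ with hK
  obtain ⟨q, hq⟩ := exists_nat_ge (max (2 * K : ℝ) (max 1 R))
  have hq1 : (1 : ℝ) ≤ q := ((le_max_left _ _).trans (le_max_right _ _)).trans hq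
  have hqK : (2 * K : ℝ) ≤ q := (le_max_left _ _).trans hq
  have hqR : R ≤ q := ((le_max_right _ _).trans (le_max_right _ _)).trans hq
  have hq0 : (0 : ℝ) < q := by linarith
  refine ⟨d * ((q : ℝ) ^ (2 * K) * ((R ^ d) ^ 2 * B ^ 2)) + (R ^ d) ^ 2 * B ^ 2, by positivity,
    fun F hF J => ?_⟩
  set h : ℝ := R / (2 * q * 2 ^ J) with hh
  have h2J : (1 : ℝ) ≤ 2 ^ J := one_le_pow₀ (by norm_num)
  have hh0 : 0 < h := by positivity
  have hhJ : h ≤ 1 / 2 ^ J := by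
    rw [hh, div_le_div_iff₀ (by positivity) (by positivity)]
    nlinarith
  have hh1 : h ≤ 1 := hhJ.trans (by rw [div_le_one (by positivity)]; exact h2J)
  have hhR : h ≤ R / (2 * q) := by
    rw [hh]
    refine div_le_div_of_nonneg_left hR.le (by positivity) ?_
    nlinarith
  have hKa : 0 ≤ 2 * ((K : ℝ) - a) := by
    have := Nat.le_ceil a
    rw [← hK] at this
    linarith
  have hone : (1 : ℝ) ≤ ((2 : ℝ) ^ J) ^ (2 * ((K : ℝ) - a)) := Real.one_le_rpow h2J hKa
  -- Bessel's inequality for the differences in one direction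
  have hbessel : ∀ i : Fin d, ∑ k ∈ freqBox d J,
      ‖boxChar R k (h • EuclideanSpace.single i (1 : ℝ)) - 1‖ ^ (2 * K) * ‖boxCoeff R F k‖ ^ 2
      ≤ (R ^ d) ^ 2 * (B * h ^ a) ^ 2 := by
    intro i
    set v : Euc d := h • EuclideanSpace.single i (1 : ℝ) with hv
    have hvn : ‖v‖ = h := by simp [hv, norm_smul, abs_of_pos hh0]
    have := sum_norm_boxCoeff_sq_le (F := (fwdDiff v)^[K] F) hR
      (measurable_fwdDiff_iter hF.measurable v K) (B := B * h ^ a)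
      (fun y => hF.diff i h hh0 hh1 y) (fun y hy => by
        refine fwdDiff_iter_eq_zero hF.support v K y ?_
        obtain ⟨i, hi⟩ := hy
        have h1 := PiLp.norm_apply_le y i
        rw [Real.norm_eq_abs] at h1
        rw [hvn]
        have h2 : K * h ≤ R / 4 := by
          calc K * h ≤ K * (R / (2 * q)) := by gcongr
            _ = (2 * K) * R / (4 * q) := by field_simp; norm_num
            _ ≤ q * R / (4 * q) := by gcongr
            _ = R / 4 := by field_simp
        linarith) (freqBox d J)
    refine le_trans (le_of_eq (Finset.sum_congr rfl fun k _ => ?_)) this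
    rw [boxCoeff_fwdDiff_iter hF.integrable, norm_mul, norm_pow]
    ring
  have hterm : ∀ k ∈ freqBox d J, (4 : ℝ) ^ (K * freqLevel k) * ‖boxCoeff R F k‖ ^ 2
      ≤ (∑ i : Fin d, (q * 2 ^ J : ℝ) ^ (2 * K)
          * (‖boxChar R k (h • EuclideanSpace.single i (1 : ℝ)) - 1‖ ^ (2 * K)
            * ‖boxCoeff R F k‖ ^ 2))
        + ‖boxCoeff R F k‖ ^ 2 := by
    intro k hk
    have hnn : 0 ≤ ∑ i : Fin d, (q * 2 ^ J : ℝ) ^ (2 * K)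
          * (‖boxChar R k (h • EuclideanSpace.single i (1 : ℝ)) - 1‖ ^ (2 * K)
            * ‖boxCoeff R F k‖ ^ 2) := Finset.sum_nonneg fun i _ => by positivity
    by_cases h0 : freqLevel k = 0
    · rw [h0]; simpa using hnn
    obtain ⟨i, hi⟩ := exists_natAbs_ge_of_freqLevel h0
    have hkJ : (k i).natAbs < 2 ^ J := lt_of_le_of_lt (natAbs_le_freqNorm k i)
      (Nat.size_le.1 (mem_freqBox.1 hk))
    have hkJ' : |(k i : ℝ)| ≤ 2 ^ J := by
      rw [← Int.cast_abs, Int.abs_eq_natAbs]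
      exact_mod_cast hkJ.le
    have hki : (2 : ℝ) ^ freqLevel k ≤ 2 * |(k i : ℝ)| := by
      rw [← Int.cast_abs, Int.abs_eq_natAbs]
      exact_mod_cast hi
    have ht : |k i * h / R| = |(k i : ℝ)| / (2 * q * 2 ^ J) := by
      rw [abs_div, abs_mul, abs_of_pos hh0, abs_of_pos hR, hh]
      field_simp
    have hphase := le_norm_boxChar_sub_one (h := h) k i (by
      rw [ht, div_le_div_iff₀ (by positivity) (by norm_num)]
      nlinarith)
    rw [ht] at hphase
    have hge : (2 : ℝ) ^ freqLevel k
        ≤ (q * 2 ^ J) * ‖boxChar R k (h • EuclideanSpace.single i (1 : ℝ)) - 1‖ := by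
      calc (2 : ℝ) ^ freqLevel k ≤ 2 * |(k i : ℝ)| := hki
        _ = (q * 2 ^ J) * (4 * (|(k i : ℝ)| / (2 * q * 2 ^ J))) := by field_simp; ring
        _ ≤ _ := by gcongr
    have hpow : (4 : ℝ) ^ (K * freqLevel k)
        ≤ (q * 2 ^ J) ^ (2 * K)
          * ‖boxChar R k (h • EuclideanSpace.single i (1 : ℝ)) - 1‖ ^ (2 * K) := by
      rw [← mul_pow]
      refine le_trans (le_of_eq ?_) (pow_le_pow_left₀ (by positivity) hge (2 * K))
      rw [← pow_mul, show (4 : ℝ) = 2 ^ 2 by norm_num, ← pow_mul]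
      ring_nf
    have hsingle := Finset.single_le_sum (f := fun i : Fin d => (q * 2 ^ J : ℝ) ^ (2 * K)
          * (‖boxChar R k (h • EuclideanSpace.single i (1 : ℝ)) - 1‖ ^ (2 * K)
            * ‖boxCoeff R F k‖ ^ 2)) (fun i _ => by positivity) (Finset.mem_univ i)
    calc _ ≤ ((q * 2 ^ J) ^ (2 * K)
          * ‖boxChar R k (h • EuclideanSpace.single i (1 : ℝ)) - 1‖ ^ (2 * K))
            * ‖boxCoeff R F k‖ ^ 2 := by gcongr
      _ ≤ _ := by
        rw [mul_assoc]
        exact hsingle.trans (le_add_of_nonneg_right (by positivity))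
  refine (Finset.sum_le_sum hterm).trans ?_
  rw [Finset.sum_add_distrib, Finset.sum_comm, add_mul]
  refine add_le_add ?_ ?_
  · have hi : ∀ i : Fin d, ∑ k ∈ freqBox d J, (q * 2 ^ J : ℝ) ^ (2 * K)
          * (‖boxChar R k (h • EuclideanSpace.single i (1 : ℝ)) - 1‖ ^ (2 * K)
            * ‖boxCoeff R F k‖ ^ 2)
        ≤ (q : ℝ) ^ (2 * K) * ((R ^ d) ^ 2 * B ^ 2) * ((2 : ℝ) ^ J) ^ (2 * ((K : ℝ) - a)) := by
      intro i
      rw [← Finset.mul_sum]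
      refine (mul_le_mul_of_nonneg_left (hbessel i) (by positivity)).trans ?_
      have e1 : (h ^ a) ^ 2 ≤ ((2 : ℝ) ^ J) ^ (-(2 * a)) := by
        rw [← Real.rpow_natCast, ← Real.rpow_mul hh0.le, Real.rpow_neg (by positivity),
          ← Real.inv_rpow (by positivity)]
        refine (Real.rpow_le_rpow hh0.le (hhJ.trans (le_of_eq (one_div _))) (by push_cast; linarith)).trans
          (le_of_eq ?_)
        congr 1; push_cast; ring
      calc (q * 2 ^ J : ℝ) ^ (2 * K) * ((R ^ d) ^ 2 * (B * h ^ a) ^ 2)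
          = (q : ℝ) ^ (2 * K) * ((R ^ d) ^ 2 * B ^ 2) * (((2 : ℝ) ^ J) ^ (2 * K) * (h ^ a) ^ 2) := by
            ring
        _ ≤ (q : ℝ) ^ (2 * K) * ((R ^ d) ^ 2 * B ^ 2)
            * (((2 : ℝ) ^ J) ^ (2 * K) * ((2 : ℝ) ^ J) ^ (-(2 * a))) := by gcongr
        _ = _ := by
            rw [← Real.rpow_natCast ((2 : ℝ) ^ J) (2 * K), ← Real.rpow_add (by positivity)]
            congr 2; push_cast; ring
    refine (Finset.sum_le_sum fun i _ => hi i).trans (le_of_eq ?_)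
    simp
    ring
  · refine (sum_norm_boxCoeff_sq_le hR hF.measurable hF.bound (hF.eq_zero hR) _).trans ?_
    exact le_mul_of_one_le_right (by positivity) hone

end

section

variable {d : ℕ} {R : ℝ}

/-- The Fourier coefficients of level `j` of a function of smoothness `a` have square sum of order
`2 ^ (-2 j a)`. -/
theorem exists_sum_shell_boxCoeff_le {a B : ℝ} (hR : 0 < R) (ha : 0 ≤ a) :
    ∃ C : ℝ, 0 ≤ C ∧ ∀ F : Euc d → ℝ, SmoothInBox R a B F → ∀ j : ℕ,
      ∑ k ∈ (freqBox d j).filter (fun k => freqLevel k = j), ‖boxCoeff R F k‖ ^ 2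
        ≤ C * ((2 : ℝ) ^ (-a)) ^ (2 * j) := by
  obtain ⟨C, hC, h⟩ := exists_sum_boxCoeff_le (d := d) (B := B) hR ha
  refine ⟨C, hC, fun F hF j => ?_⟩
  have h1 : (4 : ℝ) ^ (⌈a⌉₊ * j)
      * ∑ k ∈ (freqBox d j).filter (fun k => freqLevel k = j), ‖boxCoeff R F k‖ ^ 2
      ≤ C * ((2 : ℝ) ^ j) ^ (2 * ((⌈a⌉₊ : ℝ) - a)) := by
    refine le_trans ?_ (h F hF j)
    rw [Finset.mul_sum]
    calc _ = ∑ k ∈ (freqBox d j).filter (fun k => freqLevel k = j),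
          (4 : ℝ) ^ (⌈a⌉₊ * freqLevel k) * ‖boxCoeff R F k‖ ^ 2 :=
          Finset.sum_congr rfl fun k hk => by rw [(Finset.mem_filter.1 hk).2]
      _ ≤ _ := Finset.sum_le_sum_of_subset_of_nonneg (Finset.filter_subset _ _)
          fun k _ _ => by positivity
  have e1 : ((2 : ℝ) ^ j) ^ (2 * ((⌈a⌉₊ : ℝ) - a))
      = (4 : ℝ) ^ (⌈a⌉₊ * j) * ((2 : ℝ) ^ (-a)) ^ (2 * j) := by
    rw [show (4 : ℝ) = 2 ^ (2 : ℝ) by norm_num, ← Real.rpow_natCast, ← Real.rpow_natCast,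
      ← Real.rpow_natCast, ← Real.rpow_mul (by norm_num), ← Real.rpow_mul (by norm_num),
      ← Real.rpow_mul (by norm_num), ← Real.rpow_add (by norm_num)]
    congr 1; push_cast; ring
  rw [e1, mul_left_comm] at h1
  exact le_of_mul_le_mul_left h1 (by positivity)

/-- Pairing of two functions of smoothness `a` and `b`: the frequencies above level `J` contribute at
most a multiple of `2 ^ (-J (a + b))`. -/
theorem exists_abs_integral_mul_le {a b B B' : ℝ} (hR : 0 < R) (ha : 0 ≤ a) (hb : 0 < b) :
    ∃ C : ℝ, 0 ≤ C ∧ ∀ F W : Euc d → ℝ, SmoothInBox R a B F → SmoothInBox R b B' W → ∀ J : ℕ,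
      R ^ d * |∫ y, F y * W y|
        ≤ ∑ k ∈ freqBox d J, ‖boxCoeff R F k‖ * ‖boxCoeff R W k‖
          + C * ((2 : ℝ) ^ (-(a + b))) ^ J := by
  obtain ⟨C₁, hC₁, h₁⟩ := exists_sum_shell_boxCoeff_le (d := d) (B := B) hR ha
  obtain ⟨C₂, hC₂, h₂⟩ := exists_sum_shell_boxCoeff_le (d := d) (B := B') hR hb.le
  set x : ℝ := (2 : ℝ) ^ (-(a + b)) with hx
  have hx0 : 0 < x := by positivity
  have hx1 : x < 1 := Real.rpow_lt_one_of_one_lt_of_neg (by norm_num) (by linarith)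
  have hxab : (2 : ℝ) ^ (-a) * (2 : ℝ) ^ (-b) = x := by
    rw [← Real.rpow_add (by norm_num), hx]; congr 1; ring
  refine ⟨√C₁ * √C₂ / (1 - x), div_nonneg (by positivity) (by linarith), fun F W hF hW J => ?_⟩
  have hshell : ∀ j, ∑ k ∈ (freqBox d j).filter (fun k => freqLevel k = j),
      ‖boxCoeff R F k‖ * ‖boxCoeff R W k‖ ≤ √C₁ * √C₂ * x ^ j := by
    intro j
    refine (Real.sum_mul_le_sqrt_mul_sqrt _ _ _).trans ?_
    calc _ ≤ √(C₁ * ((2 : ℝ) ^ (-a)) ^ (2 * j)) * √(C₂ * ((2 : ℝ) ^ (-b)) ^ (2 * j)) := by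
          gcongr
          · exact h₁ F hF j
          · exact h₂ W hW j
      _ = _ := by
          rw [Real.sqrt_mul hC₁, Real.sqrt_mul hC₂, mul_comm 2 j, pow_mul, pow_mul,
            Real.sqrt_sq (by positivity), Real.sqrt_sq (by positivity), ← hxab, mul_pow]
          ring
  have hsum : ∀ M, J ≤ M → ∑ k ∈ freqBox d M, ‖boxCoeff R F k‖ * ‖boxCoeff R W k‖
      ≤ ∑ k ∈ freqBox d J, ‖boxCoeff R F k‖ * ‖boxCoeff R W k‖
        + √C₁ * √C₂ * ∑ j ∈ Finset.Ico (J + 1) (M + 1), x ^ j := by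
    intro M hM
    induction M, hM using Nat.le_induction with
    | base => simp
    | succ M hM ih =>
      have hsplit : freqBox d (M + 1)
          = (freqBox d M).disjUnion ((freqBox d (M + 1)).filter fun k => freqLevel k = M + 1)
            (Finset.disjoint_left.2 fun k hk hk' => by
              have h1 := mem_freqBox.1 hk
              have h2 := (Finset.mem_filter.1 hk').2
              omega) := by
        ext k
        simp only [Finset.disjUnion_eq_union, Finset.mem_union, Finset.mem_filter, mem_freqBox]
        omega
      rw [hsplit, Finset.sum_disjUnion, Finset.sum_Ico_succ_top (by omega), mul_add]
      linarith [hshell (M + 1)]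
  have htot : ∀ s : Finset (Fin d → ℤ),
      ‖∑ k ∈ s, (starRingEnd ℂ) (boxCoeff R F k) * boxCoeff R W k‖
        ≤ ∑ k ∈ freqBox d J, ‖boxCoeff R F k‖ * ‖boxCoeff R W k‖
          + √C₁ * √C₂ / (1 - x) * x ^ J := by
    intro s
    set M := max J (s.sup freqLevel) with hM
    calc _ ≤ ∑ k ∈ s, ‖(starRingEnd ℂ) (boxCoeff R F k) * boxCoeff R W k‖ := norm_sum_le _ _
      _ = ∑ k ∈ s, ‖boxCoeff R F k‖ * ‖boxCoeff R W k‖ := by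
          refine Finset.sum_congr rfl fun k _ => ?_
          rw [norm_mul, RCLike.norm_conj]
      _ ≤ ∑ k ∈ freqBox d M, ‖boxCoeff R F k‖ * ‖boxCoeff R W k‖ := by
          refine Finset.sum_le_sum_of_subset_of_nonneg (fun k hk => ?_) fun k _ _ => by positivity
          exact mem_freqBox.2 ((Finset.le_sup hk).trans (le_max_right _ _))
      _ ≤ _ := hsum M (le_max_left _ _)
      _ ≤ _ := by
          have h3 : ∑ j ∈ Finset.Ico (J + 1) (M + 1), x ^ j ≤ x ^ J / (1 - x) := by
            refine (geom_sum_Ico_le_of_lt_one hx0.le hx1).trans ?_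
            have : 0 < 1 - x := by linarith
            gcongr ?_ / _
            exact pow_le_pow_of_le_one hx0.le hx1.le (Nat.le_succ J)
          have := mul_le_mul_of_nonneg_left h3 (show 0 ≤ √C₁ * √C₂ by positivity)
          rw [mul_div_assoc'] at this
          rw [div_mul_eq_mul_div]
          linarith
  have hhas := hasSum_boxCoeff_mul hR hF.measurable hW.measurable hF.bound hW.bound
    (hF.eq_zero hR) (hW.eq_zero hR)
  have hlim := le_of_tendsto hhas.norm (Filter.Eventually.of_forall htot)
  rwa [Complex.norm_real, Real.norm_eq_abs, abs_mul, abs_of_pos (pow_pos hR d)] at hlim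

end

/-! ### The integral probability metric and Fourier coefficients -/

/-- The densities of the class: probability densities in a Hölder ball that vanish outside the ball
of radius `L`. -/
structure HolderDensity (d : ℕ) (α L : ℝ) (u : Euc d → ℝ) : Prop where
  mem : u ∈ HolderBall d α L
  nonneg : ∀ y, 0 ≤ u y
  support : ∀ y, L < ‖y‖ → u y = 0
  prob : IsProbabilityMeasure (volume.withDensity fun y => ENNReal.ofReal (u y))

section

variable {d : ℕ} {α L : ℝ}

theorem HolderBall.measurable {r : ℝ} (hα : 0 < α) {f : Euc d → ℝ} (hf : f ∈ HolderBall d α r) :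
    Measurable f :=
  ((HolderBall.contDiff_of_lt hα hf (Nat.ceil_pos.2 hα)).continuous).measurable

theorem fwdDiff_iter_sub {E : Type*} [AddCommGroup E] (v : E) (f g : E → ℝ) (n : ℕ) :
    (fwdDiff v)^[n] (f - g) = (fwdDiff v)^[n] f - (fwdDiff v)^[n] g := by
  induction n generalizing f g with
  | zero => rfl
  | succ n ih =>
    have : fwdDiff v (f - g) = fwdDiff v f - fwdDiff v g := by
      funext y; simp [fwdDiff]; ring
    rw [Function.iterate_succ_apply, Function.iterate_succ_apply, Function.iterate_succ_apply,
      this, ih]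

theorem HolderDensity.smoothInBox_sub (hα : 0 < α) (hL : 0 < L) {u v : Euc d → ℝ}
    (hu : HolderDensity d α L u) (hv : HolderDensity d α L v) :
    SmoothInBox (8 * L) α (2 * L) (fun y => u y - v y) where
  measurable := (HolderBall.measurable hα hu.mem).sub (HolderBall.measurable hα hv.mem)
  bound y := (abs_sub _ _).trans (by
    linarith [HolderBall.abs_le hα.le hL.le hu.mem y, HolderBall.abs_le hα.le hL.le hv.mem y])
  support y hy := by rw [hu.support y (by linarith), hv.support y (by linarith), sub_zero]
  diff i h hh _ y := by
    have e := congrFun (fwdDiff_iter_sub (h • EuclideanSpace.single i (1 : ℝ)) u v ⌈α⌉₊) y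
    have h1 := HolderBall.abs_fwdDiff_iter_le hα.le hL.le hu.mem i hh le_rfl y
    have h2 := HolderBall.abs_fwdDiff_iter_le hα.le hL.le hv.mem i hh le_rfl y
    rw [min_eq_left (Nat.le_ceil α)] at h1 h2
    change |(fwdDiff (h • EuclideanSpace.single i (1 : ℝ)))^[⌈α⌉₊] (u - v) y| ≤ _
    rw [e, Pi.sub_apply]
    refine (abs_sub _ _).trans ?_
    linarith

theorem HolderDensity.smoothInBox (hα : 0 < α) (hL : 0 < L) {u : Euc d → ℝ}
    (hu : HolderDensity d α L u) : SmoothInBox (8 * L) α (2 * L) u where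
  measurable := HolderBall.measurable hα hu.mem
  bound y := by linarith [HolderBall.abs_le hα.le hL.le hu.mem y]
  support y hy := hu.support y (by linarith)
  diff i h hh _ y := by
    have h1 := HolderBall.abs_fwdDiff_iter_le hα.le hL.le hu.mem i hh le_rfl y
    rw [min_eq_left (Nat.le_ceil α)] at h1
    have : 0 ≤ L * h ^ α := by positivity
    linarith

/-- A test function, cut off outside a neighbourhood of the ball of radius `L`. -/
theorem exists_cutoff (d : ℕ) {γ L : ℝ} (hγ : 0 ≤ γ) (hL : 0 < L) :
    ∃ (χ : Euc d → ℝ) (B : ℝ), (∀ y, ‖y‖ ≤ L → χ y = 1) ∧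
      ∀ f ∈ HolderBall d γ 1, Measurable f → SmoothInBox (8 * L) γ B (fun y => χ y * f y) := by
  let χ : ContDiffBump (0 : Euc d) := ⟨L, 2 * L, hL, by linarith⟩
  have hχ : ContDiff ℝ ⌈γ⌉₊ χ := χ.contDiff
  obtain ⟨A, hA, h⟩ := exists_abs_fwdDiff_iter_le ⌈γ⌉₊ hχ χ.hasCompactSupport
  have hpow : (1 : ℝ) ≤ 2 ^ ⌈γ⌉₊ := one_le_pow₀ (by norm_num)
  refine ⟨χ, 2 ^ ⌈γ⌉₊ * A + 1, fun y hy => χ.one_of_mem_closedBall (by simpa using hy),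
    fun f hf hfm => ⟨χ.continuous.measurable.mul hfm, fun y => ?_, fun y hy => ?_,
      fun i s hs hs1 y => ?_⟩⟩
  · rw [abs_mul, abs_of_nonneg (χ.nonneg)]
    have h1 : χ y * |f y| ≤ 1 * 1 :=
      mul_le_mul χ.le_one (HolderBall.abs_le hγ zero_le_one hf y) (abs_nonneg _) zero_le_one
    nlinarith
  · rw [χ.zero_of_le_dist (by simp; linarith), zero_mul]
  · refine (HolderBall.abs_fwdDiff_iter_mul_le hγ zero_le_one hf i hs hs1 (A := A)
      (fun l hl y => h l hl i s hs y) y).trans ?_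
    gcongr
    linarith

end

section

variable {d : ℕ} {α L : ℝ}

theorem boxCoeff_sub {R : ℝ} {F G : Euc d → ℝ} (hF : Integrable F) (hG : Integrable G)
    (k : Fin d → ℤ) :
    boxCoeff R (fun y => F y - G y) k = boxCoeff R F k - boxCoeff R G k := by
  unfold boxCoeff
  rw [← integral_sub (integrable_boxChar_mul hF _) (integrable_boxChar_mul hG _)]
  refine integral_congr_ae (Filter.Eventually.of_forall fun y => ?_)
  simp only [Complex.ofReal_sub]
  ring

theorem HolderDensity.integral_eq (hα : 0 < α) {u : Euc d → ℝ}
    (hu : HolderDensity d α L u) {E : Type*} [NormedAddCommGroup E] [NormedSpace ℝ E]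
    (f : Euc d → E) :
    ∫ y, f y ∂(volume.withDensity fun y => ENNReal.ofReal (u y)) = ∫ y, u y • f y := by
  rw [integral_withDensity_eq_integral_toReal_smul
    (HolderBall.measurable hα hu.mem).ennreal_ofReal
    (Filter.Eventually.of_forall fun y => ENNReal.ofReal_lt_top)]
  refine integral_congr_ae (Filter.Eventually.of_forall fun y => ?_)
  simp only [ENNReal.toReal_ofReal (hu.nonneg y)]

/-- Comparison of the integral probability metric with weighted Fourier coefficients of level at most
`J`, for weights `ω` such that the inversely weighted coefficients of test functions are bounded
in square mean. -/
theorem holderIPM_le_of_weights_bound (hα : 0 < α) (hL : 0 < L) {γ : ℝ} (hγ : 0 ≤ γ) :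
    ∃ B C : ℝ, 0 ≤ C ∧ ∀ (u v : Euc d → ℝ), HolderDensity d α L u → HolderDensity d α L v →
      ∀ (J : ℕ) (ω : ℕ → ℝ) (A : ℝ), (∀ j, 0 < ω j) →
      (∀ F, SmoothInBox (8 * L) γ B F →
        ∑ k ∈ freqBox d J, (ω (freqLevel k))⁻¹ * ‖boxCoeff (8 * L) F k‖ ^ 2 ≤ A) →
      holderIPM γ (volume.withDensity fun y => ENNReal.ofReal (u y))
          (volume.withDensity fun y => ENNReal.ofReal (v y))
        ≤ ENNReal.ofReal (C * (√A * √(∑ k ∈ freqBox d J,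
            ω (freqLevel k) * ‖boxCoeff (8 * L) u k - boxCoeff (8 * L) v k‖ ^ 2)
          + ((2 : ℝ) ^ (-(γ + α))) ^ J)) := by
  have hR : 0 < 8 * L := by linarith
  obtain ⟨χ, B, hχ1, hχ⟩ := exists_cutoff d hγ hL
  obtain ⟨C, hC, h⟩ := exists_abs_integral_mul_le (d := d) (B := B) (B' := 2 * L) hR hγ hα
  refine ⟨B, (1 + C) / (8 * L) ^ d, by positivity, fun u v hu hv J ω A hω hA => ?_⟩
  refine iSup_le fun f => iSup_le fun hf => iSup_le fun hfm => ENNReal.ofReal_le_ofReal ?_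
  have hF := hχ f hf hfm
  have hW := HolderDensity.smoothInBox_sub hα hL hu hv
  have hui := (HolderDensity.smoothInBox hα hL hu).integrable
  have hvi := (HolderDensity.smoothInBox hα hL hv).integrable
  have hfint : ∀ {w : Euc d → ℝ}, Integrable w → Integrable fun y => w y • f y := fun hw => by
    simp only [smul_eq_mul, mul_comm _ (f _)]
    exact hw.bdd_mul (c := 1) hfm.aestronglyMeasurable
      (Filter.Eventually.of_forall fun y => HolderBall.abs_le hγ zero_le_one hf y)
  have e1 : ∫ y, f y ∂(volume.withDensity fun y => ENNReal.ofReal (u y))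
      - ∫ y, f y ∂(volume.withDensity fun y => ENNReal.ofReal (v y))
      = ∫ y, (χ y * f y) * (u y - v y) := by
    rw [hu.integral_eq hα, hv.integral_eq hα, ← integral_sub (hfint hui) (hfint hvi)]
    refine integral_congr_ae (Filter.Eventually.of_forall fun y => ?_)
    by_cases hy : ‖y‖ ≤ L
    · simp only [hχ1 y hy, smul_eq_mul]; ring
    · simp only [hu.support y (not_le.1 hy), hv.support y (not_le.1 hy)]; simp
  rw [e1]
  have h1 := h _ _ hF hW J
  have h2 : ∑ k ∈ freqBox d J, ‖boxCoeff (8 * L) (fun y => χ y * f y) k‖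
        * ‖boxCoeff (8 * L) (fun y => u y - v y) k‖
      ≤ √A * √(∑ k ∈ freqBox d J,
            ω (freqLevel k) * ‖boxCoeff (8 * L) u k - boxCoeff (8 * L) v k‖ ^ 2) := by
    calc _ = ∑ k ∈ freqBox d J,
          (√((ω (freqLevel k))⁻¹) * ‖boxCoeff (8 * L) (fun y => χ y * f y) k‖)
          * (√(ω (freqLevel k)) * ‖boxCoeff (8 * L) u k - boxCoeff (8 * L) v k‖) := by
          refine Finset.sum_congr rfl fun k _ => ?_
          have : √((ω (freqLevel k))⁻¹) * √(ω (freqLevel k)) = 1 := by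
            rw [← Real.sqrt_mul (inv_nonneg.2 (hω _).le), inv_mul_cancel₀ (hω _).ne', Real.sqrt_one]
          rw [boxCoeff_sub hui hvi, mul_mul_mul_comm, this, one_mul]
      _ ≤ _ := Real.sum_mul_le_sqrt_mul_sqrt _ _ _
      _ ≤ _ := by
          refine mul_le_mul (Real.sqrt_le_sqrt ?_) (le_of_eq ?_) (Real.sqrt_nonneg _)
            (Real.sqrt_nonneg _)
          · refine le_trans (le_of_eq (Finset.sum_congr rfl fun k _ => ?_)) (hA _ hF)
            rw [mul_pow, Real.sq_sqrt (inv_nonneg.2 (hω _).le)]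
          · congr 1
            refine Finset.sum_congr rfl fun k _ => ?_
            rw [mul_pow, Real.sq_sqrt (hω _).le]
  set T := √A * √(∑ k ∈ freqBox d J,
            ω (freqLevel k) * ‖boxCoeff (8 * L) u k - boxCoeff (8 * L) v k‖ ^ 2) with hT
  have hT0 : 0 ≤ T := by positivity
  rw [div_mul_eq_mul_div, le_div_iff₀ (by positivity), mul_comm]
  set X := ((2 : ℝ) ^ (-(γ + α))) ^ J with hX
  have hX0 : 0 ≤ X := by positivity
  nlinarith [mul_nonneg hC hT0]

/-- The bound for arbitrary weights: the decay of the coefficients of test functions is used level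
by level. -/
theorem holderIPM_le_of_weights (hα : 0 < α) (hL : 0 < L) {γ : ℝ} (hγ : 0 ≤ γ) :
    ∃ C : ℝ, 0 ≤ C ∧ ∀ (u v : Euc d → ℝ), HolderDensity d α L u → HolderDensity d α L v →
      ∀ (J : ℕ) (ω : ℕ → ℝ), (∀ j, 0 < ω j) →
      holderIPM γ (volume.withDensity fun y => ENNReal.ofReal (u y))
          (volume.withDensity fun y => ENNReal.ofReal (v y))
        ≤ ENNReal.ofReal (C * (√(∑ j ∈ Finset.range (J + 1), (ω j)⁻¹ * ((2 : ℝ) ^ (-γ)) ^ (2 * j))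
            * √(∑ k ∈ freqBox d J,
              ω (freqLevel k) * ‖boxCoeff (8 * L) u k - boxCoeff (8 * L) v k‖ ^ 2)
          + ((2 : ℝ) ^ (-(γ + α))) ^ J)) := by
  have hR : 0 < 8 * L := by linarith
  obtain ⟨B, C, hC, h⟩ := holderIPM_le_of_weights_bound (d := d) hα hL hγ
  obtain ⟨C', hC', h'⟩ := exists_sum_shell_boxCoeff_le (d := d) (B := B) hR hγ
  refine ⟨C * (√C' + 1), by positivity, fun u v hu hv J ω hω => ?_⟩
  refine (h u v hu hv J ω
    (C' * ∑ j ∈ Finset.range (J + 1), (ω j)⁻¹ * ((2 : ℝ) ^ (-γ)) ^ (2 * j)) hω fun F hF => ?_).trans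
    (ENNReal.ofReal_le_ofReal ?_)
  · rw [Finset.mul_sum]
    rw [← Finset.sum_fiberwise_of_maps_to (g := freqLevel) (t := Finset.range (J + 1))
      (fun k hk => by have := mem_freqBox.1 hk; exact Finset.mem_range.2 (by omega))]
    refine Finset.sum_le_sum fun j hj => ?_
    have e : (freqBox d J).filter (fun k => freqLevel k = j)
        = (freqBox d j).filter (fun k => freqLevel k = j) := by
      have := Finset.mem_range.1 hj
      ext k
      simp only [Finset.mem_filter, mem_freqBox]
      omega
    rw [e]
    calc _ = (ω j)⁻¹ * ∑ k ∈ (freqBox d j).filter (fun k => freqLevel k = j),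
          ‖boxCoeff (8 * L) F k‖ ^ 2 := by
          rw [Finset.mul_sum]
          exact Finset.sum_congr rfl fun k hk => by rw [(Finset.mem_filter.1 hk).2]
      _ ≤ (ω j)⁻¹ * (C' * ((2 : ℝ) ^ (-γ)) ^ (2 * j)) :=
          mul_le_mul_of_nonneg_left (h' F hF j) (inv_nonneg.2 (hω j).le)
      _ = _ := by ring
  · rw [Real.sqrt_mul hC']
    set S := √(∑ j ∈ Finset.range (J + 1), (ω j)⁻¹ * ((2 : ℝ) ^ (-γ)) ^ (2 * j))
    set T := √(∑ k ∈ freqBox d J,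
            ω (freqLevel k) * ‖boxCoeff (8 * L) u k - boxCoeff (8 * L) v k‖ ^ 2)
    set X := ((2 : ℝ) ^ (-(γ + α))) ^ J with hX
    have hX0 : 0 ≤ X := by positivity
    have h1 : 0 ≤ S * T := by positivity
    have h2 : √C' * S * T + X ≤ (√C' + 1) * (S * T + X) := by
      nlinarith [Real.sqrt_nonneg C', mul_nonneg (Real.sqrt_nonneg C') hX0]
    calc _ ≤ C * ((√C' + 1) * (S * T + X)) := mul_le_mul_of_nonneg_left h2 hC
      _ = _ := by ring

/-- For integral `γ` the squares of the weighted coefficients of a test function are summable over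
all levels at once, as for a function of the Sobolev space `W^{γ,2}`. -/
theorem holderIPM_le_of_nat (hα : 0 < α) (hL : 0 < L) (m : ℕ) :
    ∃ C : ℝ, 0 ≤ C ∧ ∀ (u v : Euc d → ℝ), HolderDensity d α L u → HolderDensity d α L v →
      ∀ (J : ℕ),
      holderIPM m (volume.withDensity fun y => ENNReal.ofReal (u y))
          (volume.withDensity fun y => ENNReal.ofReal (v y))
        ≤ ENNReal.ofReal (C * (√(∑ k ∈ freqBox d J, ((4 : ℝ) ^ (m * freqLevel k))⁻¹
              * ‖boxCoeff (8 * L) u k - boxCoeff (8 * L) v k‖ ^ 2)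
          + ((2 : ℝ) ^ (-(m + α))) ^ J)) := by
  have hR : 0 < 8 * L := by linarith
  have hm : (0 : ℝ) ≤ m := Nat.cast_nonneg m
  obtain ⟨B, C, hC, h⟩ := holderIPM_le_of_weights_bound (d := d) hα hL hm
  obtain ⟨C', hC', h'⟩ := exists_sum_boxCoeff_le (d := d) (B := B) hR hm
  refine ⟨C * (√C' + 1), by positivity, fun u v hu hv J => ?_⟩
  refine (h u v hu hv J (fun j => ((4 : ℝ) ^ (m * j))⁻¹) C' (fun j => by positivity)
    fun F hF => ?_).trans (ENNReal.ofReal_le_ofReal ?_)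
  · have := h' F hF J
    simp only [Nat.ceil_natCast, sub_self, mul_zero, Real.rpow_zero, mul_one] at this
    simpa using this
  · set T := √(∑ k ∈ freqBox d J, ((4 : ℝ) ^ (m * freqLevel k))⁻¹
              * ‖boxCoeff (8 * L) u k - boxCoeff (8 * L) v k‖ ^ 2)
    set X := ((2 : ℝ) ^ (-(m + α))) ^ J with hX
    have hX0 : 0 ≤ X := by positivity
    have h1 : 0 ≤ T := by positivity
    have h2 : √C' * T + X ≤ (√C' + 1) * (T + X) := by
      nlinarith [Real.sqrt_nonneg C', mul_nonneg (Real.sqrt_nonneg C') hX0]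
    calc _ ≤ C * ((√C' + 1) * (T + X)) := mul_le_mul_of_nonneg_left h2 hC
      _ = _ := by ring

end

/-! ### Forster–Warmuth regression -/

section FW

open Matrix

variable {ι : Type*} [DecidableEq ι]

/-- The regularised Gram matrix `1 + ∑ i, φ i (φ i)ᵀ` of a family of feature vectors. -/
def ridgeGram {N : Type*} [Fintype N] (Φ : N → ι → ℝ) : Matrix ι ι ℝ :=
  1 + ∑ i, vecMulVec (Φ i) (Φ i)

/-- The Forster–Warmuth predictor at a point with feature vector `φ`, from observations `z` at points
with feature vectors `Φ`: the ridge prediction with the new point included in the Gram matrix, shrunk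
by one minus the leverage of the new point. -/
noncomputable def fwPredict [Fintype ι] {n : ℕ} (φ : ι → ℝ) (Φ : Fin n → ι → ℝ) (z : Fin n → ℝ) : ℝ :=
  (1 - φ ⬝ᵥ (ridgeGram (Fin.cons φ Φ : Fin (n + 1) → ι → ℝ))⁻¹ *ᵥ φ)
    * (φ ⬝ᵥ (ridgeGram (Fin.cons φ Φ : Fin (n + 1) → ι → ℝ))⁻¹ *ᵥ (∑ j, z j • Φ j))

section

variable [Fintype ι] {N : Type*} [Fintype N] (Φ : N → ι → ℝ)

theorem ridgeGram_mulVec (v : ι → ℝ) :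
    ridgeGram Φ *ᵥ v = v + ∑ i, (Φ i ⬝ᵥ v) • Φ i := by
  unfold ridgeGram
  rw [add_mulVec, one_mulVec, sum_mulVec]
  congr 1
  refine Finset.sum_congr rfl fun i _ => ?_
  rw [vecMulVec_mulVec]
  ext a
  simp [mul_comm]

theorem posDef_ridgeGram : (ridgeGram Φ).PosDef := by
  refine Matrix.PosDef.add_posSemidef Matrix.PosDef.one ?_
  refine Matrix.posSemidef_sum _ fun i _ => ?_
  simpa using posSemidef_vecMulVec_self_star (Φ i)

theorem ridgeGram_mul_inv : ridgeGram Φ * (ridgeGram Φ)⁻¹ = 1 :=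
  mul_nonsing_inv _ ((isUnit_iff_isUnit_det _).1 (posDef_ridgeGram Φ).isUnit)

theorem ridgeGram_inv_mul : (ridgeGram Φ)⁻¹ * ridgeGram Φ = 1 :=
  nonsing_inv_mul _ ((isUnit_iff_isUnit_det _).1 (posDef_ridgeGram Φ).isUnit)

theorem leverage_mem_Icc (i : N) :
    Φ i ⬝ᵥ (ridgeGram Φ)⁻¹ *ᵥ Φ i ∈ Set.Icc (0 : ℝ) 1 := by
  set a := (ridgeGram Φ)⁻¹ *ᵥ Φ i with ha
  have h1 : ridgeGram Φ *ᵥ a = Φ i := by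
    rw [ha, mulVec_mulVec, ridgeGram_mul_inv, one_mulVec]
  have h2 : Φ i ⬝ᵥ a = a ⬝ᵥ a + ∑ j, (Φ j ⬝ᵥ a) ^ 2 := by
    conv_lhs => rw [← h1, ridgeGram_mulVec, add_dotProduct, sum_dotProduct]
    congr 1
    refine Finset.sum_congr rfl fun j _ => ?_
    rw [smul_dotProduct, smul_eq_mul, sq]
  have h3 : (Φ i ⬝ᵥ a) ^ 2 ≤ ∑ j, (Φ j ⬝ᵥ a) ^ 2 :=
    Finset.single_le_sum (f := fun j => (Φ j ⬝ᵥ a) ^ 2) (fun _ _ => sq_nonneg _)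
      (Finset.mem_univ i)
  have h4 : 0 ≤ a ⬝ᵥ a := Finset.sum_nonneg fun j _ => mul_self_nonneg _
  constructor
  · nlinarith [sq_nonneg (Φ i ⬝ᵥ a)]
  · nlinarith [sq_nonneg (Φ i ⬝ᵥ a)]

/-- The sum of the leverages is at most the number of features that do not vanish on the design. -/
theorem sum_leverage_le (S : Finset ι) (hS : ∀ i, ∀ a ∉ S, Φ i a = 0) :
    ∑ i, Φ i ⬝ᵥ (ridgeGram Φ)⁻¹ *ᵥ Φ i ≤ S.card := by
  set M := (ridgeGram Φ)⁻¹ with hM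
  have h1 : ∑ i, Φ i ⬝ᵥ M *ᵥ Φ i = (1 - M).trace := by
    have e : 1 - M = M * ∑ i, vecMulVec (Φ i) (Φ i) := by
      have : M * ridgeGram Φ = 1 := ridgeGram_inv_mul Φ
      unfold ridgeGram at this
      rw [mul_add, mul_one] at this
      rw [← this]; abel
    rw [e, Matrix.mul_sum, trace_sum]
    refine Finset.sum_congr rfl fun i _ => ?_
    rw [mul_vecMulVec, trace_vecMulVec, dotProduct_comm]
  have hpos : ∀ a, 0 ≤ M a a := fun a => by
    have := (posDef_ridgeGram Φ).inv.posSemidef.diag_nonneg (i := a)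
    exact this
  have hone : ∀ a ∉ S, M a a = 1 := by
    intro a ha
    have h2 : ridgeGram Φ *ᵥ Pi.single a 1 = Pi.single a 1 := by
      rw [ridgeGram_mulVec]
      simp [hS _ a ha]
    have h3 : M *ᵥ Pi.single a 1 = Pi.single a 1 := by
      conv_lhs => rw [← h2]
      rw [mulVec_mulVec, ridgeGram_inv_mul, one_mulVec]
    have := congrFun h3 a
    simpa using this
  rw [h1, Matrix.trace]
  simp only [diag_apply, Matrix.sub_apply, one_apply_eq]
  rw [← Finset.sum_subset (Finset.subset_univ S) fun a _ ha => by rw [hone a ha, sub_self]]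
  calc _ ≤ ∑ a ∈ S, (1 : ℝ) := Finset.sum_le_sum fun a _ => by linarith [hpos a]
    _ = _ := by simp

/-- The ridge estimator minimises the regularised square loss. -/
theorem sum_ridge_residual_sq_le (z : N → ℝ) (θ : ι → ℝ) :
    ∑ i, (z i - Φ i ⬝ᵥ (ridgeGram Φ)⁻¹ *ᵥ (∑ j, z j • Φ j)) ^ 2
      ≤ ∑ i, (z i - Φ i ⬝ᵥ θ) ^ 2 + θ ⬝ᵥ θ := by
  set t := (ridgeGram Φ)⁻¹ *ᵥ (∑ j, z j • Φ j) with ht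
  have h1 : t + ∑ i, (Φ i ⬝ᵥ t) • Φ i = ∑ j, z j • Φ j := by
    rw [← ridgeGram_mulVec, ht, mulVec_mulVec, ridgeGram_mul_inv, one_mulVec]
  set η := θ - t with hη
  have h2 : t ⬝ᵥ η + ∑ i, (Φ i ⬝ᵥ t) * (Φ i ⬝ᵥ η) = ∑ i, z i * (Φ i ⬝ᵥ η) := by
    have := congrArg (fun v => v ⬝ᵥ η) h1
    simpa [add_dotProduct, sum_dotProduct, smul_dotProduct] using this
  have hθ : θ = t + η := by rw [hη]; abel
  have h3 : ∑ i, (z i - Φ i ⬝ᵥ θ) ^ 2 = ∑ i, (z i - Φ i ⬝ᵥ t) ^ 2 + ∑ i, (Φ i ⬝ᵥ η) ^ 2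
      - 2 * (∑ i, z i * (Φ i ⬝ᵥ η) - ∑ i, (Φ i ⬝ᵥ t) * (Φ i ⬝ᵥ η)) := by
    rw [hθ, ← Finset.sum_add_distrib, ← Finset.sum_sub_distrib, Finset.mul_sum,
      ← Finset.sum_sub_distrib]
    refine Finset.sum_congr rfl fun i _ => ?_
    rw [dotProduct_add]; ring
  have h4 : θ ⬝ᵥ θ = t ⬝ᵥ t + 2 * (t ⬝ᵥ η) + η ⬝ᵥ η := by
    rw [hθ, add_dotProduct, dotProduct_add, dotProduct_add, dotProduct_comm η t]; ring
  have h5 : 0 ≤ t ⬝ᵥ t := Finset.sum_nonneg fun j _ => mul_self_nonneg _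
  have h6 : 0 ≤ η ⬝ᵥ η := Finset.sum_nonneg fun j _ => mul_self_nonneg _
  have h7 : 0 ≤ ∑ i, (Φ i ⬝ᵥ η) ^ 2 := Finset.sum_nonneg fun j _ => sq_nonneg _
  rw [h3, h4]
  linarith

end

theorem ridgeGram_cons_removeNth {n : ℕ} (Φ : Fin (n + 1) → ι → ℝ) (i : Fin (n + 1)) :
    ridgeGram (Fin.cons (Φ i) (fun j => Φ (i.succAbove j)) : Fin (n + 1) → ι → ℝ)
      = ridgeGram Φ := by
  unfold ridgeGram
  congr 1
  rw [Fin.sum_univ_succ, Fin.sum_univ_succAbove _ i]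
  simp

/-- The leave-one-out predictions of the Forster–Warmuth predictor have square loss at most that of
any linear predictor `θ`, up to a multiple of the number of active features. The shrinkage makes
the leave-one-out residual a convex combination of the ridge residual and of a multiple of `z i`. -/
theorem sum_fwPredict_loo_sq_le [Fintype ι] {n : ℕ} (Φ : Fin (n + 1) → ι → ℝ) (z : Fin (n + 1) → ℝ)
    (hz : ∀ i, |z i| ≤ 1) (S : Finset ι) (hS : ∀ i, ∀ a ∉ S, Φ i a = 0) (θ : ι → ℝ) :
    ∑ i, (z i - fwPredict (Φ i) (fun j => Φ (i.succAbove j)) (fun j => z (i.succAbove j))) ^ 2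
      ≤ ∑ i, (z i - Φ i ⬝ᵥ θ) ^ 2 + (θ ⬝ᵥ θ + 4 * S.card) := by
  set G := ridgeGram Φ with hG
  have hterm : ∀ i, (z i - fwPredict (Φ i) (fun j => Φ (i.succAbove j))
        (fun j => z (i.succAbove j))) ^ 2
      ≤ (z i - Φ i ⬝ᵥ G⁻¹ *ᵥ (∑ j, z j • Φ j)) ^ 2 + 4 * (Φ i ⬝ᵥ G⁻¹ *ᵥ Φ i) := by
    intro i
    have hsum : ∑ j, z (i.succAbove j) • Φ (i.succAbove j) = ∑ j, z j • Φ j - z i • Φ i := by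
      rw [Fin.sum_univ_succAbove _ i]; abel
    unfold fwPredict
    rw [ridgeGram_cons_removeNth, ← hG, hsum, mulVec_sub, dotProduct_sub, mulVec_smul,
      dotProduct_smul, smul_eq_mul]
    obtain ⟨h0, h1⟩ := leverage_mem_Icc Φ i
    rw [← hG] at h0 h1
    set h := Φ i ⬝ᵥ G⁻¹ *ᵥ Φ i
    set f := Φ i ⬝ᵥ G⁻¹ *ᵥ (∑ j, z j • Φ j)
    have e : z i - (1 - h) * (f - z i * h) = (1 - h) * (z i - f) + h * ((2 - h) * z i) := by ring
    have hz2 : z i ^ 2 ≤ 1 := by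
      rw [← sq_abs]; exact pow_le_one₀ (abs_nonneg _) (hz i)
    have hconv : ((1 - h) * (z i - f) + h * ((2 - h) * z i)) ^ 2
        ≤ (1 - h) * (z i - f) ^ 2 + h * ((2 - h) * z i) ^ 2 := by
      nlinarith [mul_nonneg (mul_nonneg h0 (sub_nonneg.2 h1))
        (sq_nonneg ((z i - f) - (2 - h) * z i))]
    have h4 : ((2 - h) * z i) ^ 2 ≤ 4 := by
      rw [mul_pow]
      have : (2 - h) ^ 2 ≤ 4 := by nlinarith
      nlinarith [sq_nonneg (z i), sq_nonneg (2 - h)]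
    rw [e]
    nlinarith [mul_le_mul_of_nonneg_left h4 h0, mul_nonneg h0 (sq_nonneg (z i - f))]
  refine (Finset.sum_le_sum fun i _ => hterm i).trans ?_
  rw [Finset.sum_add_distrib, ← Finset.mul_sum]
  have h1 := sum_ridge_residual_sq_le Φ z θ
  have h2 := sum_leverage_le Φ S hS
  rw [← hG] at h1 h2
  linarith

theorem measurable_matrix_inv_apply [Fintype ι] {X : Type*} [MeasurableSpace X] {M : X → Matrix ι ι ℝ}
    (hM : ∀ a b, Measurable fun x => M x a b) (a b : ι) : Measurable fun x => (M x)⁻¹ a b := by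
  have hdet : ∀ {M : X → Matrix ι ι ℝ}, (∀ a b, Measurable fun x => M x a b) →
      Measurable fun x => (M x).det := by
    intro M hM
    simp only [det_apply]
    refine Finset.measurable_sum _ fun σ _ => ?_
    exact (Finset.measurable_prod _ fun i _ => hM _ _).const_smul _
  simp only [inv_def, Ring.inverse_eq_inv', Matrix.smul_apply, smul_eq_mul, adjugate_apply]
  refine (hdet hM).inv.mul (hdet fun i j => ?_)
  by_cases hi : i = b
  · subst hi; simp
  · simpa [updateRow_ne hi] using hM i j

theorem measurable_fwPredict [Fintype ι] {X : Type*} [MeasurableSpace X] {n : ℕ} {φ : X → ι → ℝ}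
    {Φ : X → Fin n → ι → ℝ} {z : X → Fin n → ℝ} (hφ : Measurable φ) (hΦ : Measurable Φ)
    (hz : Measurable z) : Measurable fun x => fwPredict (φ x) (Φ x) (z x) := by
  have h1 : ∀ a, Measurable fun x => φ x a := fun a => (measurable_pi_apply a).comp hφ
  have h2 : ∀ j a, Measurable fun x => Φ x j a := fun j a =>
    (measurable_pi_apply a).comp ((measurable_pi_apply j).comp hΦ)
  have h3 : ∀ j, Measurable fun x => z x j := fun j => (measurable_pi_apply j).comp hz
  have hG : ∀ a b, Measurable fun x =>
      (ridgeGram (Fin.cons (φ x) (Φ x) : Fin (n + 1) → ι → ℝ)) a b := by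
    intro a b
    simp only [ridgeGram, Matrix.add_apply, Matrix.sum_apply, vecMulVec_apply, Fin.sum_univ_succ, Fin.cons_zero,
      Fin.cons_succ]
    exact measurable_const.add (((h1 a).mul (h1 b)).add
      (Finset.measurable_sum _ fun j _ => (h2 j a).mul (h2 j b)))
  have hI := measurable_matrix_inv_apply hG
  have hquad : ∀ {w : X → ι → ℝ}, (∀ a, Measurable fun x => w x a) → Measurable fun x =>
      φ x ⬝ᵥ (ridgeGram (Fin.cons (φ x) (Φ x) : Fin (n + 1) → ι → ℝ))⁻¹ *ᵥ (w x) := by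
    intro w hw
    simp only [dotProduct, mulVec]
    exact Finset.measurable_sum _ fun a _ => (h1 a).mul
      (Finset.measurable_sum _ fun b _ => (hI a b).mul (hw b))
  unfold fwPredict
  refine (measurable_const.sub (hquad h1)).mul (hquad fun a => ?_)
  simp only [Finset.sum_apply, Pi.smul_apply, smul_eq_mul]
  exact Finset.measurable_sum _ fun j _ => (h3 j).mul (h2 j a)

end FW

section FWRisk

open Matrix

variable {ι : Type*} [DecidableEq ι] [Fintype ι] {X Y : Type*} [MeasurableSpace X]
  [MeasurableSpace Y]

/-- The mean square error is the variance plus the squared bias. -/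
theorem lintegral_sq_sub_eq {ν : Measure Y} [IsProbabilityMeasure ν] {ζ : Y → ℝ}
    (hζ : Measurable ζ) (hb : ∀ y, |ζ y| ≤ 1) (t : ℝ) :
    ∫⁻ y, ENNReal.ofReal ((ζ y - t) ^ 2) ∂ν
      = ∫⁻ y, ENNReal.ofReal ((ζ y - ∫ y, ζ y ∂ν) ^ 2) ∂ν
        + ENNReal.ofReal ((t - ∫ y, ζ y ∂ν) ^ 2) := by
  set c := ∫ y, ζ y ∂ν with hc
  have hi : Integrable ζ ν := .of_bound hζ.aestronglyMeasurable 1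
    (Filter.Eventually.of_forall fun y => by simpa using hb y)
  have hi2 : Integrable (fun y => ζ y ^ 2) ν := .of_bound (hζ.pow_const 2).aestronglyMeasurable 1
    (Filter.Eventually.of_forall fun y => by
      rw [norm_pow]; exact pow_le_one₀ (norm_nonneg _) (hb y))
  have hsq : ∀ t : ℝ, (fun y => (ζ y - t) ^ 2) = fun y => ζ y ^ 2 - 2 * t * ζ y + t ^ 2 := by
    intro t; funext y; ring
  have hint : ∀ t : ℝ, Integrable (fun y => (ζ y - t) ^ 2) ν := fun t => by
    rw [hsq]; exact (hi2.sub (hi.const_mul _)).add (integrable_const _)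
  have hval : ∀ t : ℝ, ∫ y, (ζ y - t) ^ 2 ∂ν = ∫ y, ζ y ^ 2 ∂ν - 2 * t * c + t ^ 2 := fun t => by
    have hsub : Integrable (fun y => ζ y ^ 2 - 2 * t * ζ y) ν := hi2.sub (hi.const_mul _)
    rw [hsq, integral_add hsub (integrable_const _),
      integral_sub hi2 (hi.const_mul _), integral_const_mul]
    simp [hc]
  rw [← ofReal_integral_eq_lintegral_ofReal (hint t)
      (Filter.Eventually.of_forall fun y => sq_nonneg _),
    ← ofReal_integral_eq_lintegral_ofReal (hint c)
      (Filter.Eventually.of_forall fun y => sq_nonneg _),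
    ← ENNReal.ofReal_add (integral_nonneg fun y => sq_nonneg _) (sq_nonneg _), hval, hval]
  congr 1; ring

theorem measurable_condMean {κ : Kernel X Y} {ζ : Y → ℝ} (hζ : Measurable ζ) :
    Measurable fun x => ∫ y, ζ y ∂(κ x) :=
  (hζ.stronglyMeasurable.integral_kernel (κ := κ)).measurable

variable {μ : Measure X} [IsProbabilityMeasure μ] {κ : Kernel X Y} [IsMarkovKernel κ]

theorem lintegral_compProd_sq_sub_eq {ζ : Y → ℝ} (hζ : Measurable ζ) (hb : ∀ y, |ζ y| ≤ 1)
    {T : X → ℝ} (hT : Measurable T) :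
    ∫⁻ w, ENNReal.ofReal ((ζ w.2 - T w.1) ^ 2) ∂(μ ⊗ₘ κ)
      = ∫⁻ w, ENNReal.ofReal ((ζ w.2 - ∫ y, ζ y ∂(κ w.1)) ^ 2) ∂(μ ⊗ₘ κ)
        + ∫⁻ x, ENNReal.ofReal ((T x - ∫ y, ζ y ∂(κ x)) ^ 2) ∂μ := by
  have hc := measurable_condMean (κ := κ) hζ
  have hm : ∀ {S : X → ℝ}, Measurable S →
      Measurable fun w : X × Y => ENNReal.ofReal ((ζ w.2 - S w.1) ^ 2) := fun hS =>
    (((hζ.comp measurable_snd).sub (hS.comp measurable_fst)).pow_const 2).ennreal_ofReal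
  rw [Measure.lintegral_compProd (hm hT), Measure.lintegral_compProd (hm hc), ← lintegral_add_right]
  · exact lintegral_congr fun x => lintegral_sq_sub_eq hζ hb (T x)
  · exact ((hT.sub hc).pow_const 2).ennreal_ofReal

/-- The risk of the Forster–Warmuth predictor: no assumption on the distribution of the design is
needed. -/
theorem lintegral_fwPredict_sq_sub_le (n : ℕ) {φ : X → ι → ℝ} (hφ : Measurable φ) {ζ : Y → ℝ}
    (hζ : Measurable ζ) (hb : ∀ y, |ζ y| ≤ 1) (S : Finset ι)
    (hS : ∀ᵐ x ∂μ, ∀ a ∉ S, φ x a = 0) (θ : ι → ℝ) :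
    ∫⁻ s, ∫⁻ x, ENNReal.ofReal ((fwPredict (φ x) (fun j => φ (s j).1) (fun j => ζ (s j).2)
        - ∫ y, ζ y ∂(κ x)) ^ 2) ∂μ ∂(Measure.pi fun _ : Fin n => μ ⊗ₘ κ)
      ≤ ∫⁻ x, ENNReal.ofReal ((φ x ⬝ᵥ θ - ∫ y, ζ y ∂(κ x)) ^ 2) ∂μ
        + ENNReal.ofReal ((θ ⬝ᵥ θ + 4 * S.card) / (n + 1)) := by
  set P := μ ⊗ₘ κ with hP
  set T : (Fin n → X × Y) → X → ℝ := fun s x =>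
    fwPredict (φ x) (fun j => φ (s j).1) (fun j => ζ (s j).2) with hT
  have hTm : Measurable fun p : (Fin n → X × Y) × X => T p.1 p.2 := by
    refine measurable_fwPredict (hφ.comp measurable_snd) (measurable_pi_lambda _ fun j => ?_)
      (measurable_pi_lambda _ fun j => ?_)
    · exact hφ.comp (measurable_fst.comp ((measurable_pi_apply j).comp measurable_fst))
    · exact hζ.comp (measurable_snd.comp ((measurable_pi_apply j).comp measurable_fst))
  have hc := measurable_condMean (κ := κ) hζ
  have hdot : Measurable fun x => φ x ⬝ᵥ θ := by
    simp only [dotProduct]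
    exact Finset.measurable_sum _ fun a _ => ((measurable_pi_apply a).comp hφ).mul_const _
  set V := ∫⁻ w, ENNReal.ofReal ((ζ w.2 - ∫ y, ζ y ∂(κ w.1)) ^ 2) ∂P with hV
  have hVfin : V ≠ ∞ := by
    refine (lt_of_le_of_lt (lintegral_mono (g := fun _ => ENNReal.ofReal 4) fun w => ?_) (by
      simp)).ne
    refine ENNReal.ofReal_le_ofReal ?_
    have h1 : |∫ y, ζ y ∂(κ w.1)| ≤ 1 := by
      have := norm_integral_le_of_norm_le_const (μ := κ w.1) (f := ζ) (C := 1)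
        (Filter.Eventually.of_forall fun y => by simpa using hb y)
      simpa using this
    have h2 := abs_le.1 h1
    have h3 := abs_le.1 (hb w.2)
    nlinarith
  -- the fresh observation together with the sample, exchangeably
  have hloo : (n + 1 : ℝ≥0∞) * ∫⁻ s, ∫⁻ w, ENNReal.ofReal ((ζ w.2 - T s w.1) ^ 2) ∂P
        ∂(Measure.pi fun _ : Fin n => P)
      ≤ (n + 1 : ℝ≥0∞) * ∫⁻ w, ENNReal.ofReal ((ζ w.2 - φ w.1 ⬝ᵥ θ) ^ 2) ∂P
        + ENNReal.ofReal (θ ⬝ᵥ θ + 4 * S.card) := by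
    set g : (X × Y) × (Fin n → X × Y) → ℝ≥0∞ := fun q =>
      ENNReal.ofReal ((ζ q.1.2 - T q.2 q.1.1) ^ 2) with hg
    have hgm : Measurable g := by
      refine (((hζ.comp (measurable_snd.comp measurable_fst)).sub ?_).pow_const 2).ennreal_ofReal
      exact hTm.comp (measurable_snd.prodMk (measurable_fst.comp measurable_fst))
    have e1 : ∫⁻ s, ∫⁻ w, ENNReal.ofReal ((ζ w.2 - T s w.1) ^ 2) ∂P
        ∂(Measure.pi fun _ : Fin n => P) = ∫⁻ q, g q ∂(P.prod (Measure.pi fun _ : Fin n => P)) := by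
      rw [lintegral_prod_symm' _ hgm]
    have e2 : ∀ i : Fin (n + 1), ∫⁻ q, g q ∂(P.prod (Measure.pi fun _ : Fin n => P))
        = ∫⁻ w, g (w i, fun j => w (i.succAbove j)) ∂(Measure.pi fun _ : Fin (n + 1) => P) := by
      intro i
      exact ((measurePreserving_piFinSuccAbove (fun _ : Fin (n + 1) => P) i).lintegral_comp
        hgm).symm
    have hgi : ∀ i : Fin (n + 1), Measurable fun w : Fin (n + 1) → X × Y =>
        g (w i, fun j => w (i.succAbove j)) := fun i =>
      hgm.comp ((measurable_pi_apply i).prodMk (measurable_pi_lambda _ fun j =>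
        measurable_pi_apply _))
    have e3 : (n + 1 : ℝ≥0∞) * ∫⁻ q, g q ∂(P.prod (Measure.pi fun _ : Fin n => P))
        = ∫⁻ w, ∑ i : Fin (n + 1), g (w i, fun j => w (i.succAbove j))
            ∂(Measure.pi fun _ : Fin (n + 1) => P) := by
      rw [lintegral_finsetSum _ fun i _ => hgi i, Finset.sum_congr rfl fun i _ => (e2 i).symm]
      simp
    have hae : ∀ᵐ w ∂(Measure.pi fun _ : Fin (n + 1) => P), ∀ i, ∀ a ∉ S, φ (w i).1 a = 0 := by
      rw [ae_all_iff]
      intro i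
      have h1 : ∀ᵐ w ∂P, ∀ a ∉ S, φ w.1 a = 0 := by
        have : Measure.map Prod.fst P = μ := by
          rw [hP]; exact Measure.fst_compProd μ κ
        rw [← this] at hS
        exact ae_of_ae_map measurable_fst.aemeasurable hS
      exact (Measure.quasiMeasurePreserving_eval (fun _ : Fin (n + 1) => P) i).ae h1
    rw [e1, e3]
    have hfin : ∀ i : Fin (n + 1), Measurable fun w : Fin (n + 1) → X × Y =>
        ENNReal.ofReal ((ζ (w i).2 - φ (w i).1 ⬝ᵥ θ) ^ 2) := fun i =>
      (((hζ.comp (measurable_snd.comp (measurable_pi_apply i))).sub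
        (hdot.comp (measurable_fst.comp (measurable_pi_apply i)))).pow_const 2).ennreal_ofReal
    have hq : ∀ i : Fin (n + 1), ∫⁻ w, ENNReal.ofReal ((ζ (w i).2 - φ (w i).1 ⬝ᵥ θ) ^ 2)
          ∂(Measure.pi fun _ : Fin (n + 1) => P)
        = ∫⁻ w, ENNReal.ofReal ((ζ w.2 - φ w.1 ⬝ᵥ θ) ^ 2) ∂P := by
      intro i
      exact (measurePreserving_eval (fun _ : Fin (n + 1) => P) i).lintegral_comp
        (f := fun w : X × Y => ENNReal.ofReal ((ζ w.2 - φ w.1 ⬝ᵥ θ) ^ 2))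
        (((hζ.comp measurable_snd).sub (hdot.comp measurable_fst)).pow_const 2).ennreal_ofReal
    calc _ ≤ ∫⁻ w, (∑ i : Fin (n + 1), ENNReal.ofReal ((ζ (w i).2 - φ (w i).1 ⬝ᵥ θ) ^ 2)
              + ENNReal.ofReal (θ ⬝ᵥ θ + 4 * S.card)) ∂(Measure.pi fun _ : Fin (n + 1) => P) := by
          refine lintegral_mono_ae ?_
          filter_upwards [hae] with w hw
          have h1 := sum_fwPredict_loo_sq_le (fun i => φ (w i).1) (fun i => ζ (w i).2)
            (fun i => hb _) S hw θ
          simp only [hg, hT]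
          rw [← ENNReal.ofReal_sum_of_nonneg fun i _ => sq_nonneg _,
            ← ENNReal.ofReal_sum_of_nonneg fun i _ => sq_nonneg _, ← ENNReal.ofReal_add
              (Finset.sum_nonneg fun i _ => sq_nonneg _)]
          · exact ENNReal.ofReal_le_ofReal h1
          · have : 0 ≤ θ ⬝ᵥ θ := Finset.sum_nonneg fun j _ => mul_self_nonneg _
            positivity
      _ = _ := by
          rw [lintegral_add_right _ measurable_const, lintegral_finsetSum _ fun i _ => hfin i,
            Finset.sum_congr rfl fun i _ => hq i]
          simp
  have hpyth : ∀ {U : X → ℝ}, Measurable U → ∫⁻ w, ENNReal.ofReal ((ζ w.2 - U w.1) ^ 2) ∂P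
      = V + ∫⁻ x, ENNReal.ofReal ((U x - ∫ y, ζ y ∂(κ x)) ^ 2) ∂μ := fun hU =>
    lintegral_compProd_sq_sub_eq hζ hb hU
  have hTs : ∀ s, Measurable (T s) := fun s => hTm.comp (measurable_const.prodMk measurable_id)
  rw [hpyth hdot, lintegral_congr fun s => hpyth (hTs s), lintegral_add_left measurable_const,
    lintegral_const, measure_univ, mul_one, mul_add, mul_add, add_assoc] at hloo
  have hn : (n + 1 : ℝ≥0∞) ≠ 0 := by simp
  have hn' : (n + 1 : ℝ≥0∞) ≠ ∞ := by simp
  have h1 := (ENNReal.add_le_add_iff_left (ENNReal.mul_ne_top hn' hVfin)).1 hloo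
  rw [← ENNReal.mul_le_mul_iff_right hn hn']
  refine h1.trans (le_of_eq ?_)
  rw [mul_add]
  congr 1
  have e : (n + 1 : ℝ≥0∞) = ENNReal.ofReal (n + 1) := by
    rw [ENNReal.ofReal_add (by positivity) zero_le_one]; simp
  rw [e, ← ENNReal.ofReal_mul (by positivity)]
  congr 1
  field_simp

end FWRisk

/-! ### Piecewise polynomials on a grid -/

/-- Functions of a Hölder ball are equicontinuous. -/
theorem HolderBall.exists_abs_sub_le {d : ℕ} {α r : ℝ} (hα : 0 < α) (hr : 0 ≤ r) :
    ∃ C : ℝ, 0 ≤ C ∧ ∀ f ∈ HolderBall d α r, ∀ x y, ‖x - y‖ ≤ 1 →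
      |f x - f y| ≤ C * ‖x - y‖ ^ min 1 α := by
  set K := ⌈α⌉₊ with hK
  obtain ⟨p, hp⟩ : ∃ p, K = p + 1 := ⟨K - 1, by have := Nat.ceil_pos.2 hα; omega⟩
  refine ⟨(∑ k ∈ Finset.range p, (d : ℝ) ^ (k + 1) * r) + (d : ℝ) ^ (K - 1) * r,
    by positivity, fun f hf x y hxy => ?_⟩
  have hT := HolderBall.taylor hα hr hf y x
  rw [← hK, hp, Finset.sum_range_succ'] at hT
  set v := x - y with hv
  have hmin : (0 : ℝ) < min 1 α := lt_min one_pos hα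
  have hle : ∀ s : ℝ, min 1 α ≤ s → ‖v‖ ^ s ≤ ‖v‖ ^ min 1 α := fun s hs => by
    rcases (norm_nonneg v).eq_or_lt with h | h
    · rw [← h, Real.zero_rpow hmin.ne', Real.zero_rpow (by linarith)]
    · exact Real.rpow_le_rpow_of_exponent_ge h hxy hs
  have h1 : |∑ k ∈ Finset.range p, ∑ m : Fin (k + 1) → Fin d,
      ((((k + 1).factorial : ℝ)⁻¹ * iteratedFDeriv ℝ (k + 1) f y
        fun l => EuclideanSpace.single (m l) (1 : ℝ)) * ∏ l, v (m l))|
      ≤ (∑ k ∈ Finset.range p, (d : ℝ) ^ (k + 1) * r) * ‖v‖ ^ min 1 α := by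
    rw [Finset.sum_mul]
    refine (Finset.abs_sum_le_sum_abs _ _).trans (Finset.sum_le_sum fun k hk => ?_)
    refine (Finset.abs_sum_le_sum_abs _ _).trans ?_
    have : ∀ m : Fin (k + 1) → Fin d, |(((k + 1).factorial : ℝ)⁻¹ * iteratedFDeriv ℝ (k + 1) f y
        fun l => EuclideanSpace.single (m l) (1 : ℝ)) * ∏ l, v (m l)| ≤ r * ‖v‖ ^ min 1 α := by
      intro m
      rw [abs_mul, abs_mul]
      have h2 : |∏ l, v (m l)| ≤ ‖v‖ ^ min 1 α := by
        rw [Finset.abs_prod]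
        refine (Finset.prod_le_prod (fun l _ => abs_nonneg _)
          fun l _ => PiLp.norm_apply_le v (m l)).trans ?_
        simp only [Finset.prod_const, Finset.card_univ, Fintype.card_fin]
        rw [← Real.rpow_natCast]
        refine hle _ ((min_le_left _ _).trans ?_)
        push_cast
        linarith [Nat.cast_nonneg (α := ℝ) k]
      have h3 := HolderBall.abs_iteratedFDeriv_le hα hr hf (k := k + 1)
        (by have := Finset.mem_range.1 hk; omega) m y
      have h4 : |(((k + 1).factorial : ℝ))⁻¹| ≤ 1 := by
        rw [abs_of_nonneg (by positivity)]
        exact inv_le_one_of_one_le₀ (by exact_mod_cast Nat.factorial_pos _)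
      calc _ ≤ (1 * r) * ‖v‖ ^ min 1 α := by gcongr
        _ = _ := by ring
    refine (Finset.sum_le_sum fun m _ => this m).trans (le_of_eq ?_)
    simp
    ring
  have h0 : ∑ m : Fin 0 → Fin d, (((Nat.factorial 0 : ℕ) : ℝ)⁻¹ * iteratedFDeriv ℝ 0 f y
        fun l => EuclideanSpace.single (m l) (1 : ℝ)) * ∏ l, v (m l) = f y := by
    simp
  rw [h0] at hT
  have h5 := mul_le_mul_of_nonneg_left (hle α (min_le_right _ _))
    (show 0 ≤ (d : ℝ) ^ (K - 1) * r by positivity)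
  rw [hp] at h5 ⊢
  rw [add_mul]
  have h6 := abs_sub_abs_le_abs_sub (f x - f y) (∑ k ∈ Finset.range p,
    ∑ m : Fin (k + 1) → Fin d,
      ((((k + 1).factorial : ℝ)⁻¹ * iteratedFDeriv ℝ (k + 1) f y
        fun l => EuclideanSpace.single (m l) (1 : ℝ)) * ∏ l, v (m l)))
  rw [← sub_sub, sub_right_comm] at hT
  linarith

/-- The cell of side `δ` that contains a point, by its lower corner in units of `δ`. -/
noncomputable def cellOf {D : ℕ} (δ : ℝ) (x : Euc D) (i : Fin D) : ℤ := ⌊x i / δ⌋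

/-- The lower corner of a cell. -/
noncomputable def corner {D : ℕ} (δ : ℝ) (c : Fin D → ℤ) : Euc D := WithLp.toLp 2 fun i => δ * c i

/-- Index set of the monomials of degree less than `K` on the cells with coordinates in `[-b, b]`;
a monomial of degree `k` is given by the sequence of its `k` variables. -/
abbrev GridIdx (D K b : ℕ) : Type :=
  {c : Fin D → ℤ // c ∈ Fintype.piFinset fun _ : Fin D => Finset.Icc (-(b : ℤ)) b} ×
    (Σ k : Fin K, Fin k → Fin D)

/-- The monomials on the cells of a grid, centred at the lower corners of the cells. -/
noncomputable def gridFeature {D : ℕ} (K b : ℕ) (δ : ℝ) (x : Euc D) (p : GridIdx D K b) : ℝ :=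
  if cellOf δ x = p.1.1 then ∏ l, (x - corner δ p.1.1) (p.2.2 l) else 0

open Classical in
/-- The features living on cells that meet the set `M`. -/
noncomputable def gridActive {D : ℕ} (K b : ℕ) (δ : ℝ) (M : Set (Euc D)) :
    Finset (GridIdx D K b) :=
  Finset.univ.filter fun p => ∃ x ∈ M, cellOf δ x = p.1.1

section

variable {D K b : ℕ} {δ : ℝ}

theorem measurable_cellOf : Measurable (cellOf (D := D) δ) :=
  measurable_pi_lambda _ fun i => Int.measurable_floor.comp
    ((by fun_prop : Measurable fun x : Euc D => x i / δ))

theorem measurable_gridFeature : Measurable (gridFeature (D := D) K b δ) := by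
  refine measurable_pi_lambda _ fun p => ?_
  unfold gridFeature
  refine Measurable.ite (measurable_cellOf (MeasurableSet.singleton p.1.1))
    (Finset.measurable_prod _ fun l _ => ?_) measurable_const
  have : Continuous fun x : Euc D => (x - corner δ p.1.1) (p.2.2 l) := by fun_prop
  exact this.measurable

theorem gridFeature_eq_zero {M : Set (Euc D)} {x : Euc D} (hx : x ∈ M) (p : GridIdx D K b)
    (hp : p ∉ gridActive K b δ M) : gridFeature K b δ x p = 0 := by
  unfold gridFeature
  rw [if_neg]
  intro h
  exact hp (by classical exact Finset.mem_filter.2 ⟨Finset.mem_univ _, x, hx, h⟩)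

theorem norm_sub_corner_le (hδ : 0 < δ) (x : Euc D) :
    ‖x - corner δ (cellOf δ x)‖ ≤ √D * δ := by
  rw [EuclideanSpace.norm_eq]
  have h : ∀ i, ‖(x - corner δ (cellOf δ x)) i‖ ^ 2 ≤ δ ^ 2 := by
    intro i
    have e : (x - corner δ (cellOf δ x)) i = δ * Int.fract (x i / δ) := by
      simp only [corner, cellOf, PiLp.sub_apply, Int.fract]
      field_simp
    rw [e, norm_mul, mul_pow, Real.norm_eq_abs, sq_abs, Real.norm_eq_abs, sq_abs]
    have h1 := Int.fract_nonneg (x i / δ)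
    have h2 := (Int.fract_lt_one (x i / δ)).le
    have : Int.fract (x i / δ) ^ 2 ≤ 1 := pow_le_one₀ h1 h2
    nlinarith [sq_nonneg δ]
  calc _ ≤ √(∑ _i : Fin D, δ ^ 2) := Real.sqrt_le_sqrt (Finset.sum_le_sum fun i _ => h i)
    _ = √D * δ := by
        simp only [Finset.sum_const, Finset.card_univ, Fintype.card_fin, nsmul_eq_mul]
        rw [Real.sqrt_mul (Nat.cast_nonneg _), Real.sqrt_sq hδ.le]

theorem lt_norm_sub_of_cellOf (hδ : 0 < δ) {x x' : Euc D} (i : Fin D)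
    (h : cellOf δ x i + 2 ≤ cellOf δ x' i) : δ < ‖x - x'‖ := by
  have h1 := Int.lt_floor_add_one (x i / δ)
  have h2 := Int.floor_le (x' i / δ)
  unfold cellOf at h
  have h3 : ((⌊x i / δ⌋ : ℤ) : ℝ) + 2 ≤ ⌊x' i / δ⌋ := by exact_mod_cast h
  have h4 : x i / δ + 1 < x' i / δ := by linarith
  rw [← sub_pos] at h4
  have h5 : x i + δ < x' i := by
    have := mul_pos h4 hδ
    have e : (x' i / δ - (x i / δ + 1)) * δ = x' i - (x i + δ) := by field_simp
    rw [e] at this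
    linarith
  have h6 := PiLp.norm_apply_le (x - x') i
  rw [PiLp.sub_apply, Real.norm_eq_abs] at h6
  have h7 : x' i - x i ≤ |x i - x' i| := by rw [abs_sub_comm]; exact le_abs_self _
  linarith

/-- A set of Minkowski dimension at most `d` meets at most a multiple of `δ ^ (-d)` cells of side `δ`:
the cells whose coordinates have prescribed parities are more than `δ` apart. -/
theorem card_cells_le {d : ℕ} {L : ℝ} {M : Set (Euc D)} (hM : MinkowskiDimAtMost D d L M)
    (hδ : 0 < δ) (hδ1 : δ ≤ 1) (s : Finset (Fin D → ℤ)) (hs : ∀ c ∈ s, ∃ x ∈ M, cellOf δ x = c) :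
    (s.card : ℝ) ≤ 2 ^ D * (L * δ ^ (-(d : ℝ))) := by
  classical
  choose! pt hptM hpt using hs
  have hfib : ∀ t : Fin D → ZMod 2,
      ((s.filter fun c => (fun i => (c i : ZMod 2)) = t).card : ℝ) ≤ L * δ ^ (-(d : ℝ)) := by
    intro t
    set s' := s.filter fun c => (fun i => (c i : ZMod 2)) = t with hs'
    have hinj : Set.InjOn pt (s' : Set (Fin D → ℤ)) := by
      intro c hc c' hc' h
      rw [← hpt c (Finset.mem_filter.1 hc).1, ← hpt c' (Finset.mem_filter.1 hc').1, h]
    rw [← Finset.card_image_of_injOn hinj]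
    refine hM.2 δ hδ hδ1 _ (fun x hx => ?_) ?_
    · obtain ⟨c, hc, rfl⟩ := Finset.mem_image.1 (Finset.mem_coe.1 hx)
      exact hptM c (Finset.mem_filter.1 hc).1
    · intro x hx x' hx' hne
      obtain ⟨c, hc, rfl⟩ := Finset.mem_image.1 hx
      obtain ⟨c', hc', rfl⟩ := Finset.mem_image.1 hx'
      obtain ⟨hcs, hct⟩ := Finset.mem_filter.1 hc
      obtain ⟨hcs', hct'⟩ := Finset.mem_filter.1 hc'
      have hcc : c ≠ c' := fun h => hne (by rw [h])
      obtain ⟨i, hi⟩ := Function.ne_iff.1 hcc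
      have hpar : ((c i : ℤ) : ZMod 2) = (c' i : ℤ) := by
        rw [congrFun hct i, congrFun hct' i]
      rw [ZMod.intCast_eq_intCast_iff_dvd_sub] at hpar
      obtain ⟨q, hq⟩ := hpar
      push_cast at hq
      rcases lt_or_gt_of_ne hi with h | h
      · exact lt_norm_sub_of_cellOf hδ i (by rw [hpt c hcs, hpt c' hcs']; omega)
      · rw [norm_sub_rev]
        exact lt_norm_sub_of_cellOf hδ i (by rw [hpt c hcs, hpt c' hcs']; omega)
  have h1 := Finset.card_le_mul_card_image (f := fun c : Fin D → ℤ => fun i => (c i : ZMod 2)) s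
    ⌊L * δ ^ (-(d : ℝ))⌋₊ (fun t _ => Nat.le_floor (hfib t))
  have h2 : (s.image fun c : Fin D → ℤ => fun i => (c i : ZMod 2)).card ≤ 2 ^ D := by
    refine (Finset.card_le_univ _).trans ?_
    simp [ZMod.card]
  have h3 : 0 ≤ L * δ ^ (-(d : ℝ)) := (Nat.cast_nonneg _).trans (hfib 0)
  calc (s.card : ℝ) ≤ (⌊L * δ ^ (-(d : ℝ))⌋₊ * 2 ^ D : ℕ) := by
        exact_mod_cast h1.trans (Nat.mul_le_mul_left _ h2)
    _ ≤ (L * δ ^ (-(d : ℝ))) * 2 ^ D := by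
        push_cast
        exact mul_le_mul_of_nonneg_right (Nat.floor_le h3) (by positivity)
    _ = _ := mul_comm _ _

theorem card_gridActive_le {d : ℕ} {L : ℝ} {M : Set (Euc D)} (hM : MinkowskiDimAtMost D d L M)
    (hδ : 0 < δ) (hδ1 : δ ≤ 1) :
    ((gridActive K b δ M).card : ℝ)
      ≤ (Fintype.card (Σ k : Fin K, Fin k → Fin D)) * (2 ^ D * (L * δ ^ (-(d : ℝ)))) := by
  classical
  set s := (gridActive K b δ M).image fun p => p.1.1 with hs
  have h1 : (gridActive K b δ M).card ≤ Fintype.card (Σ k : Fin K, Fin k → Fin D) * s.card := by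
    refine Finset.card_le_mul_card_image _ _ fun c _ => ?_
    rw [← Finset.card_univ]
    refine Finset.card_le_card_of_injOn (fun p => p.2) (fun p _ => Finset.mem_coe.2 (Finset.mem_univ _)) ?_
    intro p hp p' hp' h
    have e1 := (Finset.mem_filter.1 hp).2
    have e2 := (Finset.mem_filter.1 hp').2
    exact Prod.ext (Subtype.ext (e1.trans e2.symm)) h
  have h2 := card_cells_le hM hδ hδ1 s fun c hc => by
    obtain ⟨p, hp, rfl⟩ := Finset.mem_image.1 hc
    exact (Finset.mem_filter.1 hp).2
  calc ((gridActive K b δ M).card : ℝ)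
      ≤ (Fintype.card (Σ k : Fin K, Fin k → Fin D) : ℝ) * s.card := by exact_mod_cast h1
    _ ≤ _ := mul_le_mul_of_nonneg_left h2 (Nat.cast_nonneg _)

end

section

open Matrix

/-- The coefficients of the Taylor polynomials of `g` at the corners of the cells that meet `M`. -/
noncomputable def gridCoeff {D : ℕ} (K b : ℕ) (δ : ℝ) (M : Set (Euc D)) (g : Euc D → ℝ)
    (p : GridIdx D K b) : ℝ :=
  open Classical in
  if p ∈ gridActive K b δ M then
    ((p.2.1 : ℕ).factorial : ℝ)⁻¹ * iteratedFDeriv ℝ (p.2.1 : ℕ) g (corner δ p.1.1)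
      fun l => EuclideanSpace.single (p.2.2 l) (1 : ℝ)
  else 0

variable {D b : ℕ} {δ α L : ℝ} {M : Set (Euc D)}

theorem abs_gridCoeff_le (hα : 0 < α) (hL : 0 ≤ L) {g : Euc D → ℝ} (hg : g ∈ HolderBall D α L)
    (p : GridIdx D ⌈α⌉₊ b) : |gridCoeff ⌈α⌉₊ b δ M g p| ≤ L := by
  unfold gridCoeff
  split_ifs with hp
  · rw [abs_mul]
    have h1 := HolderBall.abs_iteratedFDeriv_le hα hL hg p.2.1.2 p.2.2 (corner δ p.1.1)
    have h2 : |((p.2.1 : ℕ).factorial : ℝ)⁻¹| ≤ 1 := by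
      rw [abs_of_nonneg (by positivity)]
      exact inv_le_one_of_one_le₀ (by exact_mod_cast Nat.factorial_pos _)
    calc _ ≤ 1 * L := mul_le_mul h2 h1 (abs_nonneg _) zero_le_one
      _ = L := one_mul _
  · simpa using hL

theorem abs_gridFeature_dotProduct_sub_le (hα : 0 < α) (hL : 0 ≤ L) (hδ : 0 < δ)
    {g : Euc D → ℝ} (hg : g ∈ HolderBall D α L) {x : Euc D} (hx : x ∈ M)
    (hb : ∀ i, |cellOf δ x i| ≤ b) :
    |gridFeature ⌈α⌉₊ b δ x ⬝ᵥ gridCoeff ⌈α⌉₊ b δ M g - g x|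
      ≤ (D : ℝ) ^ (⌈α⌉₊ - 1) * L * (√D * δ) ^ α := by
  classical
  have hc : cellOf δ x ∈ Fintype.piFinset fun _ : Fin D => Finset.Icc (-(b : ℤ)) b :=
    Fintype.mem_piFinset.2 fun i => Finset.mem_Icc.2 (abs_le.1 (hb i))
  have e : gridFeature ⌈α⌉₊ b δ x ⬝ᵥ gridCoeff ⌈α⌉₊ b δ M g
      = ∑ k ∈ Finset.range ⌈α⌉₊, ∑ m : Fin k → Fin D,
      ((k.factorial : ℝ)⁻¹ * iteratedFDeriv ℝ k g (corner δ (cellOf δ x))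
        fun l => EuclideanSpace.single (m l) (1 : ℝ))
        * ∏ l, (x - corner δ (cellOf δ x)) (m l) := by
    rw [dotProduct, Fintype.sum_prod_type, Finset.sum_eq_single ⟨cellOf δ x, hc⟩]
    · rw [Fintype.sum_sigma, Finset.sum_range]
      refine Finset.sum_congr rfl fun k _ => Finset.sum_congr rfl fun m _ => ?_
      have hact : ((⟨cellOf δ x, hc⟩, ⟨k, m⟩) : GridIdx D ⌈α⌉₊ b) ∈ gridActive ⌈α⌉₊ b δ M :=
        Finset.mem_filter.2 ⟨Finset.mem_univ _, x, hx, rfl⟩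
      unfold gridFeature gridCoeff
      rw [if_pos rfl, if_pos hact, mul_comm]
    · intro c _ hne
      refine Finset.sum_eq_zero fun σ _ => ?_
      unfold gridFeature
      rw [if_neg, zero_mul]
      exact fun h => hne (Subtype.ext h.symm)
    · intro h; exact absurd (Finset.mem_univ _) h
  rw [e, abs_sub_comm]
  refine (HolderBall.taylor hα hL hg _ x).trans ?_
  refine mul_le_mul_of_nonneg_left ?_ (by positivity)
  exact Real.rpow_le_rpow (norm_nonneg _) (norm_sub_corner_le hδ x) hα.le

theorem abs_cellOf_le {x : Euc D} (hδ : 0 < δ) (hx : ‖x‖ ≤ L) (hb : L / δ + 1 ≤ b) (i : Fin D) :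
    |cellOf δ x i| ≤ b := by
  have h1 := PiLp.norm_apply_le x i
  rw [Real.norm_eq_abs] at h1
  have h2 : |x i / δ| ≤ L / δ := by
    rw [abs_div, abs_of_pos hδ]
    exact div_le_div_of_nonneg_right (h1.trans hx) hδ.le
  have h3 := abs_le.1 h2
  have h4 := Int.floor_le (x i / δ)
  have h5 := Int.lt_floor_add_one (x i / δ)
  unfold cellOf
  rw [abs_le]
  constructor
  · have : -(b : ℝ) ≤ ((⌊x i / δ⌋ : ℤ) : ℝ) := by linarith
    exact_mod_cast this
  · have : ((⌊x i / δ⌋ : ℤ) : ℝ) ≤ b := by linarith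
    exact_mod_cast this

/-- Simultaneous approximation, by piecewise polynomials in `x`, of all the functions
`x ↦ ∫ ζ y * u y x`. The error is the integral of `ζ` against one and the same function `r` of
size `δ ^ α`, so that Bessel's inequality applies to an orthonormal family of functions `ζ`. The
Taylor coefficients of `u y` need not depend measurably on `y`; therefore `y` is rounded to a fine
lattice. -/
theorem exists_grid_approx {d : ℕ} {β : ℝ} (hα : 0 < α) (hβ : 0 < β) (hL : 0 < L) :
    ∃ C : ℝ, 0 ≤ C ∧ ∀ (M : Set (Euc D)) (u : Euc d → Euc D → ℝ),
      (∀ x ∈ M, ‖x‖ ≤ L) → (∀ y, u y ∈ HolderBallOn D α L M) →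
      (∀ x ∈ M, HolderDensity d β L fun y => u y x) →
      ∀ (δ : ℝ) (b : ℕ), 0 < δ → L / δ + 1 ≤ b →
      ∃ θ : (Euc d → ℝ) → GridIdx D ⌈α⌉₊ b → ℝ,
        (∀ ζ : Euc d → ℝ, Measurable ζ → (∀ y, |ζ y| ≤ 1) →
          θ ζ ⬝ᵥ θ ζ ≤ C * (gridActive ⌈α⌉₊ b δ M).card) ∧
        ∀ x ∈ M, ∃ r : Euc d → ℝ, Measurable r ∧ (∀ y, |r y| ≤ C * δ ^ α) ∧
          (∀ y, L < ‖y‖ → r y = 0) ∧ ∀ ζ : Euc d → ℝ, Measurable ζ → (∀ y, |ζ y| ≤ 1) →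
            gridFeature ⌈α⌉₊ b δ x ⬝ᵥ θ ζ - ∫ y, u y x * ζ y = ∫ y, r y * ζ y := by
  obtain ⟨C₁, hC₁, hcont⟩ := HolderBall.exists_abs_sub_le (d := d) hβ hL.le
  set K := ⌈α⌉₊ with hK
  set E : Set (Euc d) := Metric.closedBall 0 L with hE
  set V : ℝ := (volume E).toReal with hV
  have hEfin : volume E < ∞ := measure_closedBall_lt_top
  set C₀ : ℝ := (D : ℝ) ^ (K - 1) * L * (√D) ^ α with hC₀
  refine ⟨(C₀ + C₁) + (V * L) ^ 2, by positivity, fun M u hML hu hud δ b hδ hb => ?_⟩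
  -- rounding to a lattice so fine that the densities vary by at most a multiple of `δ ^ α`
  have hmin : (0 : ℝ) < min 1 β := lt_min one_pos hβ
  obtain ⟨ε, hε, hε1, hεδ⟩ : ∃ ε : ℝ, 0 < ε ∧ √d * ε ≤ 1 ∧ (√d * ε) ^ min 1 β ≤ δ ^ α := by
    have hδα : 0 < δ ^ α := Real.rpow_pos_of_pos hδ α
    have ht : Filter.Tendsto (fun ε : ℝ => √d * ε) (nhdsWithin 0 (Set.Ioi 0)) (nhds 0) := by
      have : Continuous fun ε : ℝ => √d * ε := by fun_prop
      simpa using (this.tendsto 0).mono_left nhdsWithin_le_nhds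
    have ht2 : Filter.Tendsto (fun ε : ℝ => (√d * ε) ^ min 1 β) (nhdsWithin 0 (Set.Ioi 0))
        (nhds 0) := by
      have := ht.rpow_const (p := min 1 β) (Or.inr hmin.le)
      simpa [Real.zero_rpow hmin.ne'] using this
    obtain ⟨ε, h1, h2, h3⟩ := ((ht.eventually (gt_mem_nhds one_pos)).and
      ((ht2.eventually (gt_mem_nhds hδα)).and self_mem_nhdsWithin)).exists
    exact ⟨ε, h3, h1.le, h2.le⟩
  choose g hg hgu using hu
  set a : Euc d → GridIdx D K b → ℝ := fun y => gridCoeff K b δ M (g (corner ε (cellOf ε y)))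
    with ha
  have ham : ∀ p, Measurable fun y => a y p := fun p =>
    (Measurable.of_discrete (f := fun c : Fin d → ℤ => gridCoeff K b δ M (g (corner ε c)) p)).comp
      measurable_cellOf
  have hab : ∀ y p, |a y p| ≤ L := fun y p => abs_gridCoeff_le hα hL.le (hg _) p
  have haint : ∀ (ζ : Euc d → ℝ), Measurable ζ → (∀ y, |ζ y| ≤ 1) → ∀ p,
      IntegrableOn (fun y => ζ y * a y p) E := fun ζ hζ hζ1 p =>
    Measure.integrableOn_of_bounded (M := L) hEfin.ne (hζ.mul (ham p)).aestronglyMeasurable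
      (Filter.Eventually.of_forall fun y => by
        rw [norm_mul]
        calc _ ≤ 1 * L := mul_le_mul (hζ1 y) (hab y p) (abs_nonneg _) zero_le_one
          _ = L := one_mul L)
  refine ⟨fun ζ p => ∫ y in E, ζ y * a y p, fun ζ hζ hζ1 => ?_, fun x hx => ?_⟩
  · have hterm : ∀ p : GridIdx D K b, (∫ y in E, ζ y * a y p) * (∫ y in E, ζ y * a y p)
        ≤ if p ∈ gridActive K b δ M then (V * L) ^ 2 else 0 := by
      intro p
      split_ifs with hp
      · have h1 : |∫ y in E, ζ y * a y p| ≤ V * L := by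
          have := norm_setIntegral_le_of_norm_le_const (μ := volume) (s := E) (C := L)
            (f := fun y => ζ y * a y p) hEfin (fun y _ => by
              rw [norm_mul]
              calc _ ≤ 1 * L := mul_le_mul (hζ1 y) (hab y p) (abs_nonneg _) zero_le_one
                _ = L := one_mul L)
          rw [mul_comm]
          exact this
        rw [← sq, ← sq_abs]
        exact pow_le_pow_left₀ (abs_nonneg _) h1 2
      · have h0 : ∀ y, a y p = 0 := fun y => by
          simp only [ha, gridCoeff, if_neg hp]
        simp [h0]
    calc _ ≤ ∑ p, if p ∈ gridActive K b δ M then (V * L) ^ 2 else 0 :=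
          Finset.sum_le_sum fun p _ => hterm p
      _ = (V * L) ^ 2 * (gridActive K b δ M).card := by
          rw [Finset.sum_ite_mem, Finset.univ_inter, Finset.sum_const, nsmul_eq_mul, mul_comm]
      _ ≤ _ := by
          refine mul_le_mul_of_nonneg_right ?_ (Nat.cast_nonneg _)
          have : 0 ≤ C₀ + C₁ := by positivity
          linarith
  · set q : Euc d → ℝ := fun y => gridFeature K b δ x ⬝ᵥ a y with hq
    have hqm : Measurable q := by
      simp only [hq, dotProduct]
      exact Finset.measurable_sum _ fun p _ => (ham p).const_mul _
    have hum := HolderBall.measurable hβ (hud x hx).mem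
    have hdiff : ∀ y, |q y - u y x| ≤ (C₀ + C₁) * δ ^ α := by
      intro y
      set y' := corner ε (cellOf ε y) with hy'
      have h1 := abs_gridFeature_dotProduct_sub_le (M := M) (b := b) hα hL.le hδ (hg y') hx
        (fun i => abs_cellOf_le hδ (hML x hx) hb i)
      rw [hgu y' hx, Real.mul_rpow (Real.sqrt_nonneg _) hδ.le, ← mul_assoc] at h1
      have h2n : ‖y - y'‖ ≤ √d * ε := norm_sub_corner_le hε y
      have h2 := hcont _ (hud x hx).mem y y' (h2n.trans hε1)
      have h3 : ‖y - y'‖ ^ min 1 β ≤ δ ^ α :=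
        (Real.rpow_le_rpow (norm_nonneg _) h2n hmin.le).trans hεδ
      have h4 : |q y - u y x| ≤ |q y - u y' x| + |u y x - u y' x| := by
        rw [abs_sub_comm (u y x)]
        exact abs_sub_le _ _ _
      have h5 := mul_le_mul_of_nonneg_left h3 hC₁
      have h6 : |q y - u y' x| ≤ C₀ * δ ^ α := h1
      linarith
    refine ⟨E.indicator fun y => q y - u y x, (hqm.sub hum).indicator measurableSet_closedBall,
      fun y => ?_, fun y hy => Set.indicator_of_notMem (by simpa [hE] using hy) _,
      fun ζ hζ hζ1 => ?_⟩
    · have hle : (C₀ + C₁) * δ ^ α ≤ (C₀ + C₁ + (V * L) ^ 2) * δ ^ α :=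
        mul_le_mul_of_nonneg_right (by linarith [sq_nonneg (V * L)]) (by positivity)
      by_cases hy : y ∈ E
      · rw [Set.indicator_of_mem hy]
        exact (hdiff y).trans hle
      · rw [Set.indicator_of_notMem hy, abs_zero]
        positivity
    · have e1 : gridFeature K b δ x ⬝ᵥ (fun p => ∫ y in E, ζ y * a y p)
          = ∫ y in E, q y * ζ y := by
        simp only [dotProduct, hq, Finset.sum_mul]
        rw [integral_finsetSum]
        · refine Finset.sum_congr rfl fun p _ => ?_
          rw [← integral_const_mul]
          refine integral_congr_ae (Filter.Eventually.of_forall fun y => ?_)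
          simp only []
          ring
        · intro p _
          refine ((haint ζ hζ hζ1 p).const_mul (gridFeature K b δ x p)).congr
            (Filter.Eventually.of_forall fun y => ?_)
          simp only []
          ring
      have e2 : ∫ y, u y x * ζ y = ∫ y in E, u y x * ζ y := by
        symm
        refine setIntegral_eq_integral_of_forall_compl_eq_zero fun y hy => ?_
        rw [(hud x hx).support y (by simpa [hE] using hy), zero_mul]
      have e3 : ∫ y, E.indicator (fun y => q y - u y x) y * ζ y
          = ∫ y in E, (q y - u y x) * ζ y := by
        rw [← integral_indicator (show MeasurableSet E from measurableSet_closedBall)]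
        refine integral_congr_ae (Filter.Eventually.of_forall fun y => ?_)
        by_cases hy : y ∈ E
        · simp only [Set.indicator_of_mem hy]
        · simp only [Set.indicator_of_notMem hy, zero_mul]
      rw [e1, e2, e3, ← integral_sub]
      · refine integral_congr_ae (Filter.Eventually.of_forall fun y => ?_)
        simp only []
        ring
      · simp only [hq, dotProduct, Finset.sum_mul]
        refine integrable_finsetSum _ fun p _ => ?_
        refine ((haint ζ hζ hζ1 p).const_mul (gridFeature K b δ x p)).congr
          (Filter.Eventually.of_forall fun y => ?_)
        simp only []
        ring
      · refine Measure.integrableOn_of_bounded (M := L) hEfin.ne (hum.mul hζ).aestronglyMeasurable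
          (Filter.Eventually.of_forall fun y => ?_)
        rw [norm_mul]
        calc _ ≤ L * 1 := mul_le_mul (HolderBall.abs_le hβ.le hL.le (hud x hx).mem y) (hζ1 y)
                (abs_nonneg _) hL.le
          _ = L := mul_one L
end

/-! ### Regression of Fourier coefficients -/

section

open Matrix

/-- The real (`true`) and imaginary (`false`) part of the character of frequency `-k`. -/
noncomputable def charPart {d : ℕ} (R : ℝ) (q : (Fin d → ℤ) × Bool) (y : Euc d) : ℝ :=
  if q.2 then (boxChar R (-q.1) y).re else (boxChar R (-q.1) y).im

variable {d : ℕ} {R : ℝ}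

theorem measurable_charPart (q : (Fin d → ℤ) × Bool) : Measurable (charPart R q) := by
  unfold charPart
  split_ifs
  · exact (Complex.continuous_re.comp (continuous_boxChar _)).measurable
  · exact (Complex.continuous_im.comp (continuous_boxChar _)).measurable

theorem abs_charPart_le (q : (Fin d → ℤ) × Bool) (y : Euc d) : |charPart R q y| ≤ 1 := by
  rw [← norm_boxChar (R := R) (-q.1) y]
  unfold charPart
  split_ifs
  · exact Complex.abs_re_le_norm _
  · exact Complex.abs_im_le_norm _

theorem norm_boxCoeff_sq_eq {F : Euc d → ℝ} (hF : Integrable F) (k : Fin d → ℤ) :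
    ‖boxCoeff R F k‖ ^ 2 = ∑ e : Bool, (∫ y, F y * charPart R (k, e) y) ^ 2 := by
  have h := integrable_boxChar_mul (R := R) hF (-k)
  have hre : (boxCoeff R F k).re = ∫ y, F y * charPart R (k, true) y := by
    have := (integral_re h).symm
    simp only [RCLike.re_eq_complex_re] at this
    unfold boxCoeff
    rw [this]
    refine integral_congr_ae (Filter.Eventually.of_forall fun y => ?_)
    simp [charPart, mul_comm]
  have him : (boxCoeff R F k).im = ∫ y, F y * charPart R (k, false) y := by
    have := (integral_im h).symm
    simp only [RCLike.im_eq_complex_im] at this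
    unfold boxCoeff
    rw [this]
    refine integral_congr_ae (Filter.Eventually.of_forall fun y => ?_)
    simp [charPart, mul_comm]
  rw [← Complex.normSq_eq_norm_sq, Complex.normSq_apply, hre, him, Fintype.sum_bool]
  ring

/-- The estimator of the conditional mean of `charPart R q` by Forster–Warmuth regression on
piecewise polynomials. -/
noncomputable def fwCoeff {D n : ℕ} (K b : ℕ) (δ R : ℝ) (q : (Fin d → ℤ) × Bool)
    (p : (Fin n → Euc D × Euc d) × Euc D) : ℝ :=
  fwPredict (gridFeature K b δ p.2) (fun j => gridFeature K b δ (p.1 j).1)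
    (fun j => charPart R q (p.1 j).2)

theorem measurable_fwCoeff {D n : ℕ} (K b : ℕ) (δ R : ℝ) (q : (Fin d → ℤ) × Bool) :
    Measurable (fwCoeff (D := D) (n := n) K b δ R q) := by
  refine measurable_fwPredict (measurable_gridFeature.comp measurable_snd)
    (measurable_pi_lambda _ fun j => ?_) (measurable_pi_lambda _ fun j => ?_)
  · exact measurable_gridFeature.comp
      (measurable_fst.comp ((measurable_pi_apply j).comp measurable_fst))
  · exact (measurable_charPart q).comp
      (measurable_snd.comp ((measurable_pi_apply j).comp measurable_fst))

/-- The total square risk of the estimators of a finite set of Fourier coefficients: the squared bias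
`δ ^ (2 α)` is not multiplied with the number of coefficients, by Bessel's inequality. -/
theorem exists_sum_fwCoeff_risk_le {D dX : ℕ} {α β L : ℝ} (hα : 0 < α) (hβ : 0 < β) (hL : 0 < L) :
    ∃ C : ℝ, 0 ≤ C ∧ ∀ (M : Set (Euc D)) (u : Euc d → Euc D → ℝ) (μ : Measure (Euc D))
      (κ : Kernel (Euc D) (Euc d)), IsProbabilityMeasure μ → IsMarkovKernel κ →
      MinkowskiDimAtMost D dX L M → (∀ᵐ x ∂μ, x ∈ M) → (∀ y, u y ∈ HolderBallOn D α L M) →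
      (∀ x ∈ M, HolderDensity d β L fun y => u y x) →
      (∀ x ∈ M, κ x = volume.withDensity fun y => ENNReal.ofReal (u y x)) →
      ∀ (δ : ℝ) (b n : ℕ) (s : Finset (Fin d → ℤ)), 0 < δ → δ ≤ 1 → L / δ + 1 ≤ b →
      ∑ q ∈ s ×ˢ Finset.univ, ∫⁻ t, ∫⁻ x, ENNReal.ofReal ((fwCoeff ⌈α⌉₊ b δ (8 * L) q (t, x)
          - ∫ y, charPart (8 * L) q y ∂(κ x)) ^ 2) ∂μ ∂(Measure.pi fun _ : Fin n => μ ⊗ₘ κ)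
        ≤ ENNReal.ofReal (C * ((δ ^ α) ^ 2 + s.card * δ ^ (-(dX : ℝ)) / (n + 1))) := by
  obtain ⟨C₀, hC₀, happrox⟩ := exists_grid_approx (D := D) (d := d) hα hβ hL
  have hR : 0 < 8 * L := by linarith
  set N : ℝ := (Fintype.card (Σ k : Fin ⌈α⌉₊, Fin k → Fin D) : ℝ) with hN
  refine ⟨((8 * L) ^ d) ^ 2 * C₀ ^ 2 + 2 * (C₀ + 4) * (N * (2 ^ D * L)), by positivity,
    fun M u μ κ _ _ hM hae hu hud hκ δ b n s hδ hδ1 hb => ?_⟩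
  obtain ⟨θ, hθ, hr⟩ := happrox M u (fun x hx => (mem_ball_zero_iff.1 (hM.1 hx)).le) hu hud δ b hδ hb
  set S := gridActive ⌈α⌉₊ b δ M with hS
  have hterm : ∀ q ∈ s ×ˢ (Finset.univ : Finset Bool), ∫⁻ t, ∫⁻ x, ENNReal.ofReal
        ((fwCoeff ⌈α⌉₊ b δ (8 * L) q (t, x)
          - ∫ y, charPart (8 * L) q y ∂(κ x)) ^ 2) ∂μ ∂(Measure.pi fun _ : Fin n => μ ⊗ₘ κ)
      ≤ ∫⁻ x, ENNReal.ofReal ((gridFeature ⌈α⌉₊ b δ x ⬝ᵥ θ (charPart (8 * L) q)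
          - ∫ y, charPart (8 * L) q y ∂(κ x)) ^ 2) ∂μ
        + ENNReal.ofReal ((C₀ + 4) * S.card / (n + 1)) := by
    intro q _
    refine (lintegral_fwPredict_sq_sub_le n measurable_gridFeature (measurable_charPart q)
      (abs_charPart_le q) S (hae.mono fun x hx p hp => gridFeature_eq_zero hx p hp)
      (θ (charPart (8 * L) q))).trans ?_
    refine add_le_add le_rfl (ENNReal.ofReal_le_ofReal ?_)
    gcongr
    have := hθ _ (measurable_charPart (R := 8 * L) q) (abs_charPart_le q)
    linarith
  refine (Finset.sum_le_sum hterm).trans ?_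
  rw [Finset.sum_add_distrib, ← lintegral_finsetSum]
  swap
  · intro q _
    refine ((Measurable.sub ?_ (measurable_condMean (measurable_charPart q))).pow_const
      2).ennreal_ofReal
    simp only [dotProduct]
    exact Finset.measurable_sum _ fun p _ =>
      ((measurable_pi_apply p).comp measurable_gridFeature).mul_const _
  have hbias : ∫⁻ x, ∑ q ∈ s ×ˢ (Finset.univ : Finset Bool), ENNReal.ofReal
        ((gridFeature ⌈α⌉₊ b δ x ⬝ᵥ θ (charPart (8 * L) q)
          - ∫ y, charPart (8 * L) q y ∂(κ x)) ^ 2) ∂μ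
      ≤ ENNReal.ofReal (((8 * L) ^ d) ^ 2 * (C₀ * δ ^ α) ^ 2) := by
    calc _ ≤ ∫⁻ _x, ENNReal.ofReal (((8 * L) ^ d) ^ 2 * (C₀ * δ ^ α) ^ 2) ∂μ := by
          refine lintegral_mono_ae ?_
          filter_upwards [hae] with x hx
          obtain ⟨r, hrm, hrb, hrs, hreq⟩ := hr x hx
          have hrint : Integrable r := by
            have h1 : IntegrableOn r (Metric.closedBall 0 L) :=
              Measure.integrableOn_of_bounded (M := C₀ * δ ^ α) measure_closedBall_lt_top.ne
                hrm.aestronglyMeasurable (Filter.Eventually.of_forall fun y => hrb y)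
            refine (integrableOn_iff_integrable_of_support_subset fun y hy => ?_).1 h1
            by_contra h
            exact hy (hrs y (by simpa using h))
          have e : ∀ q : (Fin d → ℤ) × Bool,
              gridFeature ⌈α⌉₊ b δ x ⬝ᵥ θ (charPart (8 * L) q)
                - ∫ y, charPart (8 * L) q y ∂(κ x) = ∫ y, r y * charPart (8 * L) q y := by
            intro q
            rw [hκ x hx, (hud x hx).integral_eq hβ]
            exact hreq _ (measurable_charPart q) (abs_charPart_le q)
          simp only [e]
          rw [← ENNReal.ofReal_sum_of_nonneg fun q _ => sq_nonneg _, Finset.sum_product]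
          refine ENNReal.ofReal_le_ofReal ?_
          rw [Finset.sum_congr rfl fun k _ => (norm_boxCoeff_sq_eq (R := 8 * L) hrint k).symm]
          refine sum_norm_boxCoeff_sq_le hR hrm hrb (fun y hy => hrs y ?_) s
          obtain ⟨i, hi⟩ := hy
          have := PiLp.norm_apply_le y i
          rw [Real.norm_eq_abs] at this
          linarith
      _ = _ := by simp
  refine (add_le_add hbias le_rfl).trans ?_
  rw [Finset.sum_const, nsmul_eq_mul, Finset.card_product, Finset.card_univ, Fintype.card_bool,
    ← ENNReal.ofReal_natCast, ← ENNReal.ofReal_mul (Nat.cast_nonneg _),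
    ← ENNReal.ofReal_add (by positivity) (by positivity)]
  refine ENNReal.ofReal_le_ofReal ?_
  have hcard := card_gridActive_le (K := ⌈α⌉₊) (b := b) hM hδ hδ1
  rw [← hS, ← hN] at hcard
  have hδd : 0 ≤ δ ^ (-(dX : ℝ)) := by positivity
  have hn : (0 : ℝ) < n + 1 := by positivity
  have h1 : ((s.card * 2 : ℕ) : ℝ) * ((C₀ + 4) * S.card / (n + 1))
      ≤ 2 * (C₀ + 4) * (N * (2 ^ D * L)) * (s.card * δ ^ (-(dX : ℝ)) / (n + 1)) := by
    calc _ = 2 * (C₀ + 4) * s.card / (n + 1) * S.card := by push_cast; ring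
      _ ≤ 2 * (C₀ + 4) * s.card / (n + 1) * (N * (2 ^ D * (L * δ ^ (-(dX : ℝ))))) := by gcongr
      _ = _ := by ring
  have h2 : 0 ≤ (s.card : ℝ) * δ ^ (-(dX : ℝ)) / (n + 1) := by positivity
  have hN0 : 0 ≤ N := Nat.cast_nonneg _
  have h3 : 0 ≤ 2 * (C₀ + 4) * (N * (2 ^ D * L)) * (δ ^ α) ^ 2 := by positivity
  have h4 : 0 ≤ ((8 * L) ^ d) ^ 2 * C₀ ^ 2 * ((s.card : ℝ) * δ ^ (-(dX : ℝ)) / (n + 1)) := by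
    positivity
  nlinarith

end

/-! ### The estimator and its risk -/

section

/-- For almost every covariate value the conditional density also vanishes outside the ball of
radius `L`, which is assumed of the marginal law of the response only. -/
theorem Regime1.exists_density {DY DX dX : ℕ} {αY αX L : ℝ} (hαY : 0 < αY)
    {μX : Measure (Euc DX)} {κ : Kernel (Euc DX) (Euc DY)} (h : Regime1 DY DX dX αY αX L μX κ) :
    ∃ (M : Set (Euc DX)) (u : Euc DY → Euc DX → ℝ), MinkowskiDimAtMost DX dX L M ∧
      (∀ᵐ x ∂μX, x ∈ M) ∧ (∀ y, u y ∈ HolderBallOn DX αX L M) ∧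
      (∀ x ∈ M, HolderDensity DY αY L fun y => u y x) ∧
      ∀ x ∈ M, κ x = volume.withDensity fun y => ENNReal.ofReal (u y x) := by
  obtain ⟨_, _, hM, hsnd, u, hu, huY, huX⟩ := h
  have hmem : ∀ x ∈ μX.support, (fun y => u y x) ∈ HolderBall DY αY L := by
    intro x hx
    obtain ⟨g, hg, hgu⟩ := huY x hx
    rwa [show (fun y => u y x) = g from funext fun y => (hgu (Set.mem_univ y)).symm]
  have hsupp : ∀ᵐ x ∂μX, x ∈ μX.support := Measure.support_mem_ae_of_regular
  set U : Set (Euc DY) := {y | L < ‖y‖} with hU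
  have hUo : IsOpen U := isOpen_lt continuous_const continuous_norm
  have hUm : MeasurableSet U := hUo.measurableSet
  have hzero : (μX ⊗ₘ κ).snd U = 0 := by
    refine measure_mono_null (fun y hy => ?_) (Measure.measure_compl_support_of_regular
      (μ := (μX ⊗ₘ κ).snd))
    intro hy'
    have h1 := mem_ball_zero_iff.1 (hsnd hy')
    have h2 : L < ‖y‖ := hy
    linarith
  rw [Measure.snd_compProd, Measure.bind_apply hUm κ.measurable.aemeasurable,
    lintegral_eq_zero_iff (κ.measurable_coe hUm)] at hzero
  refine ⟨{x | x ∈ μX.support ∧ κ x U = 0}, u, ⟨fun x hx => hM.1 hx.1, fun ε h0 h1 P hP =>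
    hM.2 ε h0 h1 P fun x hx => (hP hx).1⟩, ?_, fun y => ?_, fun x hx => ?_,
    fun x hx => (hu x hx.1).2⟩
  · filter_upwards [hsupp, hzero] with x h1 h2 using ⟨h1, h2⟩
  · obtain ⟨g, hg, hgu⟩ := huX y (Set.mem_univ y)
    exact ⟨g, hg, fun x hx => hgu hx.1⟩
  · have hme := (HolderBall.measurable hαY (hmem x hx.1)).ennreal_ofReal
    refine ⟨hmem x hx.1, (hu x hx.1).1, ?_, ?_⟩
    · have h0 := hx.2
      rw [(hu x hx.1).2, withDensity_apply _ hUm, lintegral_eq_zero_iff hme] at h0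
      have h1 : (fun y => u y x) =ᵐ[volume.restrict U] fun _ => 0 := by
        filter_upwards [h0] with y hy
        have := ENNReal.ofReal_eq_zero.1 hy
        exact le_antisymm this ((hu x hx.1).1 y)
      have := Measure.eqOn_open_of_ae_eq h1 hUo
        ((HolderBall.contDiff_of_lt hαY (hmem x hx.1) (Nat.ceil_pos.2 hαY)).continuous.continuousOn)
        continuousOn_const
      exact fun y hy => this hy
    · rw [← (hu x hx.1).2]
      infer_instance

/-- Measurable near-minimization of a weighted square distance to a set of vectors. -/
theorem exists_measurable_near_minimizer {ι 𝒰 : Type*} [Fintype ι] [Nonempty 𝒰]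
    (c : 𝒰 → ι → ℝ) (w : ι → ℝ) (hw : ∀ i, 0 ≤ w i) {ε : ℝ} (hε : 0 < ε) :
    ∃ (v : ℕ → 𝒰) (sel : (ι → ℝ) → ℕ), Measurable sel ∧ ∀ T a,
      ∑ i, w i * (T i - c (v (sel T)) i) ^ 2 ≤ ∑ i, w i * (T i - c a i) ^ 2 + ε := by
  classical
  have hne : Nonempty (Set.range c) := ⟨⟨c (Classical.arbitrary 𝒰), Set.mem_range_self _⟩⟩
  set z := TopologicalSpace.denseSeq (Set.range c) with hz
  have hdense := TopologicalSpace.denseRange_denseSeq (Set.range c)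
  have hv : ∀ m, ∃ a, c a = z m := fun m => (z m).2
  choose v hv using hv
  set Q : (ι → ℝ) → (ι → ℝ) → ℝ := fun T b => ∑ i, w i * (T i - b i) ^ 2 with hQ
  have hQ0 : ∀ T b, 0 ≤ Q T b := fun T b =>
    Finset.sum_nonneg fun i _ => mul_nonneg (hw i) (sq_nonneg _)
  have hQT : ∀ b, Continuous fun T => Q T b := fun b => by
    simp only [hQ]; fun_prop
  have hQb : ∀ T, Continuous fun b => Q T b := fun T => by
    simp only [hQ]; fun_prop
  have hex : ∀ T, ∃ m, ∀ j, Q T (c (v m)) ≤ Q T (c (v j)) + ε := by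
    intro T
    have hbdd : BddBelow (Set.range fun m => Q T (c (v m))) :=
      ⟨0, by rintro _ ⟨m, rfl⟩; exact hQ0 _ _⟩
    obtain ⟨m, hm⟩ := exists_lt_of_ciInf_lt
      (lt_add_of_pos_right (⨅ m, Q T (c (v m))) hε)
    exact ⟨m, fun j => hm.le.trans (add_le_add (ciInf_le hbdd j) le_rfl)⟩
  refine ⟨v, fun T => Nat.find (hex T), measurable_find hex fun m => ?_, fun T a => ?_⟩
  · rw [Set.ofPred_forall]
    exact MeasurableSet.iInter fun j => measurableSet_le (hQT _).measurable
      ((hQT _).measurable.add_const _)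
  · have hspec := Nat.find_spec (hex T)
    set m := Nat.find (hex T)
    have hcl : IsClosed {b : Set.range c | Q T (c (v m)) ≤ Q T b + ε} :=
      isClosed_le continuous_const (((hQb T).comp continuous_subtype_val).add_const _)
    have := hdense.induction_on (p := fun b => Q T (c (v m)) ≤ Q T b + ε)
      ⟨c a, Set.mem_range_self a⟩ hcl fun j => by
        have := hspec j
        rwa [hv j] at this
    exact this

theorem sum_mul_sq_sub_le {ι : Type*} (s : Finset ι) (w T a b : ι → ℝ) (hw : ∀ i ∈ s, 0 ≤ w i) :
    ∑ i ∈ s, w i * (a i - b i) ^ 2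
      ≤ 2 * ∑ i ∈ s, w i * (T i - a i) ^ 2 + 2 * ∑ i ∈ s, w i * (T i - b i) ^ 2 := by
  rw [Finset.mul_sum, Finset.mul_sum, ← Finset.sum_add_distrib]
  refine Finset.sum_le_sum fun i hi => ?_
  have := hw i hi
  nlinarith [mul_nonneg this (sq_nonneg ((T i - a i) + (T i - b i)))]

theorem HolderDensity.integrable {d : ℕ} {α L : ℝ} (hα : 0 < α) {u : Euc d → ℝ}
    (hu : HolderDensity d α L u) : Integrable u := by
  refine ⟨(HolderBall.measurable hα hu.mem).aestronglyMeasurable, ?_⟩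
  rw [hasFiniteIntegral_iff_ofReal (Filter.Eventually.of_forall hu.nonneg)]
  have := hu.prob.measure_univ
  rw [withDensity_apply _ MeasurableSet.univ, setLIntegral_univ] at this
  rw [this]
  exact ENNReal.one_lt_top

/-- The differences of the Fourier coefficients of two densities in terms of their laws. -/
theorem HolderDensity.norm_boxCoeff_sub_sq {d : ℕ} {α L R : ℝ} (hα : 0 < α) {u v : Euc d → ℝ}
    (hu : HolderDensity d α L u) (hv : HolderDensity d α L v) (k : Fin d → ℤ) :
    ‖boxCoeff R u k - boxCoeff R v k‖ ^ 2
      = ∑ e : Bool,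
        (∫ y, charPart R (k, e) y ∂(volume.withDensity fun y => ENNReal.ofReal (u y))
        - ∫ y, charPart R (k, e) y ∂(volume.withDensity fun y => ENNReal.ofReal (v y))) ^ 2 := by
  have hui := hu.integrable hα
  have hvi := hv.integrable hα
  have hsub : Integrable fun y => u y - v y := hui.sub hvi
  rw [← boxCoeff_sub hui hvi, norm_boxCoeff_sq_eq hsub]
  refine Finset.sum_congr rfl fun e _ => ?_
  rw [hu.integral_eq hα, hv.integral_eq hα]
  have hint : ∀ {w : Euc d → ℝ}, Integrable w →
      Integrable fun y => w y * charPart R (k, e) y := fun hw =>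
    hw.mul_bdd (c := 1) (measurable_charPart _).aestronglyMeasurable
      (Filter.Eventually.of_forall fun y => abs_charPart_le _ y)
  simp only [smul_eq_mul, sub_mul]
  rw [integral_sub (hint hui) (hint hvi)]

theorem lintegral_lintegral_ofReal_mul {S X : Type*} [MeasurableSpace S] [MeasurableSpace X]
    {P : Measure S} {μ : Measure X} [SFinite μ] {f : S → X → ℝ}
    (hf : Measurable fun p : S × X => f p.1 p.2) {a : ℝ} (ha : 0 ≤ a) :
    ∫⁻ t, ∫⁻ x, ENNReal.ofReal (a * f t x) ∂μ ∂P
      = ENNReal.ofReal a * ∫⁻ t, ∫⁻ x, ENNReal.ofReal (f t x) ∂μ ∂P := by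
  have hm : Measurable fun p : S × X => ENNReal.ofReal (f p.1 p.2) := hf.ennreal_ofReal
  have hm1 : Measurable fun t => ∫⁻ x, ENNReal.ofReal (f t x) ∂μ := hm.lintegral_prod_right'
  rw [← lintegral_const_mul _ hm1]
  refine lintegral_congr fun t => ?_
  have hm2 : Measurable fun x => ENNReal.ofReal (f t x) := hm.comp measurable_prodMk_left
  rw [← lintegral_const_mul _ hm2]
  exact lintegral_congr fun x => ENNReal.ofReal_mul ha

theorem lintegral_lintegral_mul_sum_add {S X ι : Type*} [MeasurableSpace S] [MeasurableSpace X]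
    {P : Measure S} [IsProbabilityMeasure P] {μ : Measure X} [IsProbabilityMeasure μ]
    (I : Finset ι) (f : ι → S → X → ℝ≥0∞)
    (hf : ∀ q ∈ I, Measurable fun p : S × X => f q p.1 p.2) (a b : ℝ≥0∞) :
    ∫⁻ t, ∫⁻ x, (a * ∑ q ∈ I, f q t x + b) ∂μ ∂P = a * ∑ q ∈ I, ∫⁻ t, ∫⁻ x, f q t x ∂μ ∂P + b := by
  have hm : ∀ t, ∀ q ∈ I, Measurable fun x => f q t x := fun t q hq =>
    (hf q hq).comp measurable_prodMk_left
  have hm' : ∀ q ∈ I, Measurable fun t => ∫⁻ x, f q t x ∂μ := fun q hq =>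
    (hf q hq).lintegral_prod_right'
  have e : ∀ t, ∫⁻ x, (a * ∑ q ∈ I, f q t x + b) ∂μ = a * ∑ q ∈ I, ∫⁻ x, f q t x ∂μ + b := by
    intro t
    rw [lintegral_add_right _ measurable_const, lintegral_const, measure_univ, mul_one,
      lintegral_const_mul _ (Finset.measurable_sum I (hm t)), lintegral_finsetSum _ (hm t)]
  simp only [e]
  rw [lintegral_add_right _ measurable_const, lintegral_const, measure_univ, mul_one,
    lintegral_const_mul _ (Finset.measurable_sum I hm'), lintegral_finsetSum _ hm']

set_option maxHeartbeats 800000 in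
/-- The minimax risk is bounded by the weighted square risk of regression of Fourier coefficients,
once the `γ`-Hölder metric is bounded by a weighted distance of Fourier coefficients. The cell side
`δ j` of the regression depends on the level `j` of the frequency. -/
theorem exists_condMinimaxRisk_le {DY DX dX : ℕ} {αY αX L : ℝ} (hαY : 0 < αY) (hαX : 0 < αX)
    (hL : 0 < L) :
    ∃ C : ℝ, 0 < C ∧ ∀ (n J : ℕ) (ω δ : ℕ → ℝ) (A B γ : ℝ), (∀ j, 0 < ω j) → (∀ j, 0 < δ j) →
      (∀ j, δ j ≤ 1) → 0 ≤ A → 0 ≤ B →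
      (∀ u v : Euc DY → ℝ, HolderDensity DY αY L u → HolderDensity DY αY L v →
        holderIPM γ (volume.withDensity fun y => ENNReal.ofReal (u y))
            (volume.withDensity fun y => ENNReal.ofReal (v y))
          ≤ ENNReal.ofReal (A * √(∑ k ∈ freqBox DY J,
              ω (freqLevel k) * ‖boxCoeff (8 * L) u k - boxCoeff (8 * L) v k‖ ^ 2) + B)) →
      condMinimaxRisk DY DX dX αY αX L γ n
        ≤ ENNReal.ofReal (A * √(C * ∑ j ∈ Finset.range (J + 1),
            ω j * ((δ j ^ αX) ^ 2 + (2 ^ j) ^ DY * δ j ^ (-(dX : ℝ)) / (n + 1))) + B) := by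
  classical
  obtain ⟨C₀, hC₀, hrisk⟩ := exists_sum_fwCoeff_risk_le (D := DX) (d := DY) (dX := dX) hαX hαY hL
  refine ⟨6 * ((C₀ + 1) * 3 ^ DY), by positivity,
    fun n J ω δ A B γ hω hδ hδ1 hA hB hipm => ?_⟩
  set S : ℝ := ∑ j ∈ Finset.range (J + 1),
    ω j * ((δ j ^ αX) ^ 2 + (2 ^ j) ^ DY * δ j ^ (-(dX : ℝ)) / (n + 1)) with hS
  have hS0 : 0 < S := by
    refine Finset.sum_pos (fun j _ => mul_pos (hω j) ?_) (by simp)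
    have := hδ j
    positivity
  set Z : ℝ := (C₀ + 1) * 3 ^ DY * S with hZ
  have hZ0 : 0 < Z := by positivity
  by_cases hne : Nonempty {u : Euc DY → ℝ // HolderDensity DY αY L u}
  swap
  · have hM : IsMarkovKernel (Kernel.const ((Fin n → Euc DX × Euc DY) × Euc DX)
        (Measure.dirac (0 : Euc DY))) := inferInstance
    refine (iInf₂_le _ hM).trans ?_
    refine iSup_le fun μX => iSup_le fun κ => iSup_le fun h => ?_
    obtain ⟨M, u, -, hae, -, hud, -⟩ := h.exists_density hαY
    have := h.isProbabilityMeasure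
    obtain ⟨x, hx⟩ := hae.exists
    exact absurd ⟨_, hud x hx⟩ hne
  set I : Finset ((Fin DY → ℤ) × Bool) := freqBox DY J ×ˢ Finset.univ with hI
  set c : {u : Euc DY → ℝ // HolderDensity DY αY L u} → I → ℝ := fun u q =>
    ∫ y, charPart (8 * L) q.1 y ∂(volume.withDensity fun y => ENNReal.ofReal (u.1 y)) with hc
  obtain ⟨v, sel, hsel, hnear⟩ := exists_measurable_near_minimizer c
    (fun q => ω (freqLevel q.1.1)) (fun q => (hω _).le) hZ0
  set b : ℕ → ℕ := fun j => ⌈L / δ j + 1⌉₊ with hb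
  set T : (Fin n → Euc DX × Euc DY) × Euc DX → I → ℝ := fun p q =>
    fwCoeff ⌈αX⌉₊ (b (freqLevel q.1.1)) (δ (freqLevel q.1.1)) (8 * L) q.1 p with hT
  have hTm : Measurable T := measurable_pi_lambda _ fun q => measurable_fwCoeff _ _ _ _ _
  set base : Kernel ℕ (Euc DY) := Kernel.ofFunOfCountable fun m =>
    volume.withDensity fun y => ENNReal.ofReal ((v m).1 y) with hbase
  have hbaseM : IsMarkovKernel base := ⟨fun m => (v m).2.prob⟩
  set est : CondEstimator DY DX n := base.comap (fun p => sel (T p)) (hsel.comp hTm) with hest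
  have hestM : IsMarkovKernel est := inferInstance
  refine (iInf₂_le est hestM).trans ?_
  refine iSup_le fun μX => iSup_le fun κ => iSup_le fun h => ?_
  obtain ⟨M, u, hM, hae, huX, hud, hκ⟩ := h.exists_density hαY
  have := h.isProbabilityMeasure
  have := h.isMarkovKernel
  set P := Measure.pi fun _ : Fin n => μX ⊗ₘ κ with hP
  -- the weighted square error of the regression
  set g : (Fin DY → ℤ) × Bool → (Fin n → Euc DX × Euc DY) → Euc DX → ℝ := fun q t x =>
    (fwCoeff ⌈αX⌉₊ (b (freqLevel q.1)) (δ (freqLevel q.1)) (8 * L) q (t, x)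
      - ∫ y, charPart (8 * L) q y ∂(κ x)) ^ 2 with hg
  have hgm : ∀ q, Measurable fun p : (Fin n → Euc DX × Euc DY) × Euc DX => g q p.1 p.2 := fun q =>
    ((measurable_fwCoeff _ _ _ _ _).sub
      ((measurable_condMean (measurable_charPart q)).comp measurable_snd)).pow_const 2
  set a : ℝ := √(6 * Z) with ha
  have ha0 : 0 < a := Real.sqrt_pos.2 (by positivity)
  have ha2 : a * a = 6 * Z := Real.mul_self_sqrt (by positivity)
  have hpoint : ∀ t, ∀ᵐ x ∂μX, holderIPM γ (κ x) (est (t, x))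
      ≤ ENNReal.ofReal (2 * A / a) * ∑ q ∈ I, ENNReal.ofReal (ω (freqLevel q.1) * g q t x)
        + ENNReal.ofReal (A * (Z / a + a / 2) + B) := by
    intro t
    filter_upwards [hae] with x hx
    rw [hest, Kernel.comap_apply, hκ x hx]
    refine (hipm _ _ (hud x hx) (v (sel (T (t, x)))).2).trans ?_
    rw [← ENNReal.ofReal_sum_of_nonneg fun q _ => mul_nonneg (hω _).le (sq_nonneg _),
      ← ENNReal.ofReal_mul (by positivity), ← ENNReal.ofReal_add]
    rotate_left
    · exact mul_nonneg (by positivity) (Finset.sum_nonneg fun q _ =>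
        mul_nonneg (hω _).le (sq_nonneg _))
    · positivity
    refine ENNReal.ofReal_le_ofReal ?_
    set Y := ∑ q ∈ I, ω (freqLevel q.1) * g q t x with hY
    have hYc : ∑ q : I, ω (freqLevel q.1.1) * (T (t, x) q - c ⟨_, hud x hx⟩ q) ^ 2 = Y := by
      rw [hY, ← Finset.sum_coe_sort I]
      refine Finset.sum_congr rfl fun q _ => ?_
      simp only [hg, hT, hc, hκ x hx]
    have h1 : ∑ k ∈ freqBox DY J, ω (freqLevel k) * ‖boxCoeff (8 * L) (fun y => u y x) k
        - boxCoeff (8 * L) (v (sel (T (t, x)))).1 k‖ ^ 2 ≤ 4 * Y + 2 * Z := by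
      have e : ∑ k ∈ freqBox DY J, ω (freqLevel k) * ‖boxCoeff (8 * L) (fun y => u y x) k
            - boxCoeff (8 * L) (v (sel (T (t, x)))).1 k‖ ^ 2
          = ∑ q : I, ω (freqLevel q.1.1)
            * (c ⟨_, hud x hx⟩ q - c (v (sel (T (t, x)))) q) ^ 2 := by
        simp only [hc]
        rw [Finset.sum_coe_sort I fun q => ω (freqLevel q.1)
          * (∫ y, charPart (8 * L) q y ∂(volume.withDensity fun y => ENNReal.ofReal (u y x))
            - ∫ y, charPart (8 * L) q y ∂(volume.withDensity fun y =>
              ENNReal.ofReal ((v (sel (T (t, x)))).1 y))) ^ 2, hI, Finset.sum_product]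
        refine Finset.sum_congr rfl fun k _ => ?_
        rw [(hud x hx).norm_boxCoeff_sub_sq hαY (v (sel (T (t, x)))).2, Finset.mul_sum]
      rw [e]
      refine (sum_mul_sq_sub_le _ _ (T (t, x)) _ _ fun q _ => (hω _).le).trans ?_
      have := hnear (T (t, x)) ⟨_, hud x hx⟩
      rw [hYc] at this ⊢
      linarith
    have h2 : √(4 * Y + 2 * Z) ≤ 2 / a * Y + (Z / a + a / 2) := by
      have hY0 : 0 ≤ Y := Finset.sum_nonneg fun q _ => mul_nonneg (hω _).le (sq_nonneg _)
      set r := √(4 * Y + 2 * Z) with hr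
      have hr2 : r * r = 4 * Y + 2 * Z := Real.mul_self_sqrt (by positivity)
      have : 2 / a * Y + (Z / a + a / 2) = (r * r + a * a) / (2 * a) := by
        rw [hr2]; field_simp; ring
      rw [this, le_div_iff₀ (by positivity)]
      nlinarith [sq_nonneg (r - a)]
    calc _ ≤ A * (2 / a * Y + (Z / a + a / 2)) + B := by
          gcongr
          exact (Real.sqrt_le_sqrt h1).trans h2
      _ = _ := by ring
  -- the weighted square risk, level by level
  have hmean : ∑ q ∈ I, ∫⁻ t, ∫⁻ x, ENNReal.ofReal (ω (freqLevel q.1) * g q t x) ∂μX ∂P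
      ≤ ENNReal.ofReal Z := by
    have e1 : ∀ q ∈ I, ∫⁻ t, ∫⁻ x, ENNReal.ofReal (ω (freqLevel q.1) * g q t x) ∂μX ∂P
        = ENNReal.ofReal (ω (freqLevel q.1))
          * ∫⁻ t, ∫⁻ x, ENNReal.ofReal (g q t x) ∂μX ∂P := by
      intro q _
      exact lintegral_lintegral_ofReal_mul (hgm q) (hω _).le
    rw [Finset.sum_congr rfl e1]
    have hmaps : ∀ q ∈ I, freqLevel q.1 ∈ Finset.range (J + 1) := by
      intro q hq
      rw [hI, Finset.mem_product, mem_freqBox] at hq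
      exact Finset.mem_range.2 (Nat.lt_succ_of_le hq.1)
    rw [← Finset.sum_fiberwise_of_maps_to hmaps]
    have hZe : Z = ∑ j ∈ Finset.range (J + 1), ω j * ((C₀ + 1) * 3 ^ DY
        * ((δ j ^ αX) ^ 2 + (2 ^ j) ^ DY * δ j ^ (-(dX : ℝ)) / (n + 1))) := by
      rw [hZ, hS, Finset.mul_sum]
      exact Finset.sum_congr rfl fun j _ => by ring
    rw [hZe, ENNReal.ofReal_sum_of_nonneg]
    swap
    · intro j _
      have := hδ j
      have := hω j
      positivity
    refine Finset.sum_le_sum fun j hj => ?_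
    rw [hI, Finset.filter_product_left (fun k => freqLevel k = j)]
    set sh := (freqBox DY J).filter fun k => freqLevel k = j with hsh
    have e2 : ∑ q ∈ sh ×ˢ (Finset.univ : Finset Bool), ENNReal.ofReal (ω (freqLevel q.1))
          * ∫⁻ t, ∫⁻ x, ENNReal.ofReal (g q t x) ∂μX ∂P
        = ENNReal.ofReal (ω j) * ∑ q ∈ sh ×ˢ (Finset.univ : Finset Bool),
          ∫⁻ t, ∫⁻ x, ENNReal.ofReal ((fwCoeff ⌈αX⌉₊ (b j) (δ j) (8 * L) q (t, x)
            - ∫ y, charPart (8 * L) q y ∂(κ x)) ^ 2) ∂μX ∂P := by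
      rw [Finset.mul_sum]
      refine Finset.sum_congr rfl fun q hq => ?_
      have : freqLevel q.1 = j := by
        rw [Finset.mem_product, hsh, Finset.mem_filter] at hq
        exact hq.1.2
      simp only [hg, this]
    rw [e2, ENNReal.ofReal_mul (hω j).le]
    gcongr
    refine (hrisk M u μX κ inferInstance inferInstance hM hae huX hud hκ (δ j) (b j) n sh (hδ j)
      (hδ1 j) (Nat.le_ceil _)).trans (ENNReal.ofReal_le_ofReal ?_)
    have hcard : (sh.card : ℝ) ≤ 3 ^ DY * (2 ^ j) ^ DY := by
      have h1 : sh ⊆ freqBox DY j := fun k hk => by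
        rw [hsh, Finset.mem_filter] at hk
        exact mem_freqBox.2 hk.2.le
      exact_mod_cast (Finset.card_le_card h1).trans (card_freqBox_le DY j)
    have hδj := hδ j
    have h3 : (1 : ℝ) ≤ 3 ^ DY := one_le_pow₀ (by norm_num)
    have hx : 0 ≤ (δ j ^ αX) ^ 2 := by positivity
    have hy : 0 ≤ (2 ^ j) ^ DY * δ j ^ (-(dX : ℝ)) / ((n : ℝ) + 1) := by positivity
    calc C₀ * ((δ j ^ αX) ^ 2 + sh.card * δ j ^ (-(dX : ℝ)) / (n + 1))
        ≤ (C₀ + 1) * (3 ^ DY * (δ j ^ αX) ^ 2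
          + (3 ^ DY * (2 ^ j) ^ DY) * δ j ^ (-(dX : ℝ)) / (n + 1)) := by
          gcongr
          · linarith
          · nlinarith
      _ = _ := by ring
  calc ipmRisk γ est μX κ
      ≤ ∫⁻ t, ∫⁻ x, (ENNReal.ofReal (2 * A / a)
          * ∑ q ∈ I, ENNReal.ofReal (ω (freqLevel q.1) * g q t x)
        + ENNReal.ofReal (A * (Z / a + a / 2) + B)) ∂μX ∂P :=
        lintegral_mono fun t => lintegral_mono_ae (hpoint t)
    _ = ENNReal.ofReal (2 * A / a)
          * ∑ q ∈ I, ∫⁻ t, ∫⁻ x, ENNReal.ofReal (ω (freqLevel q.1) * g q t x) ∂μX ∂P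
        + ENNReal.ofReal (A * (Z / a + a / 2) + B) :=
        lintegral_lintegral_mul_sum_add I
          (fun q t x => ENNReal.ofReal (ω (freqLevel q.1) * g q t x))
          (fun q _ => ((hgm q).const_mul _).ennreal_ofReal) _ _
    _ ≤ ENNReal.ofReal (2 * A / a) * ENNReal.ofReal Z
        + ENNReal.ofReal (A * (Z / a + a / 2) + B) := by gcongr
    _ = ENNReal.ofReal (A * a + B) := by
        rw [← ENNReal.ofReal_mul (by positivity), ← ENNReal.ofReal_add (by positivity)
          (by positivity)]
        congr 1
        have : Z = a * a / 6 := by rw [ha2]; ring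
        rw [this]
        field_simp
        ring
    _ = _ := by rw [ha, hZ]; congr 4; ring

end

/-! ### Rates of the upper bound -/

section

/-- The cell side balancing squared bias and variance of regression on the frequencies of a level
with `T` frequencies. -/
theorem regression_term_le {αX : ℝ} (hαX : 0 < αX) (dX n : ℕ) {T : ℝ} (hT : 0 < T)
    (hTn : T ≤ n) (hn : 0 < n) {δ : ℝ} (hδ : δ = min 1 ((T / n) ^ (1 / (2 * αX + dX)))) :
    (δ ^ αX) ^ 2 + T * δ ^ (-(dX : ℝ)) / (n + 1) ≤ 2 * (T / n) ^ (2 * (αX / (2 * αX + dX))) := by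
  have hn' : (0 : ℝ) < n := Nat.cast_pos.2 hn
  have hP : 0 < 2 * αX + dX := by positivity
  set τ := T / n with hτ
  have hτ0 : 0 < τ := by positivity
  have hτ1 : τ ≤ 1 := (div_le_one hn').2 hTn
  have hδ' : δ = τ ^ (1 / (2 * αX + dX)) := by
    rw [hδ]
    exact min_eq_right (Real.rpow_le_one hτ0.le hτ1 (by positivity))
  have h1 : (δ ^ αX) ^ 2 = τ ^ (2 * (αX / (2 * αX + dX))) := by
    rw [hδ', ← Real.rpow_natCast, ← Real.rpow_mul hτ0.le, ← Real.rpow_mul hτ0.le]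
    congr 1
    push_cast
    ring
  have h2 : τ * δ ^ (-(dX : ℝ)) = τ ^ (2 * (αX / (2 * αX + dX))) := by
    rw [hδ', ← Real.rpow_mul hτ0.le]
    nth_rw 1 [← Real.rpow_one τ]
    rw [← Real.rpow_add hτ0]
    congr 1
    field_simp
    ring
  have h3 : T * δ ^ (-(dX : ℝ)) / (n + 1) ≤ τ * δ ^ (-(dX : ℝ)) := by
    have hδ0 : 0 < δ := by rw [hδ']; positivity
    rw [hτ, div_mul_eq_mul_div]
    gcongr
    linarith
  linarith

variable {DY DX dX : ℕ} {αY αX L : ℝ}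

/-- The squared regression errors of the levels `j ≤ J`, with weights `ω j`. -/
theorem exists_condMinimaxRisk_le_of_weights (hαY : 0 < αY) (hαX : 0 < αX) (hL : 0 < L) :
    ∃ C : ℝ, 0 < C ∧ ∀ (n J : ℕ) (ω : ℕ → ℝ) (A B γ : ℝ), 0 < n → ((2 : ℝ) ^ J) ^ DY ≤ n →
      (∀ j, 0 < ω j) → 0 ≤ A → 0 ≤ B →
      (∀ u v : Euc DY → ℝ, HolderDensity DY αY L u → HolderDensity DY αY L v →
        holderIPM γ (volume.withDensity fun y => ENNReal.ofReal (u y))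
            (volume.withDensity fun y => ENNReal.ofReal (v y))
          ≤ ENNReal.ofReal (A * √(∑ k ∈ freqBox DY J,
              ω (freqLevel k) * ‖boxCoeff (8 * L) u k - boxCoeff (8 * L) v k‖ ^ 2) + B)) →
      condMinimaxRisk DY DX dX αY αX L γ n
        ≤ ENNReal.ofReal (C * A * ((n : ℝ) ^ (-(αX / (2 * αX + dX)))
          * √(∑ j ∈ Finset.range (J + 1), ω j * ((4 : ℝ) ^ (DY * αX / (2 * αX + dX))) ^ j)) + B) := by
  obtain ⟨C, hC, h⟩ := exists_condMinimaxRisk_le (DY := DY) (DX := DX) (dX := dX) hαY hαX hL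
  refine ⟨√(2 * C), by positivity, fun n J ω A B γ hn hJ hω hA hB hipm => ?_⟩
  have hn' : (0 : ℝ) < n := Nat.cast_pos.2 hn
  set r := αX / (2 * αX + dX) with hr
  have hP : 0 < 2 * αX + dX := by positivity
  refine (h n J ω (fun j => min 1 ((((2 : ℝ) ^ j) ^ DY / n) ^ (1 / (2 * αX + dX)))) A B γ hω
    (fun j => lt_min one_pos (by positivity)) (fun j => min_le_left _ _) hA hB hipm).trans
    (ENNReal.ofReal_le_ofReal ?_)
  rw [mul_comm (√(2 * C)) A, mul_assoc]
  gcongr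
  have hterm : ∀ j ∈ Finset.range (J + 1), ω j
      * (((min 1 ((((2 : ℝ) ^ j) ^ DY / n) ^ (1 / (2 * αX + dX)))) ^ αX) ^ 2
        + (2 ^ j) ^ DY * (min 1 ((((2 : ℝ) ^ j) ^ DY / n) ^ (1 / (2 * αX + dX)))) ^ (-(dX : ℝ)) / (n + 1))
      ≤ 2 * (((n : ℝ) ^ (-r)) ^ 2 * (ω j * ((4 : ℝ) ^ (DY * αX / (2 * αX + dX))) ^ j)) := by
    intro j hj
    have hjJ : j ≤ J := Nat.lt_succ_iff.1 (Finset.mem_range.1 hj)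
    have hle : ((2 : ℝ) ^ j) ^ DY ≤ n := by
      refine le_trans ?_ hJ
      gcongr
      norm_num
    have := regression_term_le hαX dX n (T := (2 ^ j) ^ DY) (by positivity) hle hn rfl
    refine (mul_le_mul_of_nonneg_left this (hω j).le).trans (le_of_eq ?_)
    have e : (((2 : ℝ) ^ j) ^ DY / n) ^ (2 * r)
        = ((n : ℝ) ^ (-r)) ^ 2 * ((4 : ℝ) ^ (DY * αX / (2 * αX + dX))) ^ j := by
      rw [Real.div_rpow (by positivity) hn'.le, ← Real.rpow_natCast ((n : ℝ) ^ (-r)),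
        ← Real.rpow_mul hn'.le, ← pow_mul, ← Real.rpow_natCast 2, ← Real.rpow_mul (by norm_num),
        ← Real.rpow_natCast _ j, ← Real.rpow_mul (by norm_num),
        show (4 : ℝ) = 2 ^ (2 : ℝ) by norm_num, ← Real.rpow_mul (by norm_num), div_eq_mul_inv,
        ← Real.rpow_neg hn'.le, mul_comm]
      congr 2
      · push_cast; ring
      · rw [hr]; push_cast; ring
    rw [e]
    ring
  calc _ ≤ √(C * ∑ j ∈ Finset.range (J + 1),
        2 * (((n : ℝ) ^ (-r)) ^ 2 * (ω j * ((4 : ℝ) ^ (DY * αX / (2 * αX + dX))) ^ j))) := by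
        refine Real.sqrt_le_sqrt (mul_le_mul_of_nonneg_left (Finset.sum_le_sum hterm) hC.le)
    _ = √((2 * C) * (((n : ℝ) ^ (-r)) ^ 2
        * ∑ j ∈ Finset.range (J + 1), ω j * ((4 : ℝ) ^ (DY * αX / (2 * αX + dX))) ^ j)) := by
        rw [← Finset.mul_sum, ← Finset.mul_sum]
        congr 1
        ring
    _ = _ := by
        rw [Real.sqrt_mul (by positivity : 0 ≤ 2 * C),
          Real.sqrt_mul (by positivity : 0 ≤ ((n : ℝ) ^ (-r)) ^ 2), Real.sqrt_sq (by positivity)]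

/-- The geometric weights `2 ^ (-j (γ + γ'))`, where `γ' = D_Y α_X / (2 α_X + d_X)` is the critical
smoothness of the test functions, balance the regression error and the size of the test functions
on each level. -/
theorem exists_condMinimaxRisk_le_geom (hαY : 0 < αY) (hαX : 0 < αX) (hL : 0 < L) {γ : ℝ}
    (hγ : 0 ≤ γ) :
    ∃ C : ℝ, 0 < C ∧ ∀ n J : ℕ, 0 < n → ((2 : ℝ) ^ J) ^ DY ≤ n →
      condMinimaxRisk DY DX dX αY αX L γ n
        ≤ ENNReal.ofReal (C * ((n : ℝ) ^ (-(αX / (2 * αX + dX)))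
            * ∑ j ∈ Finset.range (J + 1), ((2 : ℝ) ^ (DY * αX / (2 * αX + dX) - γ)) ^ j
          + ((2 : ℝ) ^ (-(γ + αY))) ^ J)) := by
  obtain ⟨C, hC, h⟩ := exists_condMinimaxRisk_le_of_weights (DY := DY) (DX := DX) (dX := dX)
    hαY hαX hL
  obtain ⟨C', hC', h'⟩ := holderIPM_le_of_weights (d := DY) hαY hL hγ
  refine ⟨C * C' + C' + 1, by positivity, fun n J hn hJ => ?_⟩
  set g := DY * αX / (2 * αX + dX) with hg
  have h4 : (4 : ℝ) = 2 ^ (2 : ℝ) := by norm_num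
  have e1 : ∀ j : ℕ, (((2 : ℝ) ^ (-(γ + g))) ^ j)⁻¹ * ((2 : ℝ) ^ (-γ)) ^ (2 * j)
      = ((2 : ℝ) ^ (g - γ)) ^ j := by
    intro j
    rw [← inv_pow, ← Real.rpow_neg (by norm_num), pow_mul, ← mul_pow, ← Real.rpow_natCast _ 2,
      ← Real.rpow_mul (by norm_num), ← Real.rpow_add (by norm_num)]
    congr 2
    push_cast; ring
  have e2 : ∀ j : ℕ, ((2 : ℝ) ^ (-(γ + g))) ^ j * ((4 : ℝ) ^ g) ^ j = ((2 : ℝ) ^ (g - γ)) ^ j := by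
    intro j
    rw [h4, ← mul_pow, ← Real.rpow_mul (by norm_num), ← Real.rpow_add (by norm_num)]
    congr 2
    ring
  set G := ∑ j ∈ Finset.range (J + 1), ((2 : ℝ) ^ (g - γ)) ^ j with hG
  have hG0 : 0 ≤ G := Finset.sum_nonneg fun j _ => by positivity
  have hGe : ∑ j ∈ Finset.range (J + 1), (((2 : ℝ) ^ (-(γ + g))) ^ j)⁻¹
      * ((2 : ℝ) ^ (-γ)) ^ (2 * j) = G := Finset.sum_congr rfl fun j _ => e1 j
  have hGe' : ∑ j ∈ Finset.range (J + 1), ((2 : ℝ) ^ (-(γ + g))) ^ j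
      * ((4 : ℝ) ^ g) ^ j = G := Finset.sum_congr rfl fun j _ => e2 j
  have := h n J (fun j => ((2 : ℝ) ^ (-(γ + g))) ^ j) (C' * √G)
    (C' * ((2 : ℝ) ^ (-(γ + αY))) ^ J) γ hn hJ (fun j => by positivity) (by positivity)
    (by positivity) fun u v hu hv => by
      refine (h' u v hu hv J (fun j => ((2 : ℝ) ^ (-(γ + g))) ^ j) fun j => by positivity).trans (le_of_eq ?_)
      rw [hGe]
      congr 1
      ring
  refine this.trans (ENNReal.ofReal_le_ofReal ?_)
  rw [hGe']
  set x := ((2 : ℝ) ^ (-(γ + αY))) ^ J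
  have hx : 0 ≤ x := by positivity
  set y := (n : ℝ) ^ (-(αX / (2 * αX + dX)))
  have hy : 0 ≤ y := by positivity
  have e3 : C * (C' * √G) * (y * √G) + C' * x = C * C' * (y * G) + C' * x := by
    have := Real.mul_self_sqrt hG0
    linear_combination (C * C' * y) * this
  rw [e3]
  have : 0 ≤ y * G := by positivity
  have h5 : 0 ≤ C * C' := by positivity
  nlinarith [mul_nonneg h5 hx, mul_nonneg hC' this]

/-- In the critical case of an integer smoothness the test functions satisfy a Sobolev bound that
sums over the levels, which saves the square root of the number of levels. -/
theorem exists_condMinimaxRisk_le_nat (hαY : 0 < αY) (hαX : 0 < αX) (hL : 0 < L) (m : ℕ)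
    (hm : (m : ℝ) = DY * αX / (2 * αX + dX)) :
    ∃ C : ℝ, 0 < C ∧ ∀ n J : ℕ, 0 < n → ((2 : ℝ) ^ J) ^ DY ≤ n →
      condMinimaxRisk DY DX dX αY αX L m n
        ≤ ENNReal.ofReal (C * ((n : ℝ) ^ (-(αX / (2 * αX + dX))) * √(J + 1)
          + ((2 : ℝ) ^ (-(m + αY))) ^ J)) := by
  obtain ⟨C, hC, h⟩ := exists_condMinimaxRisk_le_of_weights (DY := DY) (DX := DX) (dX := dX)
    hαY hαX hL
  obtain ⟨C', hC', h'⟩ := holderIPM_le_of_nat (d := DY) hαY hL m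
  refine ⟨C * C' + C' + 1, by positivity, fun n J hn hJ => ?_⟩
  have := h n J (fun j => ((4 : ℝ) ^ (m * j))⁻¹) C'
    (C' * ((2 : ℝ) ^ (-(m + αY))) ^ J) m hn hJ (fun j => by positivity) hC'
    (by positivity) fun u v hu hv => by
      refine (h' u v hu hv J).trans (le_of_eq ?_)
      congr 1
      ring
  refine this.trans (ENNReal.ofReal_le_ofReal ?_)
  have e : ∑ j ∈ Finset.range (J + 1),
      ((4 : ℝ) ^ (m * j))⁻¹ * ((4 : ℝ) ^ (DY * αX / (2 * αX + dX))) ^ j = J + 1 := by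
    rw [← hm, Real.rpow_natCast]
    have : ∀ j ∈ Finset.range (J + 1), ((4 : ℝ) ^ (m * j))⁻¹ * ((4 : ℝ) ^ m) ^ j = 1 := by
      intro j _
      rw [pow_mul]
      exact inv_mul_cancel₀ (by positivity)
    rw [Finset.sum_congr rfl this]
    simp
  rw [e]
  set x := ((2 : ℝ) ^ (-(m + αY))) ^ J
  have hx : 0 ≤ x := by positivity
  set y := (n : ℝ) ^ (-(αX / (2 * αX + dX))) * √(J + 1)
  have hy : 0 ≤ y := by positivity
  have h5 : 0 ≤ C * C' := by positivity
  nlinarith [mul_nonneg h5 hx, mul_nonneg hC' hy]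

/-- Geometric sums are dominated by their largest term. -/
theorem exists_geom_sum_le {q : ℝ} (hq : 0 < q) (hq1 : q ≠ 1) :
    ∃ C : ℝ, 0 < C ∧ ∀ J : ℕ, ∑ j ∈ Finset.range (J + 1), q ^ j ≤ C * max 1 (q ^ J) := by
  rcases lt_or_gt_of_ne hq1 with h | h
  · refine ⟨(1 - q)⁻¹, inv_pos.2 (by linarith), fun J => ?_⟩
    have h1 : ∑ j ∈ Finset.range (J + 1), q ^ j ≤ (1 - q)⁻¹ := by
      rw [← tsum_geometric_of_lt_one hq.le h]
      exact (summable_geometric_of_lt_one hq.le h).sum_le_tsum _ fun i _ => by positivity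
    refine h1.trans (le_mul_of_one_le_right (inv_pos.2 (by linarith)).le (le_max_left _ _))
  · refine ⟨q / (q - 1), div_pos hq (by linarith), fun J => ?_⟩
    rw [geom_sum_eq hq1, div_mul_eq_mul_div]
    have h1 : 0 < q - 1 := by linarith
    gcongr
    calc q ^ (J + 1) - 1 ≤ q * q ^ J := by rw [pow_succ]; linarith
      _ ≤ _ := by gcongr; exact le_max_right _ _

theorem exists_two_pow_le {x : ℝ} (hx : 1 ≤ x) : ∃ J : ℕ, (2 : ℝ) ^ J ≤ x ∧ x < 2 ^ (J + 1) :=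
  exists_nat_pow_near hx (by norm_num)

theorem exists_condMinimaxRisk_le_rate (hαY : 0 < αY) (hαX : 0 < αX) (hL : 0 < L) {γ : ℝ}
    (hγ : 0 ≤ γ) :
    ∃ C : ℝ, 0 < C ∧ ∀ n : ℕ, 3 ≤ n → condMinimaxRisk DY DX dX αY αX L γ n
      ≤ ENNReal.ofReal (C * (logFactor DY dX αX γ n
          * ((n : ℝ) / Real.log n) ^ (-(αX / (2 * αX + dX)))
        + ((n : ℝ) / Real.log n) ^ (-((αY + γ) / (2 * αY + DY + αY / αX * dX))))) := by
  set r := αX / (2 * αX + dX) with hr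
  set g := DY * αX / (2 * αX + dX) with hg
  set Q := 2 * αY + DY + αY / αX * dX with hQ
  set s := (αY + γ) / Q with hs
  have hP : 0 < 2 * αX + dX := by positivity
  have hQ0 : 0 < Q := by positivity
  have hr0 : 0 < r := by positivity
  have hs0 : 0 < s := by positivity
  have hid : αY + g = r * Q := by
    rw [hr, hg, hQ]; field_simp
    ring
  -- the truncation level `J` and its properties
  have hJ : ∀ n : ℕ, 3 ≤ n → ∃ J : ℕ, ((2 : ℝ) ^ J) ^ DY ≤ n ∧ (2 : ℝ) ^ J ≤ (n : ℝ) ^ (1 / Q) ∧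
      ((2 : ℝ) ^ (-(γ + αY))) ^ J ≤ 2 ^ (γ + αY) * (n : ℝ) ^ (-s) ∧
      (J : ℝ) + 1 ≤ (2 / Q + 1) * Real.log n := by
    intro n hn
    have hn3 : (3 : ℝ) ≤ n := by exact_mod_cast hn
    have hn0 : (0 : ℝ) < n := by linarith
    have hlog : 1 ≤ Real.log n := by
      rw [Real.le_log_iff_exp_le hn0]
      linarith [Real.exp_one_lt_d9]
    obtain ⟨J, h1, h2⟩ := exists_two_pow_le (x := (n : ℝ) ^ (1 / Q))
      (Real.one_le_rpow (by linarith) (by positivity))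
    refine ⟨J, ?_, h1, ?_, ?_⟩
    · calc ((2 : ℝ) ^ J) ^ DY ≤ ((n : ℝ) ^ (1 / Q)) ^ DY := by gcongr
        _ = (n : ℝ) ^ (DY / Q) := by
            rw [← Real.rpow_natCast, ← Real.rpow_mul hn0.le]; congr 1; ring
        _ ≤ (n : ℝ) ^ (1 : ℝ) := by
            refine Real.rpow_le_rpow_of_exponent_le (by linarith) ((div_le_one hQ0).2 ?_)
            have : 0 ≤ αY / αX * dX := by positivity
            linarith
        _ = n := Real.rpow_one _
    · have h3 : ((2 : ℝ) ^ (-(γ + αY))) ^ J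
          = 2 ^ (γ + αY) * ((2 : ℝ) ^ (J + 1)) ^ (-(γ + αY)) := by
        rw [← Real.rpow_natCast, ← Real.rpow_mul (by norm_num), ← Real.rpow_natCast 2 (J + 1),
          ← Real.rpow_mul (by norm_num), ← Real.rpow_add (by norm_num)]
        congr 1
        push_cast; ring
      rw [h3]
      gcongr
      calc ((2 : ℝ) ^ (J + 1)) ^ (-(γ + αY)) ≤ ((n : ℝ) ^ (1 / Q)) ^ (-(γ + αY)) :=
            Real.rpow_le_rpow_of_nonpos (by positivity) h2.le (by linarith)
        _ = (n : ℝ) ^ (-s) := by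
            rw [← Real.rpow_mul hn0.le]; congr 1; rw [hs]; ring
    · have h3 := Real.log_le_log (by positivity) h1
      rw [Real.log_pow, Real.log_rpow hn0] at h3
      have h4 : (1 : ℝ) / 2 ≤ Real.log 2 := by linarith [Real.log_two_gt_d9]
      have h5 : (J : ℝ) * (1 / 2) ≤ J * Real.log 2 := by gcongr
      have : (2 / Q + 1) * Real.log n = 2 * (1 / Q * Real.log n) + Real.log n := by ring
      linarith
  -- comparison with the powers of `n / log n`
  have hcmp : ∀ n : ℕ, 3 ≤ n → ∀ t : ℝ, 0 ≤ t →
      (n : ℝ) ^ (-t) ≤ ((n : ℝ) / Real.log n) ^ (-t) ∧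
      ((n : ℝ) / Real.log n) ^ (-t) = (Real.log n) ^ t * (n : ℝ) ^ (-t) ∧ 1 ≤ Real.log n ∧
      1 ≤ logFactor DY dX αX γ n := by
    intro n hn t ht
    have hn3 : (3 : ℝ) ≤ n := by exact_mod_cast hn
    have hn0 : (0 : ℝ) < n := by linarith
    have hlog : 1 ≤ Real.log n := by
      rw [Real.le_log_iff_exp_le hn0]
      linarith [Real.exp_one_lt_d9]
    have h1 : ((n : ℝ) / Real.log n) ^ (-t) = (Real.log n) ^ t * (n : ℝ) ^ (-t) := by
      rw [Real.div_rpow hn0.le (by linarith), Real.rpow_neg (by linarith : 0 ≤ Real.log n)]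
      field_simp
    refine ⟨?_, h1, hlog, ?_⟩
    · rw [h1]
      exact le_mul_of_one_le_left (by positivity) (Real.one_le_rpow hlog ht)
    · unfold logFactor
      split_ifs
      · exact hlog
      · exact Real.one_le_sqrt.2 hlog
  have hnpos : ∀ n : ℕ, 3 ≤ n → (0 : ℝ) < n := fun n hn => by
    have : (3 : ℝ) ≤ n := by exact_mod_cast hn
    linarith
  by_cases hcase : γ = g
  · by_cases hnat : 1 ≤ dX ∧ ∃ k : ℕ, γ = k
    · obtain ⟨hdX, m, hm⟩ := hnat
      obtain ⟨C, hC, h⟩ := exists_condMinimaxRisk_le_nat (DY := DY) (DX := DX) (dX := dX)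
        hαY hαX hL m (by rw [← hm, hcase])
      rw [← hm] at h
      refine ⟨C * (√(2 / Q + 1) + 2 ^ (γ + αY)), by positivity, fun n hn => ?_⟩
      obtain ⟨J, hJ1, -, hJ3, hJ4⟩ := hJ n hn
      refine (h n J (by omega) hJ1).trans (ENNReal.ofReal_le_ofReal ?_)
      obtain ⟨hr1, -, hlog, -⟩ := hcmp n hn r hr0.le
      obtain ⟨hs1, -, -, -⟩ := hcmp n hn s hs0.le
      have hlf : logFactor DY dX αX γ n = √(Real.log n) := by
        unfold logFactor
        rw [if_neg]
        rintro ⟨-, -, h3⟩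
        exact h3 m hm
      rw [hlf, mul_assoc]
      have h1 : √((J : ℝ) + 1) ≤ √(2 / Q + 1) * √(Real.log n) := by
        rw [← Real.sqrt_mul (by positivity)]
        exact Real.sqrt_le_sqrt hJ4
      have hn0 := hnpos n hn
      set X := ((n : ℝ) / Real.log n) ^ (-r)
      set Y := ((n : ℝ) / Real.log n) ^ (-s)
      have hX : 0 ≤ X := le_trans (by positivity) hr1
      have hY : 0 ≤ Y := le_trans (by positivity) hs1
      gcongr
      have h2 : (n : ℝ) ^ (-r) * √((J : ℝ) + 1) ≤ X * (√(2 / Q + 1) * √(Real.log n)) := by gcongr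
      have h3 : ((2 : ℝ) ^ (-(γ + αY))) ^ J ≤ 2 ^ (γ + αY) * Y := hJ3.trans (by gcongr)
      have h4 : 0 ≤ √(2 / Q + 1) * Y := by positivity
      have h5 : 0 ≤ 2 ^ (γ + αY) * (√(Real.log n) * X) := by positivity
      linarith
    · obtain ⟨C, hC, h⟩ := exists_condMinimaxRisk_le_geom (DY := DY) (DX := DX) (dX := dX)
        hαY hαX hL hγ
      refine ⟨C * ((2 / Q + 1) + 2 ^ (γ + αY)), by positivity, fun n hn => ?_⟩
      obtain ⟨J, hJ1, -, hJ3, hJ4⟩ := hJ n hn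
      refine (h n J (by omega) hJ1).trans (ENNReal.ofReal_le_ofReal ?_)
      obtain ⟨hr1, hr2, hlog, -⟩ := hcmp n hn r hr0.le
      obtain ⟨hs1, -, -, -⟩ := hcmp n hn s hs0.le
      have hn0 := hnpos n hn
      have hG : ∑ j ∈ Finset.range (J + 1), ((2 : ℝ) ^ (g - γ)) ^ j = J + 1 := by
        rw [hcase]; simp
      rw [hG, mul_assoc]
      set X := ((n : ℝ) / Real.log n) ^ (-r)
      set Y := ((n : ℝ) / Real.log n) ^ (-s)
      have hX : 0 ≤ X := le_trans (by positivity) hr1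
      have hY : 0 ≤ Y := le_trans (by positivity) hs1
      have hlf : Real.log n * (n : ℝ) ^ (-r) ≤ logFactor DY dX αX γ n * X := by
        unfold logFactor
        split_ifs with hif
        · gcongr
        · -- here `d_X = 0`, and the exponent is `r = 1 / 2`
          have hdX : dX = 0 := by
            by_contra h0
            refine hif ⟨Nat.one_le_iff_ne_zero.2 h0, hcase, fun k hk => hnat ⟨?_, k, hk⟩⟩
            exact Nat.one_le_iff_ne_zero.2 h0
          have hr' : r = 1 / 2 := by rw [hr, hdX]; push_cast; field_simp; simp
          rw [hr2, hr', ← Real.sqrt_eq_rpow, ← mul_assoc, Real.mul_self_sqrt (by linarith)]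
      gcongr
      have h2 : (n : ℝ) ^ (-r) * ((J : ℝ) + 1)
          ≤ (2 / Q + 1) * (logFactor DY dX αX γ n * X) := by
        calc _ ≤ (n : ℝ) ^ (-r) * ((2 / Q + 1) * Real.log n) := by gcongr
          _ = (2 / Q + 1) * (Real.log n * (n : ℝ) ^ (-r)) := by ring
          _ ≤ _ := by gcongr
      have h3 : ((2 : ℝ) ^ (-(γ + αY))) ^ J ≤ 2 ^ (γ + αY) * Y := hJ3.trans (by gcongr)
      have h4 : 0 ≤ (2 / Q + 1) * Y := by positivity
      have h5 : 0 ≤ 2 ^ (γ + αY) * (logFactor DY dX αX γ n * X) :=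
        mul_nonneg (by positivity) (le_trans (by positivity) hlf)
      linarith
  · obtain ⟨C, hC, h⟩ := exists_condMinimaxRisk_le_geom (DY := DY) (DX := DX) (dX := dX)
      hαY hαX hL hγ
    obtain ⟨C', hC', h'⟩ := exists_geom_sum_le (q := (2 : ℝ) ^ (g - γ)) (by positivity) (by
      intro h1
      have h2 := congrArg Real.log h1
      rw [Real.log_rpow (by norm_num), Real.log_one, mul_eq_zero] at h2
      rcases h2 with h2 | h2
      · exact hcase (by linarith)
      · exact absurd h2 (Real.log_pos (by norm_num)).ne')
    refine ⟨C * (C' + 2 ^ (γ + αY)), by positivity, fun n hn => ?_⟩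
    obtain ⟨J, hJ1, hJ2, hJ3, -⟩ := hJ n hn
    refine (h n J (by omega) hJ1).trans (ENNReal.ofReal_le_ofReal ?_)
    obtain ⟨hr1, -, hlog, hlf⟩ := hcmp n hn r hr0.le
    obtain ⟨hs1, -, -, -⟩ := hcmp n hn s hs0.le
    have hn0 := hnpos n hn
    rw [mul_assoc]
    set X := ((n : ℝ) / Real.log n) ^ (-r)
    set Y := ((n : ℝ) / Real.log n) ^ (-s)
    have hX : 0 ≤ X := le_trans (by positivity) hr1
    have hY : 0 ≤ Y := le_trans (by positivity) hs1
    have hmax : (n : ℝ) ^ (-r) * max 1 (((2 : ℝ) ^ (g - γ)) ^ J) ≤ X + Y := by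
      rcases le_total (((2 : ℝ) ^ (g - γ)) ^ J) 1 with hle | hle
      · rw [max_eq_left hle]; linarith
      · rw [max_eq_right hle]
        have h1 : ((2 : ℝ) ^ (g - γ)) ^ J ≤ max 1 ((n : ℝ) ^ ((g - γ) / Q)) := by
          rcases le_total 0 (g - γ) with h0 | h0
          · refine le_max_of_le_right ?_
            calc ((2 : ℝ) ^ (g - γ)) ^ J = ((2 : ℝ) ^ J) ^ (g - γ) := by
                  rw [← Real.rpow_natCast, ← Real.rpow_mul (by norm_num), ← Real.rpow_natCast,
                    ← Real.rpow_mul (by norm_num), mul_comm]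
              _ ≤ ((n : ℝ) ^ (1 / Q)) ^ (g - γ) := Real.rpow_le_rpow (by positivity) hJ2 h0
              _ = _ := by rw [← Real.rpow_mul hn0.le]; congr 1; ring
          · refine le_max_of_le_left (pow_le_one₀ (by positivity) ?_)
            exact Real.rpow_le_one_of_one_le_of_nonpos (by norm_num) h0
        have h2 : (n : ℝ) ^ (-r) * (n : ℝ) ^ ((g - γ) / Q) = (n : ℝ) ^ (-s) := by
          rw [← Real.rpow_add hn0]
          congr 1
          rw [hs]
          field_simp
          linarith
        calc _ ≤ (n : ℝ) ^ (-r) * max 1 ((n : ℝ) ^ ((g - γ) / Q)) := by gcongr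
          _ ≤ (n : ℝ) ^ (-r) * (1 + (n : ℝ) ^ ((g - γ) / Q)) := by
              gcongr
              exact max_le (by linarith [Real.rpow_nonneg hn0.le ((g - γ) / Q)])
                (by linarith)
          _ = (n : ℝ) ^ (-r) + (n : ℝ) ^ (-s) := by rw [mul_add, mul_one, h2]
          _ ≤ _ := by gcongr
    gcongr
    have h2 : (n : ℝ) ^ (-r) * ∑ j ∈ Finset.range (J + 1), ((2 : ℝ) ^ (g - γ)) ^ j
        ≤ C' * (X + Y) := by
      calc _ ≤ (n : ℝ) ^ (-r) * (C' * max 1 (((2 : ℝ) ^ (g - γ)) ^ J)) := by gcongr; exact h' J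
        _ = C' * ((n : ℝ) ^ (-r) * max 1 (((2 : ℝ) ^ (g - γ)) ^ J)) := by ring
        _ ≤ _ := by gcongr
    have h3 : ((2 : ℝ) ^ (-(γ + αY))) ^ J ≤ 2 ^ (γ + αY) * Y := hJ3.trans (by gcongr)
    have h4 : X ≤ logFactor DY dX αX γ n * X := le_mul_of_one_le_left hX hlf
    have h5 : 0 ≤ 2 ^ (γ + αY) * (logFactor DY dX αX γ n * X) :=
      mul_nonneg (by positivity) (hX.trans h4)
    have h6 : C' * X ≤ C' * (logFactor DY dX αX γ n * X) := by gcongr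
    linarith

end

/-! ### Hölder norms of smooth functions -/

section

variable {d : ℕ} {α : ℝ}

/-- Bounds on the total derivatives of a smooth function that imply that it lies in a Hölder ball;
unlike the Hölder norm, they are stable under sums by inspection. -/
structure HolderBound (α B : ℝ) (F : Euc d → ℝ) : Prop where
  contDiff : ContDiff ℝ (⊤ : ℕ∞) F
  abs_le : ∀ x, |F x| ≤ B
  norm_le : ∀ k : ℕ, (k : ℝ) < α → ∀ x, ‖iteratedFDeriv ℝ k F x‖ ≤ B
  norm_sub_le : ∀ k : ℕ, (k : ℝ) < α → α - 1 ≤ k → ∀ x y,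
    ‖iteratedFDeriv ℝ k F x - iteratedFDeriv ℝ k F y‖ ≤ B * ‖x - y‖ ^ (α - k)

theorem HolderBound.add {A B : ℝ} {F G : Euc d → ℝ} (hF : HolderBound α A F)
    (hG : HolderBound α B G) : HolderBound α (A + B) fun x => F x + G x := by
  have e : ∀ (k : ℕ) x, iteratedFDeriv ℝ k (fun x => F x + G x) x
      = iteratedFDeriv ℝ k F x + iteratedFDeriv ℝ k G x := fun k x =>
    iteratedFDeriv_add_apply (hF.contDiff.contDiffAt.of_le (by exact_mod_cast le_top))
      (hG.contDiff.contDiffAt.of_le (by exact_mod_cast le_top))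
  refine ⟨hF.contDiff.add hG.contDiff, fun x => (abs_add_le _ _).trans
    (add_le_add (hF.abs_le x) (hG.abs_le x)), fun k hk x => ?_, fun k hk hk' x y => ?_⟩
  · rw [e]
    exact (norm_add_le _ _).trans (add_le_add (hF.norm_le k hk x) (hG.norm_le k hk x))
  · rw [e, e, add_sub_add_comm, add_mul]
    exact (norm_add_le _ _).trans
      (add_le_add (hF.norm_sub_le k hk hk' x y) (hG.norm_sub_le k hk hk' x y))

theorem HolderBound.mono {A B : ℝ} {F : Euc d → ℝ} (hF : HolderBound α A F) (h : A ≤ B) :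
    HolderBound α B F :=
  ⟨hF.contDiff, fun x => (hF.abs_le x).trans h, fun k hk x => (hF.norm_le k hk x).trans h,
    fun k hk hk' x y => (hF.norm_sub_le k hk hk' x y).trans
      (mul_le_mul_of_nonneg_right h (Real.rpow_nonneg (norm_nonneg _) _))⟩

theorem abs_apply_single_le {k : ℕ} (T : ContinuousMultilinearMap ℝ (fun _ : Fin k => Euc d) ℝ)
    (i : Fin k → Fin d) : |T fun m => EuclideanSpace.single (i m) (1 : ℝ)| ≤ ‖T‖ := by
  have := T.le_opNorm fun m => EuclideanSpace.single (i m) (1 : ℝ)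
  simpa using this

theorem exists_mem_holderBall (d : ℕ) (α : ℝ) :
    ∃ C : ℝ, 1 ≤ C ∧ ∀ (B : ℝ) (F : Euc d → ℝ), 0 ≤ B → HolderBound α B F →
      F ∈ HolderBall d α (C * B) := by
  set N : ℝ := ((multiIdx d α).card : ℝ)
    + (((multiIdx d α).filter fun j => α - 1 ≤ ((∑ i, j i : ℕ) : ℝ)).card : ℝ) with hN
  refine ⟨max 1 N, le_max_left _ _, fun B F hB hF => ⟨fun _ x => (hF.abs_le x).trans
    (le_mul_of_one_le_left hB (le_max_left _ _)), fun hα => ⟨?_, ?_⟩⟩⟩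
  · exact hF.contDiff.of_le (by exact_mod_cast le_top)
  · have h1 : ∀ j ∈ multiIdx d α, (⨆ x : Euc d, ENNReal.ofReal |mixedPartial j F x|)
        ≤ ENNReal.ofReal B := fun j hj => iSup_le fun x => ENNReal.ofReal_le_ofReal
      ((abs_apply_single_le _ _).trans (hF.norm_le _ (mem_multiIdx.1 hj) x))
    have h2 : ∀ j ∈ (multiIdx d α).filter (fun j => α - 1 ≤ ((∑ i, j i : ℕ) : ℝ)),
        (⨆ (x : Euc d) (y : Euc d) (_ : x ≠ y),
        ENNReal.ofReal (|mixedPartial j F x - mixedPartial j F y|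
          / ‖x - y‖ ^ (α - ((∑ i, j i : ℕ) : ℝ)))) ≤ ENNReal.ofReal B := by
      intro j hj
      rw [Finset.mem_filter] at hj
      refine iSup_le fun x => iSup_le fun y => iSup_le fun hxy => ENNReal.ofReal_le_ofReal ?_
      have hpos : 0 < ‖x - y‖ := norm_pos_iff.2 (sub_ne_zero.2 hxy)
      rw [div_le_iff₀ (by positivity)]
      refine le_trans ?_ (hF.norm_sub_le _ (mem_multiIdx.1 hj.1) hj.2 x y)
      unfold mixedPartial
      rw [← sub_apply]
      exact abs_apply_single_le _ _
    unfold holderNorm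
    refine (add_le_add (Finset.sum_le_sum h1) (Finset.sum_le_sum h2)).trans ?_
    rw [Finset.sum_const, Finset.sum_const, ← add_nsmul, ← ENNReal.ofReal_nsmul, nsmul_eq_mul]
    refine ENNReal.ofReal_le_ofReal (mul_le_mul_of_nonneg_right ?_ hB)
    rw [Nat.cast_add]
    exact le_max_right (1 : ℝ) N

/-- Functions that vary on the scale `h`. -/
theorem HolderBound.of_scale (hα : 0 ≤ α) {h B : ℝ} (hh : 0 < h) (hh1 : h ≤ 1) (hB : 0 ≤ B)
    {F : Euc d → ℝ} (hF : ContDiff ℝ (⊤ : ℕ∞) F)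
    (hb : ∀ k : ℕ, k ≤ ⌈α⌉₊ → ∀ x, ‖iteratedFDeriv ℝ k F x‖ ≤ B * (h⁻¹) ^ k) :
    HolderBound α (2 * B * h ^ (-α)) F := by
  have hpow : ∀ t : ℝ, 0 ≤ t → t ≤ α → h ^ (-t) ≤ h ^ (-α) := fun t _ ht =>
    Real.rpow_le_rpow_of_exponent_ge hh hh1 (by linarith)
  have hk' : ∀ k : ℕ, (h⁻¹) ^ k = h ^ (-(k : ℝ)) := fun k => by
    rw [Real.rpow_neg hh.le, Real.rpow_natCast, inv_pow]
  have hle : ∀ k : ℕ, (k : ℝ) ≤ α → ∀ x, ‖iteratedFDeriv ℝ k F x‖ ≤ B * h ^ (-α) := by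
    intro k hk x
    have hkc : k ≤ ⌈α⌉₊ := by exact_mod_cast hk.trans (Nat.le_ceil α)
    refine (hb k hkc x).trans ?_
    rw [hk']
    exact mul_le_mul_of_nonneg_left (hpow k (Nat.cast_nonneg k) hk) hB
  have h0 : 0 ≤ B * h ^ (-α) := by positivity
  refine ⟨hF, fun x => ?_, fun k hk x => (hle k hk.le x).trans (by linarith),
    fun k hk hk2 x y => ?_⟩
  · have := hle 0 (by simpa using hα) x
    rw [norm_iteratedFDeriv_zero, Real.norm_eq_abs] at this
    linarith
  · set t := ‖x - y‖ with ht
    have ht0 : 0 ≤ t := norm_nonneg _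
    rcases le_or_gt h t with hht | hht
    · have htp : 0 < t := hh.trans_le hht
      have h1 : ‖iteratedFDeriv ℝ k F x - iteratedFDeriv ℝ k F y‖ ≤ 2 * (B * h ^ (-(k : ℝ))) := by
        have hkc : k ≤ ⌈α⌉₊ := by exact_mod_cast hk.le.trans (Nat.le_ceil α)
        have hx := hb k hkc x
        have hy := hb k hkc y
        rw [hk'] at hx hy
        linarith [_root_.norm_sub_le (iteratedFDeriv ℝ k F x) (iteratedFDeriv ℝ k F y)]
      refine h1.trans ?_
      have h2 : h ^ (-(k : ℝ)) ≤ h ^ (-α) * t ^ (α - k) := by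
        calc h ^ (-(k : ℝ)) = h ^ (-α) * h ^ (α - k) := by
              rw [← Real.rpow_add hh]; congr 1; ring
          _ ≤ _ := by gcongr
      calc _ ≤ 2 * (B * (h ^ (-α) * t ^ (α - k))) := by gcongr
        _ = _ := by ring
    · have hkc : k + 1 ≤ ⌈α⌉₊ := Nat.lt_ceil.2 hk
      have hdiff : ∀ z ∈ Set.univ, DifferentiableAt ℝ (iteratedFDeriv ℝ k F) z := fun z _ =>
        (hF.differentiable_iteratedFDeriv (by exact_mod_cast ENat.natCast_lt_top k)) z
      have hbd : ∀ z ∈ Set.univ, ‖fderiv ℝ (iteratedFDeriv ℝ k F) z‖ ≤ B * (h⁻¹) ^ (k + 1) :=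
        fun z _ => by
          rw [norm_fderiv_iteratedFDeriv]
          exact hb _ hkc z
      have h1 := (convex_univ (𝕜 := ℝ)).norm_image_sub_le_of_norm_fderiv_le hdiff hbd
        (Set.mem_univ y) (Set.mem_univ x)
      refine h1.trans ?_
      rw [hk', ← ht]
      rcases ht0.eq_or_lt with h00 | htp
      · rw [← h00, mul_zero]
        positivity
      · have h2 : h ^ (-((k + 1 : ℕ) : ℝ)) * t ≤ h ^ (-α) * t ^ (α - k) := by
          have e : t = t ^ (1 - (α - k)) * t ^ (α - k) := by
            rw [← Real.rpow_add htp]; simp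
          calc h ^ (-((k + 1 : ℕ) : ℝ)) * t
              = h ^ (-((k + 1 : ℕ) : ℝ)) * t ^ (1 - (α - k)) * t ^ (α - k) := by
                nth_rw 1 [e]; ring
            _ ≤ h ^ (-((k + 1 : ℕ) : ℝ)) * h ^ (1 - (α - k)) * t ^ (α - k) := by
                gcongr
                linarith
            _ = _ := by
                rw [← Real.rpow_add hh]; congr 2; push_cast; ring
        calc B * h ^ (-((k + 1 : ℕ) : ℝ)) * t = B * (h ^ (-((k + 1 : ℕ) : ℝ)) * t) := by ring
          _ ≤ B * (h ^ (-α) * t ^ (α - k)) := by gcongr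
          _ ≤ 2 * (B * (h ^ (-α) * t ^ (α - k))) := by
              have : 0 ≤ B * (h ^ (-α) * t ^ (α - k)) := by positivity
              linarith
          _ = _ := by ring

theorem HolderBound.of_bounded (hα : 0 ≤ α) {B : ℝ} (hB : 0 ≤ B) {F : Euc d → ℝ}
    (hF : ContDiff ℝ (⊤ : ℕ∞) F) (hb : ∀ k : ℕ, k ≤ ⌈α⌉₊ → ∀ x, ‖iteratedFDeriv ℝ k F x‖ ≤ B) :
    HolderBound α (2 * B) F := by
  simpa using HolderBound.of_scale hα one_pos le_rfl hB hF (by simpa using hb)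

theorem exists_norm_iteratedFDeriv_le {F : Euc d → ℝ} (hF : ContDiff ℝ (⊤ : ℕ∞) F)
    (hc : HasCompactSupport F) (K : ℕ) :
    ∃ B : ℝ, 0 < B ∧ ∀ k ≤ K, ∀ x, ‖iteratedFDeriv ℝ k F x‖ ≤ B := by
  have h : ∀ k : ℕ, ∃ B : ℝ, ∀ x, ‖iteratedFDeriv ℝ k F x‖ ≤ B := fun k =>
    (hc.iteratedFDeriv k).exists_bound_of_continuous
      (hF.continuous_iteratedFDeriv (by exact_mod_cast le_top))
  choose B hB using h
  have hB0 : ∀ k, 0 ≤ B k := fun k => (norm_nonneg _).trans (hB k 0)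
  refine ⟨∑ k ∈ Finset.range (K + 1), B k + 1,
    by linarith [Finset.sum_nonneg fun k (_ : k ∈ Finset.range (K + 1)) => hB0 k],
    fun k hk x => (hB k x).trans ?_⟩
  have := Finset.single_le_sum (f := B) (fun k _ => hB0 k)
    (Finset.mem_range.2 (Nat.lt_succ_of_le hk))
  linarith

/-! ### Sums of bumps with disjoint supports -/

/-- The sum of copies of the bump `φ`, shrunk to scale `h`, at the points `p i`. -/
noncomputable def bumpSum {ι : Type*} [Fintype ι] (φ : Euc d → ℝ) (h : ℝ) (p : ι → Euc d)
    (c : ι → ℝ) (x : Euc d) : ℝ :=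
  ∑ i, c i * φ (h⁻¹ • (x - p i))

variable {ι : Type*} {φ : Euc d → ℝ} {h : ℝ} {p : ι → Euc d}

/-- At most one of the bumps is nonzero at each point. -/
theorem eq_of_dist_lt (hh : 0 < h) (hp : ∀ i j, i ≠ j → h ≤ ‖p i - p j‖) {x : Euc d} {i j : ι}
    (hi : ‖h⁻¹ • (x - p i)‖ ≤ 1 / 3) (hj : ‖h⁻¹ • (x - p j)‖ ≤ 1 / 3) : i = j := by
  by_contra hij
  rw [norm_smul, norm_inv, Real.norm_of_nonneg hh.le, inv_mul_le_iff₀ hh] at hi hj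
  have h1 := hp i j hij
  have h2 : ‖p i - p j‖ ≤ ‖x - p j‖ + ‖x - p i‖ := by
    rw [show p i - p j = (x - p j) - (x - p i) by abel]
    exact norm_sub_le _ _
  linarith

variable [Fintype ι]

theorem norm_sum_le_of_disjoint {E : Type*} [SeminormedAddCommGroup E] {f : ι → E} {B : ℝ}
    (hB : 0 ≤ B) (hf : ∀ i, ‖f i‖ ≤ B) (hd : ∀ i j, f i ≠ 0 → f j ≠ 0 → i = j) :
    ‖∑ i, f i‖ ≤ B := by
  by_cases h : ∃ i, f i ≠ 0
  · obtain ⟨i, hi⟩ := h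
    rw [Finset.sum_eq_single i (fun j _ hj => by
      by_contra h0
      exact hj (hd j i h0 hi)) (by simp)]
    exact hf i
  · push Not at h
    simpa [h] using hB

theorem contDiff_bump (hφ : ContDiff ℝ (⊤ : ℕ∞) φ) (q : Euc d) :
    ContDiff ℝ (⊤ : ℕ∞) fun x => φ (h⁻¹ • (x - q)) :=
  hφ.comp (contDiff_const_smul _ |>.comp (contDiff_id.sub contDiff_const))

theorem iteratedFDeriv_bump (hφ : ContDiff ℝ (⊤ : ℕ∞) φ) (q : Euc d) (k : ℕ) (x : Euc d) :
    iteratedFDeriv ℝ k (fun x => φ (h⁻¹ • (x - q))) x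
      = (h⁻¹) ^ k • iteratedFDeriv ℝ k φ (h⁻¹ • (x - q)) := by
  have h1 := iteratedFDeriv_comp_sub (𝕜 := ℝ) (f := fun z => φ (h⁻¹ • z)) k q x
  rw [h1, iteratedFDeriv_comp_const_smul h⁻¹ (hφ.of_le (by exact_mod_cast le_top))]

theorem contDiff_bumpSum (hφ : ContDiff ℝ (⊤ : ℕ∞) φ) (c : ι → ℝ) :
    ContDiff ℝ (⊤ : ℕ∞) (bumpSum φ h p c) := by
  unfold bumpSum
  exact ContDiff.sum fun i _ => contDiff_const.mul (contDiff_bump hφ _)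

theorem norm_iteratedFDeriv_bumpSum_le (hφ : ContDiff ℝ (⊤ : ℕ∞) φ)
    (hφs : tsupport φ ⊆ Metric.closedBall 0 (1 / 3)) (hh : 0 < h)
    (hp : ∀ i j, i ≠ j → h ≤ ‖p i - p j‖) {A B : ℝ} (hA : 0 ≤ A) {c : ι → ℝ}
    (hc : ∀ i, |c i| ≤ A) {k : ℕ} (hB : ∀ x, ‖iteratedFDeriv ℝ k φ x‖ ≤ B) (x : Euc d) :
    ‖iteratedFDeriv ℝ k (bumpSum φ h p c) x‖ ≤ A * B * (h⁻¹) ^ k := by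
  have hB0 : 0 ≤ B := (norm_nonneg _).trans (hB 0)
  have hcd : ∀ i, ContDiffAt ℝ k (fun x => φ (h⁻¹ • (x - p i))) x := fun i =>
    ((contDiff_bump hφ (p i)).of_le (by exact_mod_cast le_top)).contDiffAt
  have e : iteratedFDeriv ℝ k (bumpSum φ h p c) x
      = ∑ i, c i • (h⁻¹) ^ k • iteratedFDeriv ℝ k φ (h⁻¹ • (x - p i)) := by
    unfold bumpSum
    rw [iteratedFDeriv_fun_sum_apply fun i _ => contDiffAt_const.mul (hcd i)]
    refine Finset.sum_congr rfl fun i _ => ?_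
    rw [← iteratedFDeriv_bump hφ, ← iteratedFDeriv_const_smul_apply (hcd i)]
    rfl
  rw [e]
  have hsupp : ∀ i, c i • (h⁻¹) ^ k • iteratedFDeriv ℝ k φ (h⁻¹ • (x - p i)) ≠ 0 →
      ‖h⁻¹ • (x - p i)‖ ≤ 1 / 3 := by
    intro i hi
    have h1 : iteratedFDeriv ℝ k φ (h⁻¹ • (x - p i)) ≠ 0 := fun h0 => hi (by simp [h0])
    exact mem_closedBall_zero_iff.1 (hφs (support_iteratedFDeriv_subset (𝕜 := ℝ) k h1))
  refine norm_sum_le_of_disjoint (by positivity) (fun i => ?_)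
    fun i j hi hj => eq_of_dist_lt hh hp (hsupp i hi) (hsupp j hj)
  rw [norm_smul, norm_smul, Real.norm_eq_abs, norm_pow, norm_inv, Real.norm_of_nonneg hh.le]
  calc |c i| * ((h⁻¹) ^ k * ‖iteratedFDeriv ℝ k φ (h⁻¹ • (x - p i))‖)
      ≤ A * ((h⁻¹) ^ k * B) := by
        gcongr
        · exact hc i
        · exact hB _
    _ = _ := by ring

theorem abs_bumpSum_le (hφs : tsupport φ ⊆ Metric.closedBall 0 (1 / 3)) (hh : 0 < h)
    (hp : ∀ i j, i ≠ j → h ≤ ‖p i - p j‖) {A B : ℝ} (hA : 0 ≤ A) {c : ι → ℝ}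
    (hc : ∀ i, |c i| ≤ A) (hB : ∀ x, |φ x| ≤ B) (x : Euc d) :
    |bumpSum φ h p c x| ≤ A * B := by
  have hB0 : 0 ≤ B := (abs_nonneg _).trans (hB 0)
  have hsupp : ∀ i, c i * φ (h⁻¹ • (x - p i)) ≠ 0 → ‖h⁻¹ • (x - p i)‖ ≤ 1 / 3 := fun i hi =>
    mem_closedBall_zero_iff.1 (hφs (subset_tsupport φ (right_ne_zero_of_mul hi)))
  refine norm_sum_le_of_disjoint (by positivity) (fun i => ?_)
    fun i j hi hj => eq_of_dist_lt hh hp (hsupp i hi) (hsupp j hj)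
  rw [norm_mul]
  exact mul_le_mul (hc i) (hB _) (norm_nonneg _) hA

/-- The Hölder norm of a sum of disjoint bumps does not depend on their number. -/
theorem exists_holderBound_bumpSum (hα : 0 ≤ α) (hφ : ContDiff ℝ (⊤ : ℕ∞) φ)
    (hφs : tsupport φ ⊆ Metric.closedBall 0 (1 / 3)) :
    ∃ B : ℝ, 0 < B ∧ ∀ (ι : Type) [Fintype ι] (h : ℝ) (p : ι → Euc d) (A : ℝ) (c : ι → ℝ),
      0 < h → h ≤ 1 → (∀ i j, i ≠ j → h ≤ ‖p i - p j‖) → 0 ≤ A → (∀ i, |c i| ≤ A) →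
      HolderBound α (A * B * h ^ (-α)) (bumpSum φ h p c) := by
  have hcomp : HasCompactSupport φ :=
    (isCompact_closedBall (0 : Euc d) (1 / 3)).of_isClosed_subset (isClosed_tsupport φ) hφs
  obtain ⟨B, hB, hb⟩ := exists_norm_iteratedFDeriv_le hφ hcomp ⌈α⌉₊
  refine ⟨2 * B, by positivity, fun ι _ h p A c hh hh1 hp hA hc => ?_⟩
  refine (HolderBound.of_scale hα hh hh1 (mul_nonneg hA hB.le) (contDiff_bumpSum hφ c)
    fun k hk x => norm_iteratedFDeriv_bumpSum_le hφ hφs hh hp hA hc (hb k hk) x).mono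
    (le_of_eq (by ring))

end

/-! ### Assouad's lemma -/

section

variable {S : Type*} [MeasurableSpace S]

theorem lintegral_pi_prod_eq_pow {n : ℕ} (P : Measure S) [IsProbabilityMeasure P]
    (f : Fin n → S → ℝ≥0∞) (hf : ∀ i, Measurable (f i)) :
    ∫⁻ t, ∏ i, f i (t i) ∂(Measure.pi fun _ : Fin n => P) = ∏ i, ∫⁻ x, f i x ∂P := by
  have hind : iIndepFun (fun i (t : Fin n → S) => f i (t i)) (Measure.pi fun _ : Fin n => P) :=
    iIndepFun_pi fun i => (hf i).aemeasurable
  rw [lintegral_prod_eq_prod_lintegral_of_indepFun Finset.univ _ hind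
    fun i => (hf i).comp (measurable_pi_apply i)]
  refine Finset.prod_congr rfl fun i _ => ?_
  exact (measurePreserving_eval (fun _ : Fin n => P) i).lintegral_comp (hf i)

theorem pi_withDensity {n : ℕ} (P : Measure S) [IsProbabilityMeasure P] {ρ : S → ℝ≥0∞}
    (hρ : Measurable ρ) [IsProbabilityMeasure (P.withDensity ρ)] :
    Measure.pi (fun _ : Fin n => P.withDensity ρ)
      = (Measure.pi fun _ : Fin n => P).withDensity fun t => ∏ i, ρ (t i) := by
  classical
  refine Measure.pi_eq fun s hs => ?_
  rw [withDensity_apply _ (MeasurableSet.univ_pi hs),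
    ← lintegral_indicator (MeasurableSet.univ_pi hs)]
  have e : ∀ t : Fin n → S, (Set.univ.pi s).indicator (fun t => ∏ i, ρ (t i)) t
      = ∏ i, (s i).indicator ρ (t i) := by
    intro t
    by_cases ht : t ∈ Set.univ.pi s
    · rw [Set.indicator_of_mem ht]
      exact Finset.prod_congr rfl fun i _ => by rw [Set.indicator_of_mem (ht i (Set.mem_univ i))]
    · rw [Set.indicator_of_notMem ht]
      simp only [Set.mem_pi, Set.mem_univ, forall_const, not_forall] at ht
      obtain ⟨i, hi⟩ := ht
      exact (Finset.prod_eq_zero (Finset.mem_univ i) (Set.indicator_of_notMem hi _)).symm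
  simp only [e]
  rw [lintegral_pi_prod_eq_pow P _ fun i => hρ.indicator (hs i)]
  refine Finset.prod_congr rfl fun i _ => ?_
  rw [lintegral_indicator (hs i), withDensity_apply _ (hs i)]

theorem twelve_mul_le (r : ℝ≥0∞) (hr : r ≠ ∞) : 12 * r ≤ 8 * min 1 r + 1 + 4 * r ^ 2 := by
  lift r to NNReal using hr
  have h : (12 : ℝ) * r ≤ 8 * min 1 (r : ℝ) + 1 + 4 * (r : ℝ) ^ 2 := by
    rcases le_total (r : ℝ) 1 with h | h
    · rw [min_eq_right h]
      nlinarith [sq_nonneg (2 * (r : ℝ) - 1)]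
    · rw [min_eq_left h]
      nlinarith [sq_nonneg (2 * (r : ℝ) - 3)]
  exact_mod_cast h

/-- Le Cam's two point bound, for two laws of small `χ²` divergence. -/
theorem le_lintegral_add_lintegral_withDensity {P : Measure S} [IsProbabilityMeasure P]
    {ρ : S → ℝ≥0∞} (hρ : Measurable ρ) (hρ' : ∀ t, ρ t ≠ ∞)
    [IsProbabilityMeasure (P.withDensity ρ)] (h2 : ∫⁻ t, ρ t ^ 2 ∂P ≤ 5 / 4) {f g : S → ℝ≥0∞}
    (hf : Measurable f) (hg : Measurable g) {c : ℝ≥0∞} (h : ∀ t, c ≤ f t + g t) :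
    c / 2 ≤ ∫⁻ t, f t ∂P + ∫⁻ t, g t ∂(P.withDensity ρ) := by
  have h1 : ∫⁻ t, ρ t ∂P = 1 := by
    have := measure_univ (μ := P.withDensity ρ)
    rwa [withDensity_apply _ MeasurableSet.univ, setLIntegral_univ] at this
  have hmin : (1 : ℝ≥0∞) / 2 ≤ ∫⁻ t, min 1 (ρ t) ∂P := by
    have hm : Measurable fun t => min 1 (ρ t) := measurable_const.min hρ
    have h3 : (12 : ℝ≥0∞) ≤ 8 * ∫⁻ t, min 1 (ρ t) ∂P + 1 + 4 * (5 / 4) := by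
      calc (12 : ℝ≥0∞) = ∫⁻ t, 12 * ρ t ∂P := by rw [lintegral_const_mul _ hρ, h1, mul_one]
        _ ≤ ∫⁻ t, (8 * min 1 (ρ t) + 1 + 4 * ρ t ^ 2) ∂P :=
            lintegral_mono fun t => twelve_mul_le _ (hρ' t)
        _ = 8 * ∫⁻ t, min 1 (ρ t) ∂P + 1 + 4 * ∫⁻ t, ρ t ^ 2 ∂P := by
            rw [lintegral_add_right _ ((hρ.pow_const 2).const_mul 4),
              lintegral_add_right _ measurable_const, lintegral_const_mul _ hm,
              lintegral_const_mul _ (hρ.pow_const 2), lintegral_const, measure_univ, mul_one]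
        _ ≤ _ := by gcongr
    have hfin : ∫⁻ t, min 1 (ρ t) ∂P ≠ ∞ := by
      refine ne_top_of_le_ne_top ENNReal.one_ne_top ((lintegral_mono fun t =>
        min_le_left 1 (ρ t)).trans (by simp))
    generalize ∫⁻ t, min 1 (ρ t) ∂P = z at hfin h3 ⊢
    lift z to NNReal using hfin
    have h4 : (4 : ℝ≥0∞) * (5 / 4) = 5 :=
      ENNReal.mul_div_cancel (by norm_num) (by norm_num)
    rw [h4] at h3
    have h5 : (12 : ℝ) ≤ 8 * (z : ℝ) + 1 + 5 := by exact_mod_cast h3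
    rw [ENNReal.div_le_iff (by norm_num) (by norm_num)]
    have : (1 : ℝ) ≤ z * 2 := by linarith
    exact_mod_cast this
  have hmul : Measurable fun t => ρ t * g t := hρ.mul hg
  calc c / 2 = c * (1 / 2) := by rw [mul_one_div]
    _ ≤ c * ∫⁻ t, min 1 (ρ t) ∂P := by gcongr
    _ = ∫⁻ t, c * min 1 (ρ t) ∂P := (lintegral_const_mul _ (measurable_const.min hρ)).symm
    _ ≤ ∫⁻ t, (f t + ρ t * g t) ∂P := by
        refine lintegral_mono fun t => ?_
        calc c * min 1 (ρ t) ≤ (f t + g t) * min 1 (ρ t) := by gcongr; exact h t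
          _ = f t * min 1 (ρ t) + g t * min 1 (ρ t) := add_mul _ _ _
          _ ≤ f t * 1 + g t * ρ t := by
              gcongr
              · exact min_le_left _ _
              · exact min_le_right _ _
          _ = f t + ρ t * g t := by rw [mul_one, mul_comm]
    _ = ∫⁻ t, f t ∂P + ∫⁻ t, g t ∂(P.withDensity ρ) := by
        rw [lintegral_add_left hf, lintegral_withDensity_eq_lintegral_mul _ hρ hg]
        rfl

/-- The sign encoded by a Boolean. -/
def boolSign (b : Bool) : ℝ := if b then 1 else -1

theorem abs_boolSign (b : Bool) : |boolSign b| = 1 := by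
  cases b <;> simp [boolSign]

theorem boolSign_not (b : Bool) : boolSign (!b) = -boolSign b := by
  cases b <;> simp [boolSign]

theorem pow_one_add_le {n : ℕ} (hn : 0 < n) : (1 + 1 / (5 * (n : ℝ))) ^ n ≤ 5 / 4 := by
  have hn' : (0 : ℝ) < n := Nat.cast_pos.2 hn
  calc (1 + 1 / (5 * (n : ℝ))) ^ n ≤ (Real.exp (1 / (5 * (n : ℝ)))) ^ n := by
        gcongr
        linarith [Real.add_one_le_exp (1 / (5 * (n : ℝ)))]
    _ = Real.exp (1 / 5) := by
        rw [← Real.exp_nat_mul]; congr 1; field_simp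
    _ ≤ 1 / (1 - 1 / 5) := Real.exp_bound_div_one_sub_of_interval (by norm_num) (by norm_num)
    _ = 5 / 4 := by norm_num

/-- Assouad's lemma for `n` independent observations, with the signs `ω` recovered from the values
of `T`. -/
theorem assouad {Q : Type*} [Fintype Q] [DecidableEq Q] {n : ℕ} (hn : 0 < n)
    (P : (Q → Bool) → Measure S) [∀ ω, IsProbabilityMeasure (P ω)] (T : Q → (Fin n → S) → ℝ)
    (hT : ∀ q, Measurable (T q)) {Δ : ℝ}
    (h : ∀ ω q, ∃ ρ : S → ℝ≥0∞, Measurable ρ ∧ (∀ t, ρ t ≠ ∞) ∧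
      P (Function.update ω q (!ω q)) = (P ω).withDensity ρ ∧
      ∫⁻ t, ρ t ^ 2 ∂(P ω) ≤ ENNReal.ofReal (1 + 1 / (5 * (n : ℝ)))) :
    Fintype.card (Q → Bool) * (Fintype.card Q * ENNReal.ofReal (Δ / 2))
      ≤ ∑ ω, ∫⁻ t, ∑ q, ENNReal.ofReal |boolSign (ω q) * Δ - T q t|
          ∂(Measure.pi fun _ : Fin n => P ω) := by
  have hm : ∀ (ω : Q → Bool) q, Measurable fun t : Fin n → S =>
      ENNReal.ofReal |boolSign (ω q) * Δ - T q t| := fun ω q =>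
    (measurable_const.sub (hT q)).abs.ennreal_ofReal
  set F : Q → (Q → Bool) → ℝ≥0∞ := fun q ω =>
    ∫⁻ t, ENNReal.ofReal |boolSign (ω q) * Δ - T q t| ∂(Measure.pi fun _ : Fin n => P ω) with hF
  have hpair : ∀ q ω, ENNReal.ofReal Δ ≤ F q ω + F q (Function.update ω q (!ω q)) := by
    intro q ω
    obtain ⟨ρ, hρ, hρ', hPρ, h2⟩ := h ω q
    have hprob : IsProbabilityMeasure ((P ω).withDensity ρ) := hPρ ▸ inferInstance
    simp only [hF, hPρ, Function.update_self, boolSign_not]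
    rw [pi_withDensity _ hρ]
    have hprob' : IsProbabilityMeasure ((Measure.pi fun _ : Fin n => P ω).withDensity
        fun t => ∏ i, ρ (t i)) := by
      rw [← pi_withDensity _ hρ]; infer_instance
    have hsq : ∫⁻ t, (∏ i, ρ (t i)) ^ 2 ∂(Measure.pi fun _ : Fin n => P ω) ≤ 5 / 4 := by
      simp only [← Finset.prod_pow]
      rw [lintegral_pi_prod_eq_pow (P ω) (fun _ x => ρ x ^ 2) fun _ => hρ.pow_const 2,
        Finset.prod_const, Finset.card_univ, Fintype.card_fin]
      calc (∫⁻ x, ρ x ^ 2 ∂(P ω)) ^ n ≤ ENNReal.ofReal (1 + 1 / (5 * (n : ℝ))) ^ n := by gcongr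
        _ = ENNReal.ofReal ((1 + 1 / (5 * (n : ℝ))) ^ n) :=
            (ENNReal.ofReal_pow (by positivity) n).symm
        _ ≤ ENNReal.ofReal (5 / 4) := ENNReal.ofReal_le_ofReal (pow_one_add_le hn)
        _ = 5 / 4 := by
            rw [ENNReal.ofReal_div_of_pos (by norm_num)]; norm_num
    have h3 := le_lintegral_add_lintegral_withDensity (P := Measure.pi fun _ : Fin n => P ω)
      (ρ := fun t => ∏ i, ρ (t i)) (c := ENNReal.ofReal (2 * Δ))
      (f := fun t => ENNReal.ofReal |boolSign (ω q) * Δ - T q t|)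
      (g := fun t => ENNReal.ofReal |-boolSign (ω q) * Δ - T q t|)
      (Finset.measurable_prod _ fun i _ => hρ.comp (measurable_pi_apply i))
      (fun t => ENNReal.prod_ne_top fun i _ => hρ' _) hsq (hm ω q)
      (measurable_const.sub (hT q)).abs.ennreal_ofReal fun t => by
        rw [← ENNReal.ofReal_add (abs_nonneg _) (abs_nonneg _)]
        refine ENNReal.ofReal_le_ofReal ?_
        have h5 : |2 * Δ| = |(boolSign (ω q) * Δ - T q t) - (-boolSign (ω q) * Δ - T q t)| := by
          rw [show (boolSign (ω q) * Δ - T q t) - (-boolSign (ω q) * Δ - T q t)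
            = boolSign (ω q) * (2 * Δ) by ring, abs_mul (boolSign (ω q)), abs_boolSign, one_mul]
        exact (le_abs_self _).trans (h5.le.trans (abs_sub _ _))
    rwa [show ENNReal.ofReal (2 * Δ) / 2 = ENNReal.ofReal Δ by
      rw [ENNReal.ofReal_mul (by norm_num), mul_comm, ENNReal.ofReal_ofNat]
      exact ENNReal.mul_div_cancel_right (by norm_num) (by norm_num)] at h3
  have hsum : ∀ q, Fintype.card (Q → Bool) * ENNReal.ofReal (Δ / 2) ≤ ∑ ω, F q ω := by
    intro q
    have hinv : Function.Involutive fun ω : Q → Bool => Function.update ω q (!ω q) := by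
      intro ω
      simp
    have h1 : ∑ ω, F q (Function.update ω q (!ω q)) = ∑ ω, F q ω :=
      Equiv.sum_comp hinv.toPerm (F q)
    have h2 : Fintype.card (Q → Bool) * ENNReal.ofReal Δ ≤ 2 * ∑ ω, F q ω := by
      calc (Fintype.card (Q → Bool) : ℝ≥0∞) * ENNReal.ofReal Δ
          = ∑ _ω : Q → Bool, ENNReal.ofReal Δ := by
            rw [Finset.sum_const, nsmul_eq_mul, Finset.card_univ]
        _ ≤ ∑ ω, (F q ω + F q (Function.update ω q (!ω q))) :=
            Finset.sum_le_sum fun ω _ => hpair q ω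
        _ = 2 * ∑ ω, F q ω := by rw [Finset.sum_add_distrib, h1, two_mul]
    rw [ENNReal.ofReal_div_of_pos (by norm_num), ENNReal.ofReal_ofNat, ← mul_div_assoc]
    exact ENNReal.div_le_of_le_mul' h2
  calc (Fintype.card (Q → Bool) : ℝ≥0∞) * (Fintype.card Q * ENNReal.ofReal (Δ / 2))
      = ∑ _q : Q, Fintype.card (Q → Bool) * ENNReal.ofReal (Δ / 2) := by
        rw [Finset.sum_const, nsmul_eq_mul, Finset.card_univ]; ring
    _ ≤ ∑ q, ∑ ω, F q ω := Finset.sum_le_sum fun q _ => hsum q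
    _ = _ := by
        rw [Finset.sum_comm]
        refine Finset.sum_congr rfl fun ω _ => ?_
        rw [lintegral_finsetSum _ fun q _ => hm ω q]

end

/-! ### Grids -/

section

theorem norm_le_of_abs_coord_le {D : ℕ} {c : ℝ} (hc : 0 ≤ c) {x : Euc D} (h : ∀ i, |x i| ≤ c) :
    ‖x‖ ≤ D * c := by
  refine abs_le_of_sq_le_sq' ?_ (by positivity) |>.2
  rw [EuclideanSpace.norm_sq_eq]
  calc ∑ i, ‖x i‖ ^ 2 ≤ ∑ _i : Fin D, c ^ 2 :=
        Finset.sum_le_sum fun i _ => pow_le_pow_left₀ (norm_nonneg _) (h i) 2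
    _ = D * c ^ 2 := by simp
    _ ≤ (D * c) ^ 2 := by
        rw [mul_pow]
        gcongr
        exact_mod_cast Nat.le_self_pow two_ne_zero D

/-- The points with coordinates in `{0, 1 / m, …, (m - 1) / m}` of the `d`-dimensional coordinate
subspace of `ℝ^D`. -/
noncomputable def gridPt (D d m : ℕ) (j : Fin d → Fin m) : Euc D :=
  WithLp.toLp 2 fun i => if h : i.val < d then ((j ⟨i, h⟩ : ℕ) : ℝ) / m else 0

variable {D d m : ℕ}

theorem gridPt_apply (j : Fin d → Fin m) (i : Fin D) :
    gridPt D d m j i = if h : i.val < d then ((j ⟨i, h⟩ : ℕ) : ℝ) / m else 0 := rfl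

theorem gridPt_nonneg (j : Fin d → Fin m) (i : Fin D) : 0 ≤ gridPt D d m j i := by
  rw [gridPt_apply]; split_ifs <;> positivity

theorem gridPt_le_one (j : Fin d → Fin m) (i : Fin D) : gridPt D d m j i ≤ 1 := by
  rw [gridPt_apply]
  split_ifs with h
  · refine div_le_one_of_le₀ ?_ (Nat.cast_nonneg m)
    exact Nat.cast_le.2 (j ⟨i, h⟩).2.le
  · exact zero_le_one

theorem norm_gridPt_le (j : Fin d → Fin m) : ‖gridPt D d m j‖ ≤ D := by
  have := norm_le_of_abs_coord_le zero_le_one (x := gridPt D d m j) fun i => by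
    rw [abs_of_nonneg (gridPt_nonneg j i)]; exact gridPt_le_one j i
  simpa using this

theorem le_norm_gridPt_sub (hd : d ≤ D) {j j' : Fin d → Fin m} (h : j ≠ j') :
    (m : ℝ)⁻¹ ≤ ‖gridPt D d m j - gridPt D d m j'‖ := by
  obtain ⟨i, hi⟩ := Function.ne_iff.1 h
  have h1 := PiLp.norm_apply_le (gridPt D d m j - gridPt D d m j') (Fin.castLE hd i)
  refine le_trans ?_ h1
  have hm : (0 : ℝ) < m := by
    have := (j i).pos
    exact_mod_cast this
  have hlt : (Fin.castLE hd i).val < d := i.2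
  rw [PiLp.sub_apply, gridPt_apply, gridPt_apply, dif_pos hlt, dif_pos hlt, ← sub_div,
    Real.norm_eq_abs, abs_div, abs_of_pos hm, inv_eq_one_div]
  gcongr
  have h2 : ((j i : ℕ) : ℤ) - ((j' i : ℕ) : ℤ) ≠ 0 := by
    rw [sub_ne_zero]
    exact_mod_cast fun h0 => hi (Fin.ext h0)
  have h3 := Int.one_le_abs h2
  exact_mod_cast h3

/-- The grid in a `d`-dimensional subspace has Minkowski dimension at most `d`, with a constant that
does not depend on its mesh: two grid points in the same cell are close to each other. -/
theorem minkowskiDimAtMost_range_gridPt (hd : d ≤ D) {L : ℝ} (hL1 : (D : ℝ) < L)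
    (hL2 : (2 * ((D : ℝ) + 1)) ^ d ≤ L) :
    MinkowskiDimAtMost D d L (Set.range (gridPt D d m)) := by
  refine ⟨?_, fun ε hε hε1 P hP hsep => ?_⟩
  · rintro _ ⟨j, rfl⟩
    exact mem_ball_zero_iff.2 ((norm_gridPt_le j).trans_lt hL1)
  set η := ε / (D + 1) with hη
  have hD : (0 : ℝ) < D + 1 := by positivity
  have hη0 : 0 < η := by positivity
  have hη1 : η ≤ 1 := (div_le_one hD).2 (by linarith [(Nat.cast_nonneg D : (0 : ℝ) ≤ D)])
  set f : Euc D → (Fin d → ℕ) := fun x i => ⌊x (Fin.castLE hd i) / η⌋₊ with hf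
  have hmaps : ∀ x ∈ P, f x ∈ Fintype.piFinset fun _ : Fin d => Finset.range (⌊1 / η⌋₊ + 1) := by
    intro x hx
    obtain ⟨j, rfl⟩ := hP hx
    rw [Fintype.mem_piFinset]
    intro i
    rw [Finset.mem_range, Nat.lt_succ_iff]
    refine Nat.floor_le_floor ?_
    have := gridPt_le_one (D := D) j (Fin.castLE hd i)
    gcongr
  have hinj : Set.InjOn f P := by
    intro x hx x' hx' hff
    by_contra hne
    have h1 := hsep x hx x' hx' hne
    obtain ⟨j, rfl⟩ := hP hx
    obtain ⟨j', rfl⟩ := hP hx'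
    have h2 : ‖gridPt D d m j - gridPt D d m j'‖ ≤ D * η := by
      refine norm_le_of_abs_coord_le hη0.le fun i => ?_
      rw [PiLp.sub_apply]
      by_cases hi : i.val < d
      · have h3 : ⌊gridPt D d m j i / η⌋₊ = ⌊gridPt D d m j' i / η⌋₊ := congrFun hff ⟨i, hi⟩
        have h4 := Nat.floor_le (div_nonneg (gridPt_nonneg j i) hη0.le)
        have h5 := Nat.lt_floor_add_one (gridPt D d m j i / η)
        have h6 := Nat.floor_le (div_nonneg (gridPt_nonneg j' i) hη0.le)
        have h7 := Nat.lt_floor_add_one (gridPt D d m j' i / η)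
        rw [h3] at h4 h5
        rw [le_div_iff₀ hη0] at h4 h6
        rw [div_lt_iff₀ hη0] at h5 h7
        rw [abs_le]
        constructor <;> nlinarith
      · rw [gridPt_apply, gridPt_apply, dif_neg hi, dif_neg hi, sub_zero, abs_zero]
        exact hη0.le
    have h3 : D * η < ε := by
      rw [hη, mul_div_assoc', div_lt_iff₀ hD]
      nlinarith
    linarith
  have hcard := Finset.card_le_card_of_injOn f hmaps hinj
  rw [Fintype.card_piFinset_const, Finset.card_range] at hcard
  have h1 : ((⌊1 / η⌋₊ : ℝ) + 1) ≤ 2 * (D + 1) * ε⁻¹ := by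
    have h2 := Nat.floor_le (a := 1 / η) (by positivity)
    have h3 : 1 ≤ 1 / η := (one_le_div hη0).2 hη1
    have h4 : 2 * ((D : ℝ) + 1) * ε⁻¹ = 1 / η + 1 / η := by rw [hη]; field_simp; ring
    linarith
  calc (P.card : ℝ) ≤ ((⌊1 / η⌋₊ : ℝ) + 1) ^ d := by
        have : (P.card : ℝ) ≤ (((⌊1 / η⌋₊ + 1) ^ d : ℕ) : ℝ) := by exact_mod_cast hcard
        simpa using this
    _ ≤ (2 * (D + 1) * ε⁻¹) ^ d := by gcongr
    _ = (2 * ((D : ℝ) + 1)) ^ d * ε ^ (-(d : ℝ)) := by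
        rw [mul_pow, Real.rpow_neg hε.le, Real.rpow_natCast, inv_pow]
    _ ≤ _ := by gcongr

/-- The uniform distribution on the grid. -/
noncomputable def gridMeasure (D d m : ℕ) : Measure (Euc D) :=
  ((m : ℝ≥0∞) ^ d)⁻¹ • ∑ j : Fin d → Fin m, Measure.dirac (gridPt D d m j)

theorem lintegral_gridMeasure (f : Euc D → ℝ≥0∞) :
    ∫⁻ x, f x ∂(gridMeasure D d m) = ((m : ℝ≥0∞) ^ d)⁻¹ * ∑ j, f (gridPt D d m j) := by
  unfold gridMeasure
  rw [lintegral_smul_measure, lintegral_finsetSum_measure, smul_eq_mul]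
  simp only [lintegral_dirac]

theorem isProbabilityMeasure_gridMeasure (hm : 0 < m) :
    IsProbabilityMeasure (gridMeasure D d m) := by
  constructor
  rw [← lintegral_one, lintegral_gridMeasure]
  simp only [Finset.sum_const, Finset.card_univ, Fintype.card_pi, Fintype.card_fin,
    Finset.prod_const, nsmul_eq_mul, mul_one, Nat.cast_pow]
  refine ENNReal.inv_mul_cancel (pow_ne_zero _ (by exact_mod_cast hm.ne')) ?_
  exact ENNReal.pow_ne_top (ENNReal.natCast_ne_top m)

theorem support_gridMeasure_subset : (gridMeasure D d m).support ⊆ Set.range (gridPt D d m) := by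
  have hfin : (Set.range (gridPt D d m)).Finite := Set.finite_range _
  refine Measure.support_subset_of_isClosed hfin.isClosed ?_
  rw [mem_ae_iff, ← lintegral_indicator_one hfin.measurableSet.compl, lintegral_gridMeasure]
  simp

/-! ### The perturbed densities -/

/-- A density on `ℝ^D_Y` that is constant on a large ball, and bumps in the response and in the
covariate. Perturbing by bumps of integral zero preserves the total mass. -/
structure Perturbation (DY DX : ℕ) where
  φ : Euc DX → ℝ
  ψ : Euc DY → ℝ
  u₀ : Euc DY → ℝ
  b : ℝ
  contDiff_φ : ContDiff ℝ (⊤ : ℕ∞) φ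
  tsupport_φ : tsupport φ ⊆ Metric.closedBall 0 (1 / 3)
  φ_zero : φ 0 = 1
  abs_φ_le : ∀ x, |φ x| ≤ 1
  contDiff_ψ : ContDiff ℝ (⊤ : ℕ∞) ψ
  tsupport_ψ : tsupport ψ ⊆ Metric.closedBall 0 (1 / 3)
  abs_ψ_le : ∀ y, |ψ y| ≤ 1
  integral_ψ : ∫ y, ψ y = 0
  integral_ψ_sq_pos : 0 < ∫ y, ψ y ^ 2
  contDiff_u₀ : ContDiff ℝ (⊤ : ℕ∞) u₀
  u₀_nonneg : ∀ y, 0 ≤ u₀ y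
  u₀_eq_zero : ∀ y, (DY : ℝ) + 2 < ‖y‖ → u₀ y = 0
  u₀_eq : ∀ y, ‖y‖ ≤ (DY : ℝ) + 1 → u₀ y = b
  b_pos : 0 < b
  integral_u₀ : ∫ y, u₀ y = 1

theorem nonempty_perturbation {DY : ℕ} (hDY : 1 ≤ DY) (DX : ℕ) : Nonempty (Perturbation DY DX) := by
  let χ : ContDiffBump (0 : Euc DX) := ⟨1 / 6, 1 / 3, by norm_num, by norm_num⟩
  let θ : ContDiffBump (0 : Euc DY) := ⟨1 / 6, 1 / 3, by norm_num, by norm_num⟩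
  let w : ContDiffBump (0 : Euc DY) :=
    ⟨(DY : ℝ) + 1, (DY : ℝ) + 2, by positivity, by linarith⟩
  let i₀ : Fin DY := ⟨0, hDY⟩
  have hcoord : ContDiff ℝ (⊤ : ℕ∞) fun y : Euc DY => y i₀ :=
    (EuclideanSpace.proj (𝕜 := ℝ) i₀).contDiff
  have hψ : ContDiff ℝ (⊤ : ℕ∞) fun y : Euc DY => y i₀ * θ y := hcoord.mul θ.contDiff
  have hts : tsupport (fun y : Euc DY => y i₀ * θ y) ⊆ Metric.closedBall 0 (1 / 3) := by
    rw [← θ.tsupport_eq]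
    exact closure_mono (Function.support_mul_subset_right _ _)
  refine ⟨⟨χ, fun y => y i₀ * θ y, w.normed volume, 1 / ∫ y, w y, χ.contDiff,
    χ.tsupport_eq.le, χ.one_of_mem_closedBall (by simp [χ]), fun x => ?_, hψ, hts, fun y => ?_, ?_,
    ?_, w.contDiff_normed, w.nonneg_normed, fun y hy => ?_, fun y hy => ?_,
    one_div_pos.2 w.integral_pos, w.integral_normed⟩⟩
  · rw [abs_of_nonneg χ.nonneg]
    exact χ.le_one
  · by_cases hy : y ∈ Metric.closedBall (0 : Euc DY) (1 / 3)
    · rw [abs_mul, abs_of_nonneg θ.nonneg]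
      have h1 : |y i₀| ≤ 1 := by
        have := PiLp.norm_apply_le y i₀
        rw [Real.norm_eq_abs] at this
        linarith [mem_closedBall_zero_iff.1 hy]
      exact mul_le_one₀ h1 θ.nonneg θ.le_one
    · have h0 : y i₀ * θ y = 0 := image_eq_zero_of_notMem_tsupport
        (f := fun y : Euc DY => y i₀ * θ y) fun h => hy (hts h)
      simp [h0]
  · have h1 := integral_neg_eq_self (fun y : Euc DY => y i₀ * θ y) volume
    simp only [PiLp.neg_apply, θ.neg, neg_mul] at h1
    rw [integral_neg] at h1
    linarith
  · have hc : HasCompactSupport fun y : Euc DY => (y i₀ * θ y) ^ 2 := by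
      have h1 : HasCompactSupport fun y : Euc DY => y i₀ * θ y :=
        θ.hasCompactSupport.mul_left
      have e : (fun y : Euc DY => (y i₀ * θ y) ^ 2)
          = (fun y : Euc DY => y i₀ * θ y) * fun y : Euc DY => y i₀ * θ y := by
        funext y
        rw [Pi.mul_apply, pow_two]
      rw [e]
      exact h1.mul_left
    refine (hψ.continuous.pow 2).integral_pos_of_hasCompactSupport_nonneg_nonzero hc
      (fun y => sq_nonneg _) (x := EuclideanSpace.single i₀ (1 / 6)) ?_
    have h1 : θ (EuclideanSpace.single i₀ (1 / 6)) = 1 := θ.one_of_mem_closedBall (by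
      rw [mem_closedBall_zero_iff, PiLp.norm_single]
      norm_num [θ])
    change (EuclideanSpace.single i₀ (1 / 6 : ℝ) i₀ * θ (EuclideanSpace.single i₀ (1 / 6))) ^ 2 ≠ 0
    rw [h1]
    simp
  · have : w y = 0 := w.zero_of_le_dist (by rw [dist_zero_right]; exact hy.le)
    rw [w.normed_def, this, zero_div]
  · rw [w.normed_def, w.one_of_mem_closedBall (mem_closedBall_zero_iff.2 hy)]

end

section

theorem integral_bump {d : ℕ} (F : Euc d → ℝ) {h : ℝ} (hh : 0 < h) (q : Euc d) :
    ∫ y, F (h⁻¹ • (y - q)) = h ^ d * ∫ y, F y := by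
  rw [integral_sub_right_eq_self (fun y => F (h⁻¹ • y)) q, Measure.integral_comp_smul,
    finrank_euclideanSpace_fin, smul_eq_mul, inv_pow, inv_inv, abs_of_pos (by positivity)]

namespace Perturbation

variable {DY DX dX m m' : ℕ} (S : Perturbation DY DX)

/-- The bump at the grid point of index `k` of the response space. -/
noncomputable def yBump (k : Fin DY → Fin m) (y : Euc DY) : ℝ :=
  S.ψ (((m : ℝ)⁻¹)⁻¹ • (y - gridPt DY DY m k))

/-- The coefficient of the bump `k` of the response, as a function of the covariate. -/
noncomputable def coef (ω : (Fin dX → Fin m') × (Fin DY → Fin m) → Bool) (k : Fin DY → Fin m)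
    (x : Euc DX) : ℝ :=
  bumpSum S.φ (m' : ℝ)⁻¹ (gridPt DX dX m') (fun j => boolSign (ω (j, k))) x

/-- The conditional density perturbed according to the signs `ω`. -/
noncomputable def dens (a : ℝ) (ω : (Fin dX → Fin m') × (Fin DY → Fin m) → Bool)
    (x : Euc DX) (y : Euc DY) : ℝ :=
  S.u₀ y + bumpSum S.ψ (m : ℝ)⁻¹ (gridPt DY DY m) (fun k => a * S.coef ω k x) y

theorem dens_eq (a : ℝ) (ω : (Fin dX → Fin m') × (Fin DY → Fin m) → Bool) (x : Euc DX)
    (y : Euc DY) : S.dens a ω x y = S.u₀ y + ∑ k, a * S.coef ω k x * S.yBump k y := rfl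

/-- The roles of the response and of the covariate in the perturbation are symmetric. -/
theorem dens_eq_bumpSum (a : ℝ) (ω : (Fin dX → Fin m') × (Fin DY → Fin m) → Bool) (x : Euc DX)
    (y : Euc DY) : S.dens a ω x y = S.u₀ y + bumpSum S.φ (m' : ℝ)⁻¹ (gridPt DX dX m')
      (fun j => a * bumpSum S.ψ (m : ℝ)⁻¹ (gridPt DY DY m) (fun k => boolSign (ω (j, k))) y) x := by
  unfold dens coef bumpSum
  congr 1
  simp only [Finset.mul_sum, Finset.sum_mul]
  rw [Finset.sum_comm]
  refine Finset.sum_congr rfl fun j _ => Finset.sum_congr rfl fun k _ => by ring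

theorem inv_pos_of_grid (hm : 0 < m) : (0 : ℝ) < (m : ℝ)⁻¹ := by positivity

theorem inv_le_one_of_grid (hm : 0 < m) : (m : ℝ)⁻¹ ≤ 1 :=
  inv_le_one_of_one_le₀ (by exact_mod_cast hm)

section

variable (k : Fin DY → Fin m)

theorem continuous_yBump : Continuous (S.yBump k) := by
  unfold yBump
  exact (contDiff_bump S.contDiff_ψ _).continuous

theorem abs_yBump_le (y : Euc DY) : |S.yBump k y| ≤ 1 := S.abs_ψ_le _

theorem norm_le_of_yBump_ne_zero {y : Euc DY} (h : S.yBump k y ≠ 0) :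
    ‖((m : ℝ)⁻¹)⁻¹ • (y - gridPt DY DY m k)‖ ≤ 1 / 3 :=
  mem_closedBall_zero_iff.1 (S.tsupport_ψ (subset_tsupport _ h))

theorem norm_le_of_yBump_ne_zero' (hm : 0 < m) {y : Euc DY} (h : S.yBump k y ≠ 0) :
    ‖y‖ ≤ (DY : ℝ) + 1 := by
  have h1 := S.norm_le_of_yBump_ne_zero k h
  have hm0 := inv_pos_of_grid hm
  rw [norm_smul, norm_inv, Real.norm_of_nonneg hm0.le, inv_mul_le_iff₀ hm0] at h1
  have h2 := inv_le_one_of_grid hm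
  have h3 := norm_gridPt_le (D := DY) k
  have h4 : ‖y‖ ≤ ‖y - gridPt DY DY m k‖ + ‖gridPt DY DY m k‖ := by
    have := norm_add_le (y - gridPt DY DY m k) (gridPt DY DY m k)
    rwa [sub_add_cancel] at this
  linarith

theorem yBump_mul_yBump (hm : 0 < m) {k k' : Fin DY → Fin m} (hk : k ≠ k') (y : Euc DY) :
    S.yBump k y * S.yBump k' y = 0 := by
  by_contra h
  exact hk (eq_of_dist_lt (inv_pos_of_grid hm) (fun i j hij => le_norm_gridPt_sub le_rfl hij)
    (S.norm_le_of_yBump_ne_zero k (left_ne_zero_of_mul h))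
    (S.norm_le_of_yBump_ne_zero k' (right_ne_zero_of_mul h)))

theorem integrable_yBump (hm : 0 < m) : Integrable (S.yBump k) := by
  refine (S.continuous_yBump k).integrable_of_hasCompactSupport ?_
  refine HasCompactSupport.intro (isCompact_closedBall (0 : Euc DY) ((DY : ℝ) + 1)) fun y hy => ?_
  by_contra h
  exact hy (mem_closedBall_zero_iff.2 (S.norm_le_of_yBump_ne_zero' k hm h))

theorem integrable_yBump_sq (hm : 0 < m) : Integrable fun y => S.yBump k y ^ 2 := by
  have := (S.integrable_yBump k hm).mul_bdd (c := 1)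
    (S.continuous_yBump k).aestronglyMeasurable
    (Filter.Eventually.of_forall fun y => S.abs_yBump_le k y)
  simpa [pow_two] using this

theorem integral_yBump (hm : 0 < m) : ∫ y, S.yBump k y = 0 := by
  unfold yBump
  rw [integral_bump S.ψ (inv_pos_of_grid hm), S.integral_ψ, mul_zero]

theorem integral_yBump_sq (hm : 0 < m) :
    ∫ y, S.yBump k y ^ 2 = ((m : ℝ)⁻¹) ^ DY * ∫ y, S.ψ y ^ 2 := by
  unfold yBump
  exact integral_bump (fun y => S.ψ y ^ 2) (inv_pos_of_grid hm) _

end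

theorem integrable_u₀ : Integrable S.u₀ := by
  by_contra h
  have := S.integral_u₀
  rw [integral_undef h] at this
  exact zero_ne_one this

variable {a : ℝ} (ω : (Fin dX → Fin m') × (Fin DY → Fin m) → Bool)

theorem continuous_coef (k : Fin DY → Fin m) : Continuous (S.coef ω k) :=
  (contDiff_bumpSum S.contDiff_φ _).continuous

theorem abs_coef_le (hdX : dX ≤ DX) (hm' : 0 < m') (k : Fin DY → Fin m) (x : Euc DX) :
    |S.coef ω k x| ≤ 1 := by
  have := abs_bumpSum_le S.tsupport_φ (inv_pos_of_grid hm')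
    (fun i j hij => le_norm_gridPt_sub hdX hij) zero_le_one
    (c := fun j => boolSign (ω (j, k))) (fun j => (abs_boolSign _).le) S.abs_φ_le x
  rwa [one_mul] at this

theorem coef_gridPt (hdX : dX ≤ DX) (hm' : 0 < m') (k : Fin DY → Fin m) (j : Fin dX → Fin m') :
    S.coef ω k (gridPt DX dX m' j) = boolSign (ω (j, k)) := by
  unfold coef bumpSum
  rw [Finset.sum_eq_single j]
  · rw [sub_self, smul_zero, S.φ_zero, mul_one]
  · intro i _ hij
    have h0 : S.φ (((m' : ℝ)⁻¹)⁻¹ • (gridPt DX dX m' j - gridPt DX dX m' i)) = 0 := by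
      by_contra h
      refine hij (eq_of_dist_lt (inv_pos_of_grid hm')
        (fun i j hij => le_norm_gridPt_sub hdX hij)
        (mem_closedBall_zero_iff.1 (S.tsupport_φ (subset_tsupport _ h))) ?_)
      rw [sub_self, smul_zero, norm_zero]
      norm_num
    rw [h0, mul_zero]
  · simp

variable {ω}

theorem abs_sum_coef_le (hdX : dX ≤ DX) (hm : 0 < m) (hm' : 0 < m') (ha : 0 ≤ a) (x : Euc DX)
    (y : Euc DY) : |∑ k, a * S.coef ω k x * S.yBump k y| ≤ a := by
  have := abs_bumpSum_le S.tsupport_ψ (inv_pos_of_grid hm)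
    (fun i j hij => le_norm_gridPt_sub le_rfl hij) ha (c := fun k => a * S.coef ω k x)
    (fun k => by
      rw [abs_mul, abs_of_nonneg ha]
      exact mul_le_of_le_one_right ha (S.abs_coef_le ω hdX hm' k x)) S.abs_ψ_le y
  rwa [mul_one] at this

theorem half_le_dens (hdX : dX ≤ DX) (hm : 0 < m) (hm' : 0 < m') (ha : 0 ≤ a) (hab : a ≤ S.b / 2)
    (x : Euc DX) {y : Euc DY} {k : Fin DY → Fin m} (h : S.yBump k y ≠ 0) :
    S.b / 2 ≤ S.dens a ω x y := by
  rw [dens_eq, S.u₀_eq y (S.norm_le_of_yBump_ne_zero' k hm h)]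
  have := (abs_le.1 (S.abs_sum_coef_le (ω := ω) hdX hm hm' ha x y)).1
  linarith

theorem dens_of_forall {x : Euc DX} {y : Euc DY} (h : ∀ k : Fin DY → Fin m, S.yBump k y = 0) :
    S.dens a ω x y = S.u₀ y := by
  rw [dens_eq]
  simp [h]

theorem dens_nonneg (hdX : dX ≤ DX) (hm : 0 < m) (hm' : 0 < m') (ha : 0 ≤ a) (hab : a ≤ S.b / 2)
    (x : Euc DX) (y : Euc DY) : 0 ≤ S.dens a ω x y := by
  by_cases h : ∀ k : Fin DY → Fin m, S.yBump k y = 0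
  · rw [S.dens_of_forall h]
    exact S.u₀_nonneg y
  · push Not at h
    obtain ⟨k, hk⟩ := h
    have := S.half_le_dens (ω := ω) hdX hm hm' ha hab x hk
    linarith [S.b_pos]

theorem continuous_uncurry_dens : Continuous (Function.uncurry (S.dens a ω)) := by
  have h : Function.uncurry (S.dens a ω)
      = fun p : Euc DX × Euc DY => S.u₀ p.2 + ∑ k, a * S.coef ω k p.1 * S.yBump k p.2 := by
    funext p; rfl
  rw [h]
  refine (S.contDiff_u₀.continuous.comp continuous_snd).add
    (continuous_finsetSum _ fun k _ => ?_)
  exact (continuous_const.mul ((S.continuous_coef ω k).comp continuous_fst)).mul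
    ((S.continuous_yBump k).comp continuous_snd)

theorem measurable_dens (x : Euc DX) : Measurable (S.dens a ω x) :=
  (S.continuous_uncurry_dens.comp (Continuous.prodMk_right x)).measurable

theorem integrable_dens (hm : 0 < m) (x : Euc DX) : Integrable (S.dens a ω x) := by
  have : S.dens a ω x = fun y => S.u₀ y + ∑ k, a * S.coef ω k x * S.yBump k y := rfl
  rw [this]
  exact S.integrable_u₀.add (integrable_finsetSum _ fun k _ =>
    (S.integrable_yBump k hm).const_mul _)

theorem integral_dens (hm : 0 < m) (x : Euc DX) : ∫ y, S.dens a ω x y = 1 := by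
  simp only [dens_eq]
  rw [integral_add S.integrable_u₀ (integrable_finsetSum _ fun k _ =>
    (S.integrable_yBump k hm).const_mul _), S.integral_u₀, integral_finsetSum _ fun k _ =>
    (S.integrable_yBump k hm).const_mul _]
  simp only [integral_const_mul, S.integral_yBump _ hm, mul_zero, Finset.sum_const_zero, add_zero]

variable (a ω) in
/-- The conditional law of density `S.dens a ω`. -/
noncomputable def kernel : Kernel (Euc DX) (Euc DY) :=
  Kernel.withDensity (Kernel.const _ volume) fun x y => ENNReal.ofReal (S.dens a ω x y)

theorem kernel_apply (x : Euc DX) :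
    S.kernel a ω x = volume.withDensity fun y => ENNReal.ofReal (S.dens a ω x y) := by
  unfold kernel
  rw [Kernel.withDensity_apply _ (S.continuous_uncurry_dens.measurable.ennreal_ofReal),
    Kernel.const_apply]

theorem isMarkovKernel_kernel (hdX : dX ≤ DX) (hm : 0 < m) (hm' : 0 < m') (ha : 0 ≤ a)
    (hab : a ≤ S.b / 2) : IsMarkovKernel (S.kernel a ω) := by
  refine ⟨fun x => ⟨?_⟩⟩
  rw [kernel_apply, withDensity_apply _ MeasurableSet.univ, setLIntegral_univ,
    ← ofReal_integral_eq_lintegral_ofReal (S.integrable_dens hm x)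
      (Filter.Eventually.of_forall fun y => S.dens_nonneg hdX hm hm' ha hab x y),
    S.integral_dens hm, ENNReal.ofReal_one]

theorem integral_kernel (hdX : dX ≤ DX) (hm : 0 < m) (hm' : 0 < m') (ha : 0 ≤ a)
    (hab : a ≤ S.b / 2) (x : Euc DX) (f : Euc DY → ℝ) :
    ∫ y, f y ∂(S.kernel a ω x) = ∫ y, S.dens a ω x y * f y := by
  rw [kernel_apply, integral_withDensity_eq_integral_toReal_smul
    (S.measurable_dens x).ennreal_ofReal
    (Filter.Eventually.of_forall fun y => ENNReal.ofReal_lt_top)]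
  refine integral_congr_ae (Filter.Eventually.of_forall fun y => ?_)
  simp only [smul_eq_mul]
  rw [ENNReal.toReal_ofReal (S.dens_nonneg hdX hm hm' ha hab x y)]

/-- The signs are the normalized mean values of the bumps. -/
theorem integral_yBump_kernel (hdX : dX ≤ DX) (hm : 0 < m) (hm' : 0 < m') (ha : 0 ≤ a)
    (hab : a ≤ S.b / 2) (j : Fin dX → Fin m') (k : Fin DY → Fin m) :
    ∫ y, S.yBump k y ∂(S.kernel a ω (gridPt DX dX m' j))
      = boolSign (ω (j, k)) * (a * (((m : ℝ)⁻¹) ^ DY * ∫ y, S.ψ y ^ 2)) := by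
  rw [S.integral_kernel hdX hm hm' ha hab]
  have e : ∀ y, S.dens a ω (gridPt DX dX m' j) y * S.yBump k y
      = S.b * S.yBump k y + a * boolSign (ω (j, k)) * S.yBump k y ^ 2 := by
    intro y
    by_cases h : S.yBump k y = 0
    · simp [h]
    · rw [dens_eq, S.u₀_eq y (S.norm_le_of_yBump_ne_zero' k hm h), add_mul, Finset.sum_mul,
        Finset.sum_eq_single k, S.coef_gridPt ω hdX hm']
      · ring
      · intro k' _ hk'
        rw [mul_assoc, S.yBump_mul_yBump hm hk', mul_zero]
      · simp
  simp only [e]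
  rw [integral_add ((S.integrable_yBump k hm).const_mul _)
    ((S.integrable_yBump_sq k hm).const_mul _), integral_const_mul, integral_const_mul,
    S.integral_yBump k hm, S.integral_yBump_sq k hm]
  ring

theorem lintegral_compProd_kernel (hdX : dX ≤ DX) (hm : 0 < m) (hm' : 0 < m') (ha : 0 ≤ a)
    (hab : a ≤ S.b / 2) (μ : Measure (Euc DX)) [IsProbabilityMeasure μ]
    {f : Euc DX × Euc DY → ℝ≥0∞} (hf : Measurable f) :
    ∫⁻ p, f p ∂(μ ⊗ₘ S.kernel a ω)
      = ∫⁻ x, (∫⁻ y, ENNReal.ofReal (S.dens a ω x y) * f (x, y)) ∂μ := by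
  have := S.isMarkovKernel_kernel (ω := ω) hdX hm hm' ha hab
  rw [Measure.lintegral_compProd hf]
  refine lintegral_congr fun x => ?_
  have hfx : Measurable fun y => f (x, y) := hf.comp measurable_prodMk_left
  rw [kernel_apply, lintegral_withDensity_eq_lintegral_mul _ (S.measurable_dens x).ennreal_ofReal
    hfx]
  rfl

/-- The joint laws for two sign vectors are mutually absolutely continuous. -/
theorem compProd_kernel_eq_withDensity (hdX : dX ≤ DX) (hm : 0 < m) (hm' : 0 < m') (ha : 0 ≤ a)
    (hab : a ≤ S.b / 2) (μ : Measure (Euc DX)) [IsProbabilityMeasure μ]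
    (ω' : (Fin dX → Fin m') × (Fin DY → Fin m) → Bool) :
    μ ⊗ₘ S.kernel a ω' = (μ ⊗ₘ S.kernel a ω).withDensity fun p =>
      ENNReal.ofReal (S.dens a ω' p.1 p.2 / S.dens a ω p.1 p.2) := by
  have hρ : Measurable fun p : Euc DX × Euc DY =>
      ENNReal.ofReal (S.dens a ω' p.1 p.2 / S.dens a ω p.1 p.2) :=
    (S.continuous_uncurry_dens.measurable.div
      S.continuous_uncurry_dens.measurable).ennreal_ofReal
  refine Measure.ext fun A hA => ?_
  rw [withDensity_apply _ hA, ← lintegral_indicator hA, ← lintegral_indicator_one hA,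
    S.lintegral_compProd_kernel hdX hm hm' ha hab μ (measurable_one.indicator hA),
    S.lintegral_compProd_kernel hdX hm hm' ha hab μ (hρ.indicator hA)]
  refine lintegral_congr fun x => lintegral_congr fun y => ?_
  by_cases hxy : (x, y) ∈ A
  · rw [Set.indicator_of_mem hxy, Set.indicator_of_mem hxy, Pi.one_apply, mul_one,
      ← ENNReal.ofReal_mul (S.dens_nonneg hdX hm hm' ha hab x y)]
    congr 1
    by_cases h0 : S.dens a ω x y = 0
    · -- the densities differ only where both are at least `b / 2`
      have h : ∀ k : Fin DY → Fin m, S.yBump k y = 0 := by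
        intro k
        by_contra h
        have := S.half_le_dens (ω := ω) hdX hm hm' ha hab x h
        linarith [S.b_pos]
      rw [S.dens_of_forall h] at h0 ⊢
      rw [S.dens_of_forall h, h0, zero_mul]
    · exact (mul_div_cancel₀ _ h0).symm
  · rw [Set.indicator_of_notMem hxy, Set.indicator_of_notMem hxy, mul_zero, mul_zero]

/-- The `χ²` divergence of the joint laws of two sign vectors that differ in one entry. -/
theorem lintegral_ratio_sq_le (hdX : dX ≤ DX) (hm : 0 < m) (hm' : 0 < m') (ha : 0 ≤ a)
    (hab : a ≤ S.b / 2) (q : (Fin dX → Fin m') × (Fin DY → Fin m)) :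
    ∫⁻ p, ENNReal.ofReal (S.dens a (Function.update ω q (!ω q)) p.1 p.2 / S.dens a ω p.1 p.2) ^ 2
        ∂(gridMeasure DX dX m' ⊗ₘ S.kernel a ω)
      ≤ ENNReal.ofReal (1 + 8 * a ^ 2 / S.b * (((m : ℝ)⁻¹) ^ DY * ∫ y, S.ψ y ^ 2)
          / (m' : ℝ) ^ dX) := by
  have := isProbabilityMeasure_gridMeasure (D := DX) (d := dX) hm'
  set ω' := Function.update ω q (!ω q) with hω'
  set s := ((m : ℝ)⁻¹) ^ DY * ∫ y, S.ψ y ^ 2 with hs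
  have hs0 : 0 ≤ s := mul_nonneg (by positivity) S.integral_ψ_sq_pos.le
  set E := 8 * a ^ 2 / S.b * s with hE
  have hb := S.b_pos
  have hE0 : 0 ≤ E := by positivity
  have hρ : Measurable fun p : Euc DX × Euc DY =>
      ENNReal.ofReal (S.dens a ω' p.1 p.2 / S.dens a ω p.1 p.2) :=
    (S.continuous_uncurry_dens.measurable.div
      S.continuous_uncurry_dens.measurable).ennreal_ofReal
  rw [S.lintegral_compProd_kernel hdX hm hm' ha hab _ (hρ.pow_const 2), lintegral_gridMeasure]
  -- the inner integral at a grid point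
  have hinner : ∀ i : Fin dX → Fin m',
      ∫⁻ y, ENNReal.ofReal (S.dens a ω (gridPt DX dX m' i) y)
        * ENNReal.ofReal (S.dens a ω' (gridPt DX dX m' i) y
          / S.dens a ω (gridPt DX dX m' i) y) ^ 2
      ≤ ENNReal.ofReal (1 + if i = q.1 then E else 0) := by
    intro i
    set x := gridPt DX dX m' i with hx
    set c : ℝ := a * (S.coef ω' q.2 x - S.coef ω q.2 x) with hc
    have hc2 : c ^ 2 ≤ if i = q.1 then 4 * a ^ 2 else 0 := by
      rw [hc, hx, S.coef_gridPt ω' hdX hm', S.coef_gridPt ω hdX hm', mul_pow]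
      split_ifs with hi
      · have : (i, q.2) = q := by rw [hi]
        rw [this, hω', Function.update_self, boolSign_not]
        have h1 : boolSign (ω q) ^ 2 = 1 := by
          rw [← sq_abs, abs_boolSign, one_pow]
        nlinarith
      · have : (i, q.2) ≠ q := fun h => hi (by rw [← h])
        rw [hω', Function.update_of_ne this]
        simp
    have hdiff : ∀ y, S.dens a ω' x y - S.dens a ω x y = c * S.yBump q.2 y := by
      intro y
      rw [dens_eq, dens_eq, add_sub_add_left_eq_sub, ← Finset.sum_sub_distrib,
        Finset.sum_eq_single q.2]
      · rw [hc]; ring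
      · intro k _ hk
        have : S.coef ω' k x = S.coef ω k x := by
          rw [hx, S.coef_gridPt ω' hdX hm', S.coef_gridPt ω hdX hm', hω',
            Function.update_of_ne fun h => hk (by rw [← h])]
        rw [this, sub_self]
      · simp
    have hpt : ∀ y, S.dens a ω x y * (S.dens a ω' x y / S.dens a ω x y) ^ 2
        ≤ S.dens a ω x y + (2 * c) * S.yBump q.2 y + (2 / S.b * c ^ 2) * S.yBump q.2 y ^ 2 := by
      intro y
      have hd := hdiff y
      have h0 := S.dens_nonneg (ω := ω) hdX hm hm' ha hab x y
      by_cases h : S.yBump q.2 y = 0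
      · rw [h, mul_zero, sub_eq_zero] at hd
        rw [hd, h]
        by_cases h1 : S.dens a ω x y = 0
        · simp [h1]
        · rw [div_self h1]; simp
      · have h1 := S.half_le_dens (ω := ω) hdX hm hm' ha hab x h
        set D := S.dens a ω x y
        have hD : 0 < D := by linarith
        rw [show S.dens a ω' x y = D + c * S.yBump q.2 y by linarith]
        set t := S.yBump q.2 y
        have e : D * ((D + c * t) / D) ^ 2 = D + (2 * c) * t + (c * t) ^ 2 / D := by
          field_simp; ring
        rw [e]
        have h2 : (c * t) ^ 2 / D ≤ (c * t) ^ 2 / (S.b / 2) := by gcongr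
        have h3 : (c * t) ^ 2 / (S.b / 2) = (2 / S.b * c ^ 2) * t ^ 2 := by field_simp
        linarith
    have hi1 := S.integrable_dens (a := a) (ω := ω) hm x
    have hi2 := (S.integrable_yBump q.2 hm).const_mul (2 * c)
    have hi3 := (S.integrable_yBump_sq q.2 hm).const_mul (2 / S.b * c ^ 2)
    calc _ ≤ ∫⁻ y, ENNReal.ofReal (S.dens a ω x y + (2 * c) * S.yBump q.2 y
          + (2 / S.b * c ^ 2) * S.yBump q.2 y ^ 2) := by
          refine lintegral_mono fun y => ?_
          have h0 := S.dens_nonneg (ω := ω) hdX hm hm' ha hab x y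
          have h0' := S.dens_nonneg (ω := ω') hdX hm hm' ha hab x y
          rw [← ENNReal.ofReal_pow (by positivity), ← ENNReal.ofReal_mul h0]
          exact ENNReal.ofReal_le_ofReal (hpt y)
      _ = ENNReal.ofReal (1 + 2 / S.b * c ^ 2 * s) := by
          have h12 : Integrable fun y => S.dens a ω x y + 2 * c * S.yBump q.2 y := hi1.add hi2
          have h123 : Integrable fun y => S.dens a ω x y + (2 * c) * S.yBump q.2 y
              + (2 / S.b * c ^ 2) * S.yBump q.2 y ^ 2 := h12.add hi3
          rw [← ofReal_integral_eq_lintegral_ofReal h123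
            (Filter.Eventually.of_forall fun y => ?_)]
          · congr 1
            rw [integral_add h12 hi3, integral_add hi1 hi2, integral_const_mul,
              integral_const_mul, S.integral_dens hm, S.integral_yBump q.2 hm,
              S.integral_yBump_sq q.2 hm, mul_zero, add_zero]
          · have h0 := S.dens_nonneg (ω := ω) hdX hm hm' ha hab x y
            exact le_trans (by positivity) (hpt y)
      _ ≤ _ := by
          refine ENNReal.ofReal_le_ofReal ?_
          gcongr
          calc 2 / S.b * c ^ 2 * s ≤ 2 / S.b * (if i = q.1 then 4 * a ^ 2 else 0) * s := by gcongr
            _ = _ := by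
              split_ifs
              · rw [hE]; ring
              · ring
  have hM : (0 : ℝ) < (m' : ℝ) ^ dX := by positivity
  calc _ ≤ ((m' : ℝ≥0∞) ^ dX)⁻¹ * ∑ i : Fin dX → Fin m',
        ENNReal.ofReal (1 + if i = q.1 then E else 0) := by
        gcongr with i
        exact hinner i
    _ = ENNReal.ofReal (((m' : ℝ) ^ dX)⁻¹ * ((m' : ℝ) ^ dX + E)) := by
        rw [← ENNReal.ofReal_sum_of_nonneg fun i _ => by split_ifs <;> positivity,
          Finset.sum_add_distrib, Finset.sum_ite_eq' Finset.univ q.1,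
          ENNReal.ofReal_mul (by positivity), ENNReal.ofReal_inv_of_pos hM,
          ENNReal.ofReal_pow (Nat.cast_nonneg _), ENNReal.ofReal_natCast]
        simp
    _ = _ := by
        congr 1
        field_simp

end Perturbation

end

/-! ### The lower bound -/

section

namespace Perturbation

variable {DY DX dX : ℕ} (S : Perturbation DY DX)

theorem hasCompactSupport_u₀ : HasCompactSupport S.u₀ :=
  HasCompactSupport.intro (isCompact_closedBall (0 : Euc DY) ((DY : ℝ) + 2)) fun y hy =>
    S.u₀_eq_zero y (by simpa using hy)

theorem mul_rpow_neg_le {a h α : ℝ} (hh : 0 < h) (ha : a ≤ h ^ α) : a * h ^ (-α) ≤ 1 := by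
  rw [Real.rpow_neg hh.le, ← div_eq_mul_inv]
  exact div_le_one_of_le₀ ha (by positivity)

/-- The perturbed laws belong to the family if the amplitude is compatible with both scales. -/
theorem exists_regime1_kernel (hdX : dX ≤ DX) {αY αX : ℝ} (hαY : 0 < αY) (hαX : 0 < αX) :
    ∃ L₀ : ℝ, 0 < L₀ ∧ ∀ (L : ℝ) (m m' : ℕ) (a : ℝ)
      (ω : (Fin dX → Fin m') × (Fin DY → Fin m) → Bool), L₀ ≤ L → 0 < m → 0 < m' → 0 ≤ a →
      a ≤ S.b / 2 → a ≤ ((m : ℝ)⁻¹) ^ αY → a ≤ ((m' : ℝ)⁻¹) ^ αX →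
      Regime1 DY DX dX αY αX L (gridMeasure DX dX m') (S.kernel a ω) := by
  obtain ⟨C₁, hC₁, hmem₁⟩ := exists_mem_holderBall DY αY
  obtain ⟨C₂, hC₂, hmem₂⟩ := exists_mem_holderBall DX αX
  obtain ⟨B₁, hB₁, hbump₁⟩ := exists_holderBound_bumpSum hαY.le S.contDiff_ψ S.tsupport_ψ
  obtain ⟨B₂, hB₂, hbump₂⟩ := exists_holderBound_bumpSum hαX.le S.contDiff_φ S.tsupport_φ
  obtain ⟨B₀, hB₀, hu₀⟩ := exists_norm_iteratedFDeriv_le S.contDiff_u₀ S.hasCompactSupport_u₀ ⌈αY⌉₊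
  have hu₀y := HolderBound.of_bounded hαY.le hB₀.le S.contDiff_u₀ hu₀
  have hu₀x : ∀ y, HolderBound αX (2 * B₀) fun _ : Euc DX => S.u₀ y := by
    intro y
    refine HolderBound.of_bounded hαX.le hB₀.le contDiff_const fun k _ x => ?_
    have h0 := hu₀ 0 (Nat.zero_le _) y
    rw [norm_iteratedFDeriv_zero] at h0
    rcases Nat.eq_zero_or_pos k with rfl | hk
    · rwa [norm_iteratedFDeriv_zero]
    · rw [iteratedFDeriv_const_of_ne hk.ne']
      simpa using hB₀.le
  refine ⟨C₁ * (2 * B₀ + B₁) + C₂ * (2 * B₀ + B₂) + ((DY : ℝ) + 3) + ((DX : ℝ) + 1)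
    + (2 * ((DX : ℝ) + 1)) ^ dX, by positivity, fun L m m' a ω hL hm hm' ha hab haY haX => ?_⟩
  have hp1 : 0 ≤ C₁ * (2 * B₀ + B₁) := by positivity
  have hp2 : 0 ≤ C₂ * (2 * B₀ + B₂) := by positivity
  have hp3 : 0 ≤ (2 * ((DX : ℝ) + 1)) ^ dX := by positivity
  have hp4 : (0 : ℝ) ≤ DX := Nat.cast_nonneg _
  have hp5 : (0 : ℝ) ≤ DY := Nat.cast_nonneg _
  have hm0 := inv_pos_of_grid hm
  have hm0' := inv_pos_of_grid hm'
  have hprob := isProbabilityMeasure_gridMeasure (D := DX) (d := dX) hm'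
  have hmark := S.isMarkovKernel_kernel (ω := ω) hdX hm hm' ha hab
  have hsupp := support_gridMeasure_subset (D := DX) (d := dX) (m := m')
  have hmink := minkowskiDimAtMost_range_gridPt (m := m') hdX (L := L) (by linarith) (by linarith)
  refine ⟨hprob, hmark, ⟨hsupp.trans hmink.1, fun ε h0 h1 P hP => hmink.2 ε h0 h1 P
    (hP.trans hsupp)⟩, ?_, fun y x => S.dens a ω x y, fun x _ =>
    ⟨fun y => S.dens_nonneg hdX hm hm' ha hab x y, S.kernel_apply x⟩, fun x _ => ?_, fun y _ => ?_⟩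
  · have hball : Metric.closedBall (0 : Euc DY) ((DY : ℝ) + 2) ⊆ Metric.ball 0 L :=
      Metric.closedBall_subset_ball (by linarith)
    refine (Measure.support_subset_of_isClosed Metric.isClosed_closedBall ?_).trans hball
    have hms : MeasurableSet (Metric.closedBall (0 : Euc DY) ((DY : ℝ) + 2))ᶜ :=
      Metric.isClosed_closedBall.measurableSet.compl
    rw [mem_ae_iff, Measure.snd_compProd, Measure.bind_apply hms
      (Kernel.measurable _).aemeasurable, lintegral_eq_zero_iff (Kernel.measurable_coe _ hms)]
    refine Filter.Eventually.of_forall fun x => ?_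
    simp only [Pi.zero_apply]
    rw [S.kernel_apply, withDensity_apply _ hms]
    refine setLIntegral_eq_zero hms fun y hy => ?_
    have hy' : (DY : ℝ) + 2 < ‖y‖ := by simpa using hy
    have h0 : ∀ k : Fin DY → Fin m, S.yBump k y = 0 := by
      intro k
      by_contra h
      have := S.norm_le_of_yBump_ne_zero' k hm h
      linarith
    rw [S.dens_of_forall h0, S.u₀_eq_zero y hy', ENNReal.ofReal_zero]
    rfl
  · refine ⟨S.dens a ω x, ?_, fun y _ => rfl⟩
    have h1 := hbump₁ _ (m : ℝ)⁻¹ (gridPt DY DY m) a (fun k => a * S.coef ω k x) hm0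
      (inv_le_one_of_grid hm) (fun i j hij => le_norm_gridPt_sub le_rfl hij) ha fun k => by
        rw [abs_mul, abs_of_nonneg ha]
        exact mul_le_of_le_one_right ha (S.abs_coef_le ω hdX hm' k x)
    have h2 : a * B₁ * ((m : ℝ)⁻¹) ^ (-αY) ≤ B₁ := by
      have := mul_rpow_neg_le hm0 haY
      nlinarith
    have h3 := (hu₀y.add (h1.mono h2)).mono (B := L / C₁) (by
      rw [le_div_iff₀ (by linarith), mul_comm]
      linarith)
    have h4 := hmem₁ (L / C₁) _ (div_nonneg (by linarith) (by linarith)) h3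
    rwa [mul_div_cancel₀ _ (by linarith : C₁ ≠ 0)] at h4
  · refine ⟨fun x => S.dens a ω x y, ?_, fun x _ => rfl⟩
    have h1 := hbump₂ _ (m' : ℝ)⁻¹ (gridPt DX dX m') a
      (fun j => a * bumpSum S.ψ (m : ℝ)⁻¹ (gridPt DY DY m) (fun k => boolSign (ω (j, k))) y) hm0'
      (inv_le_one_of_grid hm') (fun i j hij => le_norm_gridPt_sub hdX hij) ha fun j => by
        rw [abs_mul, abs_of_nonneg ha]
        refine mul_le_of_le_one_right ha ?_
        have := abs_bumpSum_le S.tsupport_ψ hm0 (fun i j hij => le_norm_gridPt_sub le_rfl hij)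
          zero_le_one (c := fun k => boolSign (ω (j, k))) (fun k => (abs_boolSign _).le)
          S.abs_ψ_le y
        rwa [one_mul] at this
    have h2 : a * B₂ * ((m' : ℝ)⁻¹) ^ (-αX) ≤ B₂ := by
      have := mul_rpow_neg_le hm0' haX
      nlinarith
    have h3 := ((hu₀x y).add (h1.mono h2)).mono (B := L / C₂) (by
      rw [le_div_iff₀ (by linarith), mul_comm]
      linarith)
    have h4 := hmem₂ (L / C₂) _ (div_nonneg (by linarith) (by linarith)) h3
    rw [mul_div_cancel₀ _ (by linarith : C₂ ≠ 0)] at h4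
    have h5 : (fun x => S.dens a ω x y) = fun x => S.u₀ y + bumpSum S.φ (m' : ℝ)⁻¹
        (gridPt DX dX m') (fun j => a * bumpSum S.ψ (m : ℝ)⁻¹ (gridPt DY DY m)
          (fun k => boolSign (ω (j, k))) y) x := funext fun x => S.dens_eq_bumpSum a ω x y
    rw [h5]
    exact h4

/-- Testing with signed sums of bumps shows that the metric dominates the total error of the mean
values of the bumps. -/
theorem exists_le_holderIPM {γ : ℝ} (hγ : 0 ≤ γ) :
    ∃ c : ℝ, 0 < c ∧ ∀ (m : ℕ) (μ ν : Measure (Euc DY)), 0 < m → IsProbabilityMeasure μ →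
      IsProbabilityMeasure ν →
      ENNReal.ofReal (c * ((m : ℝ)⁻¹) ^ γ * ∑ k : Fin DY → Fin m,
        |∫ y, S.yBump k y ∂μ - ∫ y, S.yBump k y ∂ν|) ≤ holderIPM γ μ ν := by
  obtain ⟨C, hC, hmem⟩ := exists_mem_holderBall DY γ
  obtain ⟨B, hB, hbump⟩ := exists_holderBound_bumpSum hγ S.contDiff_ψ S.tsupport_ψ
  have hC0 : 0 < C := by linarith
  refine ⟨1 / (C * B), by positivity, fun m μ ν hm _ _ => ?_⟩
  have hm0 := inv_pos_of_grid hm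
  set h : ℝ := (m : ℝ)⁻¹ with hh
  set τ : ℝ := 1 / (C * B) * h ^ γ with hτ
  have hτ0 : 0 < τ := by positivity
  set z : (Fin DY → Fin m) → ℝ := fun k => ∫ y, S.yBump k y ∂μ - ∫ y, S.yBump k y ∂ν with hz
  set σ : (Fin DY → Fin m) → ℝ := fun k => if 0 ≤ z k then 1 else -1 with hσ
  have hσ1 : ∀ k, |σ k| = 1 := fun k => by simp only [hσ]; split_ifs <;> simp
  have hσz : ∀ k, σ k * z k = |z k| := fun k => by
    simp only [hσ]
    split_ifs with h0
    · rw [one_mul, abs_of_nonneg h0]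
    · rw [abs_of_neg (not_le.1 h0)]; ring
  set f := bumpSum S.ψ h (gridPt DY DY m) (fun k => τ * σ k) with hf
  have hfb : HolderBound γ (1 / C) f := by
    refine (hbump _ h (gridPt DY DY m) τ (fun k => τ * σ k) hm0 (inv_le_one_of_grid hm)
      (fun i j hij => le_norm_gridPt_sub le_rfl hij) hτ0.le fun k => ?_).mono (le_of_eq ?_)
    · rw [abs_mul, hσ1, mul_one, abs_of_pos hτ0]
    · have : h ^ γ * h ^ (-γ) = 1 := by rw [← Real.rpow_add hm0]; simp
      calc τ * B * h ^ (-γ) = 1 / C * (h ^ γ * h ^ (-γ)) := by rw [hτ]; field_simp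
        _ = 1 / C := by rw [this, mul_one]
  have hfm : f ∈ HolderBall DY γ 1 := by
    have := hmem (1 / C) f (by positivity) hfb
    rwa [mul_one_div_cancel hC0.ne'] at this
  have hint : ∀ (ν : Measure (Euc DY)), IsProbabilityMeasure ν →
      ∫ y, f y ∂ν = ∑ k, τ * σ k * ∫ y, S.yBump k y ∂ν := by
    intro ν _
    have hi : ∀ k : Fin DY → Fin m, Integrable (S.yBump k) ν := fun k =>
      (integrable_const (1 : ℝ)).mono' (S.continuous_yBump k).aestronglyMeasurable
        (Filter.Eventually.of_forall fun y => S.abs_yBump_le k y)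
    have e : f = fun y => ∑ k, τ * σ k * S.yBump k y := rfl
    rw [e, integral_finsetSum _ fun k _ => (hi k).const_mul _]
    simp only [integral_const_mul]
  refine le_trans (le_of_eq ?_) (le_iSup_of_le f (le_iSup_of_le hfm (le_iSup_of_le
    hfb.contDiff.continuous.measurable le_rfl)))
  congr 1
  rw [hint μ inferInstance, hint ν inferInstance, ← Finset.sum_sub_distrib]
  have e : ∀ k, τ * σ k * ∫ y, S.yBump k y ∂μ - τ * σ k * ∫ y, S.yBump k y ∂ν = τ * |z k| := by
    intro k
    rw [← mul_sub, mul_assoc, hσz]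
  rw [Finset.sum_congr rfl fun k _ => e k, ← Finset.mul_sum, abs_of_nonneg]
  exact mul_nonneg hτ0.le (Finset.sum_nonneg fun k _ => abs_nonneg _)

/-- The total risk over all sign vectors. -/
theorem exists_le_sum_ipmRisk (hdX : dX ≤ DX) {γ : ℝ} (hγ : 0 ≤ γ) :
    ∃ c₁ c₂ : ℝ, 0 < c₁ ∧ 0 < c₂ ∧ ∀ (n m m' : ℕ) (a : ℝ) (est : CondEstimator DY DX n),
      IsMarkovKernel est → 0 < n → 0 < m → 0 < m' → 0 ≤ a → a ≤ S.b / 2 →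
      n * a ^ 2 ≤ c₁ * ((m : ℝ) ^ DY * (m' : ℝ) ^ dX) →
      Fintype.card ((Fin dX → Fin m') × (Fin DY → Fin m) → Bool)
        * ENNReal.ofReal (c₂ * (a * ((m : ℝ)⁻¹) ^ γ))
        ≤ ∑ ω : (Fin dX → Fin m') × (Fin DY → Fin m) → Bool,
          ipmRisk γ est (gridMeasure DX dX m') (S.kernel a ω) := by
  obtain ⟨c, hc, hipm⟩ := S.exists_le_holderIPM hγ
  set s := ∫ y, S.ψ y ^ 2 with hs
  have hs0 : 0 < s := S.integral_ψ_sq_pos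
  have hb := S.b_pos
  refine ⟨S.b / (40 * s), c * s / 2, by positivity, by positivity,
    fun n m m' a est hest hn hm hm' ha hab hchi => ?_⟩
  have hm0 := inv_pos_of_grid hm
  have hn' : (0 : ℝ) < n := Nat.cast_pos.2 hn
  have hmr : (0 : ℝ) < m := Nat.cast_pos.2 hm
  have hmr' : (0 : ℝ) < m' := Nat.cast_pos.2 hm'
  have hprob := isProbabilityMeasure_gridMeasure (D := DX) (d := dX) hm'
  have hmark : ∀ ω : (Fin dX → Fin m') × (Fin DY → Fin m) → Bool,
      IsMarkovKernel (S.kernel a ω) := fun ω =>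
    S.isMarkovKernel_kernel hdX hm hm' ha hab
  set Δ := a * (((m : ℝ)⁻¹) ^ DY * s) with hΔ
  set T : (Fin dX → Fin m') × (Fin DY → Fin m) → (Fin n → Euc DX × Euc DY) → ℝ := fun q t =>
    ∫ y, S.yBump q.2 y ∂(est (t, gridPt DX dX m' q.1)) with hT
  have hTm : ∀ q, Measurable (T q) := fun q =>
    (measurable_condMean (κ := est) (S.continuous_yBump q.2).measurable).comp
      (measurable_id.prodMk measurable_const)
  have hass := assouad hn (fun ω => gridMeasure DX dX m' ⊗ₘ S.kernel a ω) T hTm (Δ := Δ)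
    fun ω q => ⟨fun p => ENNReal.ofReal (S.dens a (Function.update ω q (!ω q)) p.1 p.2
        / S.dens a ω p.1 p.2),
      (S.continuous_uncurry_dens.measurable.div
        S.continuous_uncurry_dens.measurable).ennreal_ofReal,
      fun _ => ENNReal.ofReal_ne_top,
      S.compProd_kernel_eq_withDensity hdX hm hm' ha hab _ _, by
        refine (S.lintegral_ratio_sq_le hdX hm hm' ha hab q).trans (ENNReal.ofReal_le_ofReal ?_)
        have : 8 * a ^ 2 / S.b * (((m : ℝ)⁻¹) ^ DY * s) / (m' : ℝ) ^ dX ≤ 1 / (5 * n) := by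
          have e : 8 * a ^ 2 / S.b * (((m : ℝ)⁻¹) ^ DY * s) / (m' : ℝ) ^ dX
              = 8 * s * (n * a ^ 2) / (n * S.b * ((m : ℝ) ^ DY * (m' : ℝ) ^ dX)) := by
            rw [inv_pow]; field_simp
          rw [e, div_le_div_iff₀ (by positivity) (by positivity)]
          calc 8 * s * (n * a ^ 2) * (5 * n)
              ≤ 8 * s * (S.b / (40 * s) * ((m : ℝ) ^ DY * (m' : ℝ) ^ dX)) * (5 * n) := by gcongr
            _ = _ := by field_simp; ring
        linarith⟩
  set τ := c * ((m : ℝ)⁻¹) ^ γ with hτ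
  have hτ0 : 0 < τ := by positivity
  set K : ℝ≥0∞ := ((m' : ℝ≥0∞) ^ dX)⁻¹ * ENNReal.ofReal τ with hK
  have hrisk : ∀ ω : (Fin dX → Fin m') × (Fin DY → Fin m) → Bool,
      K * ∫⁻ t, ∑ q, ENNReal.ofReal |boolSign (ω q) * Δ - T q t|
        ∂(Measure.pi fun _ : Fin n => gridMeasure DX dX m' ⊗ₘ S.kernel a ω)
      ≤ ipmRisk γ est (gridMeasure DX dX m') (S.kernel a ω) := by
    intro ω
    refine (lintegral_const_mul_le _ _).trans (lintegral_mono fun t => ?_)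
    simp only [lintegral_gridMeasure]
    rw [hK, mul_assoc]
    gcongr
    rw [Fintype.sum_prod_type, Finset.mul_sum]
    refine Finset.sum_le_sum fun j _ => ?_
    rw [← ENNReal.ofReal_sum_of_nonneg fun k _ => abs_nonneg _, ← ENNReal.ofReal_mul hτ0.le]
    refine le_trans (le_of_eq ?_) (hipm m _ _ hm ((hmark ω).isProbabilityMeasure _)
      (hest.isProbabilityMeasure _))
    simp only [S.integral_yBump_kernel hdX hm hm' ha hab j]
    rfl
  calc _ = K * (Fintype.card ((Fin dX → Fin m') × (Fin DY → Fin m) → Bool)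
        * (Fintype.card ((Fin dX → Fin m') × (Fin DY → Fin m)) * ENNReal.ofReal (Δ / 2))) := by
        have e1 : ENNReal.ofReal (c * s / 2 * (a * ((m : ℝ)⁻¹) ^ γ))
            = K * (Fintype.card ((Fin dX → Fin m') × (Fin DY → Fin m))
              * ENNReal.ofReal (Δ / 2)) := by
          have hM : (0 : ℝ) < (m' : ℝ) ^ dX := by positivity
          have hK' : K = ENNReal.ofReal (((m' : ℝ) ^ dX)⁻¹ * τ) := by
            rw [hK, ENNReal.ofReal_mul (p := ((m' : ℝ) ^ dX)⁻¹) (by positivity),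
              ENNReal.ofReal_inv_of_pos hM,
              ENNReal.ofReal_pow (Nat.cast_nonneg _), ENNReal.ofReal_natCast]
          rw [hK', ← ENNReal.ofReal_natCast, ← ENNReal.ofReal_mul (Nat.cast_nonneg _),
            ← ENNReal.ofReal_mul (by positivity)]
          congr 1
          rw [Fintype.card_prod, Fintype.card_pi_const, Fintype.card_pi_const, Fintype.card_fin,
            Fintype.card_fin, hΔ, hτ, inv_pow]
          push_cast
          field_simp
        rw [e1]
        ring
    _ ≤ K * ∑ ω, ∫⁻ t, ∑ q, ENNReal.ofReal |boolSign (ω q) * Δ - T q t|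
          ∂(Measure.pi fun _ : Fin n => gridMeasure DX dX m' ⊗ₘ S.kernel a ω) := by gcongr
    _ ≤ _ := by
        rw [Finset.mul_sum]
        exact Finset.sum_le_sum fun ω _ => hrisk ω

end Perturbation

/-- The lower bound for perturbations of amplitude `a` at the scales `1 / m` in the response and
`1 / m'` in the covariate. -/
theorem exists_le_condMinimaxRisk {DY DX dX : ℕ} (hDY : 1 ≤ DY) (hdX : dX ≤ DX) {αY αX γ : ℝ}
    (hαY : 0 < αY) (hαX : 0 < αX) (hγ : 0 ≤ γ) :
    ∃ L₀ c₁ c₂ : ℝ, 0 < L₀ ∧ 0 < c₁ ∧ c₁ ≤ 1 ∧ 0 < c₂ ∧ ∀ (L : ℝ) (n m m' : ℕ) (a : ℝ),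
      L₀ ≤ L → 0 < n → 0 < m → 0 < m' → 0 ≤ a → a ≤ c₁ * ((m : ℝ)⁻¹) ^ αY →
      a ≤ c₁ * ((m' : ℝ)⁻¹) ^ αX → n * a ^ 2 ≤ c₁ * ((m : ℝ) ^ DY * (m' : ℝ) ^ dX) →
      ENNReal.ofReal (c₂ * (a * ((m : ℝ)⁻¹) ^ γ)) ≤ condMinimaxRisk DY DX dX αY αX L γ n := by
  obtain ⟨S⟩ := nonempty_perturbation hDY DX
  obtain ⟨L₀, hL₀, hreg⟩ := S.exists_regime1_kernel hdX hαY hαX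
  obtain ⟨c₁, c₂, hc₁, hc₂, hrisk⟩ := S.exists_le_sum_ipmRisk hdX hγ
  have hb := S.b_pos
  refine ⟨L₀, min (min 1 (S.b / 2)) c₁, c₂, hL₀, lt_min (lt_min one_pos (by positivity)) hc₁,
    (min_le_left _ _).trans (min_le_left _ _), hc₂,
    fun L n m m' a hL hn hm hm' ha haY haX hchi => ?_⟩
  set c := min (min 1 (S.b / 2)) c₁ with hc
  have hcle1 : c ≤ 1 := (min_le_left _ _).trans (min_le_left _ _)
  have hcleb : c ≤ S.b / 2 := (min_le_left _ _).trans (min_le_right _ _)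
  have hclec : c ≤ c₁ := min_le_right _ _
  have hc0 : 0 < c := lt_min (lt_min one_pos (by positivity)) hc₁
  have hm0 := Perturbation.inv_pos_of_grid hm
  have hm0' := Perturbation.inv_pos_of_grid hm'
  have hpow : ((m : ℝ)⁻¹) ^ αY ≤ 1 :=
    Real.rpow_le_one hm0.le (Perturbation.inv_le_one_of_grid hm) hαY.le
  have hpY : 0 ≤ ((m : ℝ)⁻¹) ^ αY := by positivity
  have hpX : 0 ≤ ((m' : ℝ)⁻¹) ^ αX := by positivity
  have hab : a ≤ S.b / 2 := by nlinarith
  refine le_iInf fun est => le_iInf fun hest => ?_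
  set Z := ⨆ (μX : Measure (Euc DX)) (κ : Kernel (Euc DX) (Euc DY))
      (_ : Regime1 DY DX dX αY αX L μX κ), ipmRisk γ est μX κ with hZ
  have h1 : ∀ ω : (Fin dX → Fin m') × (Fin DY → Fin m) → Bool,
      ipmRisk γ est (gridMeasure DX dX m') (S.kernel a ω) ≤ Z := fun ω =>
    le_iSup_of_le _ (le_iSup_of_le _ (le_iSup_of_le
      (hreg L m m' a ω hL hm hm' ha hab (by nlinarith) (by nlinarith)) le_rfl))
  have h2 := (hrisk n m m' a est hest hn hm hm' ha hab (hchi.trans (by gcongr))).trans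
    (Finset.sum_le_sum fun ω _ => h1 ω)
  rw [Finset.sum_const, nsmul_eq_mul, Finset.card_univ] at h2
  exact (ENNReal.mul_le_mul_iff_right (by exact_mod_cast Fintype.card_ne_zero)
    (ENNReal.natCast_ne_top _)).1 h2

theorem natCeil_le_two_mul {x : ℝ} (hx : 1 ≤ x) : (⌈x⌉₊ : ℝ) ≤ 2 * x := by
  linarith [Nat.ceil_lt_add_one (by linarith : 0 ≤ x)]

/-- The amplitude `c * m' ^ (-αX)` is a multiple of `x ^ (-αX)` for `m' = ⌈x⌉`. -/
theorem le_inv_natCeil_rpow {x α : ℝ} (hx : 1 ≤ x) (hα : 0 ≤ α) :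
    2 ^ (-α) * x ^ (-α) ≤ ((⌈x⌉₊ : ℝ)⁻¹) ^ α := by
  have hpos : (0 : ℝ) < ⌈x⌉₊ := Nat.cast_pos.2 (Nat.ceil_pos.2 (by linarith))
  rw [← Real.mul_rpow (by norm_num) (by linarith), Real.inv_rpow hpos.le, ← Real.rpow_neg hpos.le]
  exact Real.rpow_le_rpow_of_nonpos hpos (natCeil_le_two_mul hx) (by linarith)

/-- The lower bound of the minimax risk: perturbations that depend on the covariate only give the
first rate, and perturbations in both variables the second one. -/
theorem exists_condMinimaxRisk_ge_rate {DY DX dX : ℕ} (hDY : 1 ≤ DY) (hdX : dX ≤ DX)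
    {αY αX γ : ℝ} (hαY : 0 < αY) (hαX : 0 < αX) (hγ : 0 ≤ γ) :
    ∃ L₀ C : ℝ, 0 < L₀ ∧ 0 < C ∧ ∀ (L : ℝ) (n : ℕ), L₀ ≤ L → 0 < n →
      ENNReal.ofReal (C * ((n : ℝ) ^ (-(αX / (2 * αX + dX)))
          + (n : ℝ) ^ (-((αY + γ) / (2 * αY + DY + αY / αX * dX)))))
        ≤ condMinimaxRisk DY DX dX αY αX L γ n := by
  obtain ⟨L₀, c₁, c₂, hL₀, hc₁, hc₁1, hc₂, h⟩ := exists_le_condMinimaxRisk (γ := γ) hDY hdX hαY hαX hγ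
  set P := 2 * αX + dX with hP
  set Q := 2 * αY + DY + αY / αX * dX with hQ
  have hP0 : 0 < P := by positivity
  have hQ0 : 0 < Q := by positivity
  set C₁ := c₂ * (c₁ * 2 ^ (-αX)) with hC₁
  set C₂ := c₂ * (c₁ * 2 ^ (-αX) * 2 ^ (-(αY + γ))) with hC₂
  have hC₁0 : 0 < C₁ := by positivity
  have hC₂0 : 0 < C₂ := by positivity
  refine ⟨L₀, min C₁ C₂ / 2, hL₀, by positivity, fun L n hL hn => ?_⟩
  have hn1 : (1 : ℝ) ≤ n := by exact_mod_cast hn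
  have hn0 : (0 : ℝ) < n := by linarith
  have hlow₁ : ENNReal.ofReal (C₁ * (n : ℝ) ^ (-(αX / P)))
      ≤ condMinimaxRisk DY DX dX αY αX L γ n := by
    set x := (n : ℝ) ^ (1 / P) with hx
    have hx1 : 1 ≤ x := Real.one_le_rpow hn1 (by positivity)
    set m' := ⌈x⌉₊ with hm'
    have hm'pos : 0 < m' := Nat.ceil_pos.2 (by linarith)
    have hm'r : (1 : ℝ) ≤ m' := by exact_mod_cast hm'pos
    have hxm : x ≤ m' := Nat.le_ceil x
    have hpow : ((m' : ℝ)⁻¹) ^ αX ≤ 1 :=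
      Real.rpow_le_one (by positivity) (inv_le_one_of_one_le₀ hm'r) hαX.le
    have hnle : (n : ℝ) * (((m' : ℝ)⁻¹) ^ αX) ^ 2 ≤ (m' : ℝ) ^ dX := by
      have h1 : (n : ℝ) ≤ (m' : ℝ) ^ P := by
        calc (n : ℝ) = x ^ P := by
              rw [hx, ← Real.rpow_mul hn0.le, one_div_mul_cancel hP0.ne', Real.rpow_one]
          _ ≤ _ := by gcongr
      have h2 : (m' : ℝ) ^ P * (((m' : ℝ)⁻¹) ^ αX) ^ 2 = (m' : ℝ) ^ dX := by
        rw [Real.inv_rpow (by positivity), ← Real.rpow_neg (by positivity), ← Real.rpow_natCast,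
          ← Real.rpow_mul (by positivity), ← Real.rpow_add (by positivity), ← Real.rpow_natCast]
        congr 1
        rw [hP]; push_cast; ring
      calc _ ≤ (m' : ℝ) ^ P * (((m' : ℝ)⁻¹) ^ αX) ^ 2 := by gcongr
        _ = _ := h2
    refine le_trans (ENNReal.ofReal_le_ofReal ?_) (h L n 1 m' (c₁ * ((m' : ℝ)⁻¹) ^ αX) hL hn one_pos
      hm'pos (by positivity) ?_ le_rfl ?_)
    · have h1 := le_inv_natCeil_rpow hx1 hαX.le
      rw [← hm'] at h1
      have h2 : x ^ (-αX) = (n : ℝ) ^ (-(αX / P)) := by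
        rw [hx, ← Real.rpow_mul hn0.le]; congr 1; ring
      rw [h2] at h1
      rw [hC₁, Nat.cast_one, inv_one, Real.one_rpow, mul_one, mul_assoc, mul_assoc]
      gcongr
    · rw [Nat.cast_one, inv_one, Real.one_rpow]
      gcongr
    · rw [Nat.cast_one, one_pow, one_mul, mul_pow]
      calc (n : ℝ) * (c₁ ^ 2 * (((m' : ℝ)⁻¹) ^ αX) ^ 2)
          = c₁ * (c₁ * (n * (((m' : ℝ)⁻¹) ^ αX) ^ 2)) := by ring
        _ ≤ c₁ * (1 * (m' : ℝ) ^ dX) := by gcongr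
        _ = _ := by rw [one_mul]
  have hlow₂ : ENNReal.ofReal (C₂ * (n : ℝ) ^ (-((αY + γ) / Q)))
      ≤ condMinimaxRisk DY DX dX αY αX L γ n := by
    set w := (n : ℝ) ^ (1 / Q) with hw
    have hw1 : 1 ≤ w := Real.one_le_rpow hn1 (by positivity)
    set m := ⌈w⌉₊ with hm
    have hmpos : 0 < m := Nat.ceil_pos.2 (by linarith)
    have hmr : (1 : ℝ) ≤ m := by exact_mod_cast hmpos
    have hwm : w ≤ m := Nat.le_ceil w
    set x := (m : ℝ) ^ (αY / αX) with hx
    have hx1 : 1 ≤ x := Real.one_le_rpow hmr (by positivity)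
    set m' := ⌈x⌉₊ with hm'
    have hm'pos : 0 < m' := Nat.ceil_pos.2 (by linarith)
    have hm'r : (1 : ℝ) ≤ m' := by exact_mod_cast hm'pos
    have hxm : x ≤ m' := Nat.le_ceil x
    have hxα : x ^ αX = (m : ℝ) ^ αY := by
      rw [hx, ← Real.rpow_mul (by positivity), div_mul_cancel₀ _ hαX.ne']
    have hle : ((m' : ℝ)⁻¹) ^ αX ≤ ((m : ℝ)⁻¹) ^ αY := by
      rw [Real.inv_rpow (by positivity), Real.inv_rpow (by positivity), ← hxα]
      gcongr
    have hnle : (n : ℝ) * (((m' : ℝ)⁻¹) ^ αX) ^ 2 ≤ (m : ℝ) ^ DY * (m' : ℝ) ^ dX := by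
      have h1 : (n : ℝ) ≤ (m : ℝ) ^ DY * (m' : ℝ) ^ P := by
        calc (n : ℝ) = w ^ Q := by
              rw [hw, ← Real.rpow_mul hn0.le, one_div_mul_cancel hQ0.ne', Real.rpow_one]
          _ ≤ (m : ℝ) ^ Q := by gcongr
          _ = (m : ℝ) ^ DY * x ^ P := by
              rw [hx, ← Real.rpow_mul (by positivity), ← Real.rpow_natCast,
                ← Real.rpow_add (by positivity)]
              congr 1
              rw [hQ, hP]; field_simp; ring
          _ ≤ _ := by gcongr
      have h2 : (m' : ℝ) ^ P * (((m' : ℝ)⁻¹) ^ αX) ^ 2 = (m' : ℝ) ^ dX := by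
        rw [Real.inv_rpow (by positivity), ← Real.rpow_neg (by positivity), ← Real.rpow_natCast,
          ← Real.rpow_mul (by positivity), ← Real.rpow_add (by positivity), ← Real.rpow_natCast]
        congr 1
        rw [hP]; push_cast; ring
      calc _ ≤ (m : ℝ) ^ DY * (m' : ℝ) ^ P * (((m' : ℝ)⁻¹) ^ αX) ^ 2 := by gcongr
        _ = _ := by rw [mul_assoc, h2]
    refine le_trans (ENNReal.ofReal_le_ofReal ?_) (h L n m m' (c₁ * ((m' : ℝ)⁻¹) ^ αX) hL hn hmpos
      hm'pos (by positivity) (by gcongr) le_rfl ?_)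
    · have h1 := le_inv_natCeil_rpow hx1 hαX.le
      rw [← hm', Real.rpow_neg (by linarith : 0 ≤ x), hxα,
        ← Real.rpow_neg (by linarith : (0 : ℝ) ≤ m)] at h1
      have h2 := le_inv_natCeil_rpow hw1 (add_nonneg hαY.le hγ)
      rw [← hm] at h2
      have h3 : w ^ (-(αY + γ)) = (n : ℝ) ^ (-((αY + γ) / Q)) := by
        rw [hw, ← Real.rpow_mul hn0.le]; congr 1; ring
      rw [h3] at h2
      have h4 : (m : ℝ) ^ (-αY) * ((m : ℝ)⁻¹) ^ γ = ((m : ℝ)⁻¹) ^ (αY + γ) := by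
        rw [Real.rpow_neg (by linarith), ← Real.inv_rpow (by linarith),
          Real.rpow_add (by positivity)]
      calc C₂ * (n : ℝ) ^ (-((αY + γ) / Q))
          = c₂ * (c₁ * (2 ^ (-αX) * (2 ^ (-(αY + γ)) * (n : ℝ) ^ (-((αY + γ) / Q))))) := by
            rw [hC₂]; ring
        _ ≤ c₂ * (c₁ * (2 ^ (-αX) * ((m : ℝ)⁻¹) ^ (αY + γ))) := by gcongr
        _ = c₂ * (c₁ * (2 ^ (-αX) * (m : ℝ) ^ (-αY)) * ((m : ℝ)⁻¹) ^ γ) := by rw [← h4]; ring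
        _ ≤ _ := by gcongr
    · rw [mul_pow]
      calc (n : ℝ) * (c₁ ^ 2 * (((m' : ℝ)⁻¹) ^ αX) ^ 2)
          = c₁ * (c₁ * (n * (((m' : ℝ)⁻¹) ^ αX) ^ 2)) := by ring
        _ ≤ c₁ * (1 * ((m : ℝ) ^ DY * (m' : ℝ) ^ dX)) := by gcongr
        _ = _ := by rw [one_mul]
  set X := (n : ℝ) ^ (-(αX / P))
  set Y := (n : ℝ) ^ (-((αY + γ) / Q))
  have hX : 0 ≤ X := by positivity
  have hY : 0 ≤ Y := by positivity
  rcases le_total X Y with hXY | hXY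
  · refine le_trans (ENNReal.ofReal_le_ofReal ?_) hlow₂
    calc min C₁ C₂ / 2 * (X + Y) ≤ C₂ / 2 * (Y + Y) := by
          gcongr
          exact min_le_right _ _
      _ = C₂ * Y := by ring
  · refine le_trans (ENNReal.ofReal_le_ofReal ?_) hlow₁
    calc min C₁ C₂ / 2 * (X + Y) ≤ C₁ / 2 * (X + X) := by
          gcongr
          exact min_le_left _ _
      _ = C₁ * X := by ring

end

theorem theorem1 (DY DX dX : ℕ) (hDY : 1 ≤ DY) (hDX : 1 ≤ DX) (hdX : dX ≤ DX)
    (αY αX : ℝ) (hαY : 0 < αY) (hαX : 0 < αX) (γ : ℝ) (hγ : 0 ≤ γ) :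
    ∃ L₀ : ℝ, 0 < L₀ ∧ ∀ L : ℝ, L₀ ≤ L →
      ∃ C : ℝ, 0 < C ∧ ∃ C₁ : ℝ, 0 < C₁ ∧ ∀ n : ℕ, L₀ ≤ n →
        ENNReal.ofReal (C * ((n : ℝ) ^ (-(αX / (2 * αX + dX)))
            + (n : ℝ) ^ (-((αY + γ) / (2 * αY + DY + αY / αX * dX)))))
          ≤ condMinimaxRisk DY DX dX αY αX L γ n ∧
        condMinimaxRisk DY DX dX αY αX L γ n
          ≤ ENNReal.ofReal (C₁ * (logFactor DY dX αX γ n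
                * ((n : ℝ) / Real.log n) ^ (-(αX / (2 * αX + dX)))
            + ((n : ℝ) / Real.log n) ^ (-((αY + γ) / (2 * αY + DY + αY / αX * dX))))) := by
  obtain ⟨L₀, C, hL₀, hC, hlow⟩ := exists_condMinimaxRisk_ge_rate (γ := γ) hDY hdX hαY hαX hγ
  refine ⟨L₀ + 3, by linarith, fun L hL => ?_⟩
  obtain ⟨C₁, hC₁, hup⟩ := exists_condMinimaxRisk_le_rate (DY := DY) (DX := DX) (dX := dX) (L := L)
    hαY hαX (by linarith) hγ
  refine ⟨C, hC, C₁, hC₁, fun n hn => ?_⟩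
  have hn3 : 3 ≤ n := by
    have : (3 : ℝ) ≤ n := by linarith
    exact_mod_cast this
  exact ⟨hlow L n (by linarith) (by omega), hup n hn3⟩
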